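/- Let $S$ be the four-holed sphere, presented as a closed round disk in the oriented plane with three open round holes in a row from left to right. Let $a,b,c$ be curves parallel to the boundaries of the first, second and third hole, $d$ a curve parallel to the outer boundary, $e$ a round curve enclosing exactly the first two holes, and $f$ a round curve enclosing exactly the last two holes. Write $\tau_x\in \mathrm{Map}(S,\partial S)$ for the right-handed Dehn twist about $x$; in a product the left factor is applied first. Let $\sigma_1,\sigma_2$ be the standard generators of the braid group on three strands, where $\sigma_i$ is a right-handed half twist of the strands $i$ and $i+1$, so that $(\sigma_2\sigma_1\sigma_2)^2$ is the full right-handed twist. Let $\alpha,\beta,\gamma,\delta$ be integers, $k\ge 0$, and $\epsilon_1,\eta_1,\dots,\epsilon_k,\eta_k$ integers, with $\epsilon=\sum_{i=1}^k\epsilon_i$ and $\eta=\sum_{i=1}^k\eta_i$. Let $\phi$ be a homeomorphism of $S$ fixing $\partial S$ pointwise whose mapping class relative to the boundary is $$\tau_a^{\alpha}\tau_b^{\beta}\tau_c^{\gamma}\tau_d^{\delta}\,\tau_e^{\epsilon_1}\tau_f^{\eta_1}\cdots\tau_e^{\epsilon_k}\tau_f^{\eta_k}.$$ Let $Y$ be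 the closed oriented 3-manifold given by the open book $(S,\phi)$, that is, the quotient of $S\times[0,1]$ by $(x,1)\sim(\phi(x),0)$ for $x\in S$ and $(x,s)\sim(x,t)$ for $x\in\partial S$ and $s,t\in[0,1]$, with the product orientation. Then the braid $$(\sigma_2\sigma_1\sigma_2)^{2\delta}\,\sigma_1^{2\epsilon_1}\sigma_2^{2\eta_1}\cdots\sigma_1^{2\epsilon_k}\sigma_2^{2\eta_k}$$ is pure, and $Y$ is obtained, up to orientation-preserving homeomorphism, by integral Dehn surgery in $S^3$ on its braid closure (the closure of any geometric pure braid representing it), where the components that come from the first, second and third strand have the surgery coefficients $$(\alpha+\delta+\epsilon,\ \ \beta+\delta+\epsilon+\eta,\ \ \gamma+\delta+\eta)$$ with respect to the Seifert framings. -/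

import Mathlib

open scoped unitInterval

noncomputable section

namespace OpenBookSurgery

/-! ### Mapping class groups of planar surfaces and open books -/

/-- Self-homeomorphisms of a planar region `S` that fix the boundary `∂S` pointwise. -/
def RelHomeo (S : Set ℂ) : Subgroup (S ≃ₜ S) where
  carrier := {f | ∀ x : S, (x : ℂ) ∈ frontier S → f x = x}
  one_mem' := fun _ _ => rfl
  mul_mem' := by
    intro f g hf hg x hx
    change f (g x) = x
    rw [hg x hx, hf x hx]
  inv_mem' := by
    intro f hf x hx
    change f.symm x = x
    rw [Homeomorph.symm_apply_eq]
    exact (hf x hx).symm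

/-- Isotopy relative to the boundary: a jointly continuous family of homeomorphisms fixing `∂S`. -/
def IsotopicRel (S : Set ℂ) (f g : RelHomeo S) : Prop :=
  ∃ F : I → RelHomeo S, Continuous (fun p : I × S => (F p.1 : S ≃ₜ S) p.2) ∧ F 0 = f ∧ F 1 = g

/-- The identity component: homeomorphisms isotopic to the identity relative to the boundary. -/
def IsotopicToId (S : Set ℂ) : Subgroup (RelHomeo S) where
  carrier := {f | IsotopicRel S 1 f}
  one_mem' := ⟨fun _ => 1, continuous_snd, rfl, rfl⟩
  mul_mem' := by
    rintro f g ⟨F, hF, hF0, hF1⟩ ⟨G, hG, hG0, hG1⟩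
    refine ⟨fun t => F t * G t, ?_, by simp [hF0, hG0], by simp [hF1, hG1]⟩
    exact hF.comp (continuous_fst.prodMk hG)
  inv_mem' := by
    rintro f ⟨F, hF, hF0, hF1⟩
    refine ⟨fun t => F (unitInterval.symm t) * f⁻¹, ?_, by simp [hF1], by simp [hF0]⟩
    exact hF.comp ((unitInterval.continuous_symm.comp continuous_fst).prodMk
      ((f⁻¹ : RelHomeo S).1.continuous.comp continuous_snd))

instance (S : Set ℂ) : (IsotopicToId S).Normal where
  conj_mem := by
    rintro f ⟨F, hF, hF0, hF1⟩ g
    refine ⟨fun t => g * F t * g⁻¹, ?_, by simp [hF0], by simp [hF1]⟩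
    exact (g.1.continuous.comp hF).comp (continuous_fst.prodMk
      ((g⁻¹ : RelHomeo S).1.continuous.comp continuous_snd))

/-- The mapping class group `Map(S, ∂S)`. The opposite multiplication implements the braid
convention for compositions: in `f * g` the class `f` is applied first. -/
abbrev MappingClassGroup (S : Set ℂ) := (RelHomeo S ⧸ IsotopicToId S)ᵐᵒᵖ

/-- The mapping class of a homeomorphism. -/
def mappingClass {S : Set ℂ} (f : RelHomeo S) : MappingClassGroup S :=
  MulOpposite.op (QuotientGroup.mk f)

/-- The identifications defining the manifold of the open book `(S, φ)`: the top `S × {1}` is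
glued to the bottom by `φ`, and each circle over a boundary point of the page is collapsed. -/
inductive OpenBookRel {S : Set ℂ} (φ : RelHomeo S) : S × I → S × I → Prop
  | glue (x : S) : OpenBookRel φ (x, 1) ((φ : S ≃ₜ S) x, 0)
  | collapse (x : S) (hx : (x : ℂ) ∈ frontier S) (s t : I) : OpenBookRel φ (x, s) (x, t)

/-- The 3-manifold given by the abstract open book `(S, φ)`. -/
def OpenBook {S : Set ℂ} (φ : RelHomeo S) : Type := Quot (OpenBookRel φ)

instance {S : Set ℂ} (φ : RelHomeo S) : TopologicalSpace (OpenBook φ) :=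
  inferInstanceAs (TopologicalSpace (Quot (OpenBookRel φ)))

/-! ### Dehn twists and the four-holed sphere -/

/-- The angle function of a twist: `2π` for `r ≤ r₁`, `0` for `r ≥ r₂`, linear in between. -/
def twistAngle (r₁ r₂ r : ℝ) : ℝ := 2 * Real.pi * max 0 (min 1 ((r₂ - r) / (r₂ - r₁)))

/-- Rotation of the circle of radius `r` about `c` by the angle `s * twistAngle r₁ r₂ r`. -/
def twistMap (c : ℂ) (r₁ r₂ s : ℝ) (z : ℂ) : ℂ :=
  c + (z - c) * Complex.exp ((s * twistAngle r₁ r₂ ‖z - c‖ : ℝ) * Complex.I)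

lemma norm_twistMap_sub (c : ℂ) (r₁ r₂ s : ℝ) (z : ℂ) :
    ‖twistMap c r₁ r₂ s z - c‖ = ‖z - c‖ := by
  simp only [twistMap, add_sub_cancel_left, norm_mul, Complex.norm_exp_ofReal_mul_I, mul_one]

lemma twistMap_twistMap (c : ℂ) (r₁ r₂ s : ℝ) (z : ℂ) :
    twistMap c r₁ r₂ (-s) (twistMap c r₁ r₂ s z) = z := by
  have h := norm_twistMap_sub c r₁ r₂ s z
  rw [twistMap, h]
  simp only [twistMap, add_sub_cancel_left, mul_assoc, ← Complex.exp_add]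
  simp

lemma continuous_twistMap (c : ℂ) (r₁ r₂ s : ℝ) : Continuous (twistMap c r₁ r₂ s) := by
  unfold twistMap twistAngle
  fun_prop

lemma twistMap_eq_self {c : ℂ} {r₁ r₂ s : ℝ} (hs : s = 1 ∨ s = -1) (hr : r₁ < r₂) {z : ℂ}
    (hz : ¬ (r₁ < ‖z - c‖ ∧ ‖z - c‖ < r₂)) : twistMap c r₁ r₂ s z = z := by
  have hpos : 0 < r₂ - r₁ := sub_pos.2 hr
  suffices h : Complex.exp ((s * twistAngle r₁ r₂ ‖z - c‖ : ℝ) * Complex.I) = 1 by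
    rw [twistMap, h, mul_one, add_sub_cancel]
  by_cases h1 : r₁ < ‖z - c‖
  · have h2 : r₂ ≤ ‖z - c‖ := by
      by_contra h
      exact hz ⟨h1, not_le.1 h⟩
    have h3 : (r₂ - ‖z - c‖) / (r₂ - r₁) ≤ 0 := div_nonpos_of_nonpos_of_nonneg (by linarith) hpos.le
    have h4 : twistAngle r₁ r₂ ‖z - c‖ = 0 := by
      rw [twistAngle, min_eq_right (by linarith), max_eq_left h3, mul_zero]
    simp [h4]
  · have h3 : 1 ≤ (r₂ - ‖z - c‖) / (r₂ - r₁) := by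
      rw [le_div_iff₀ hpos]
      linarith
    have h4 : twistAngle r₁ r₂ ‖z - c‖ = 2 * Real.pi := by
      rw [twistAngle, min_eq_left h3, max_eq_right zero_le_one, mul_one]
    rw [h4]
    rcases hs with rfl | rfl
    · simp
    · have := Complex.exp_neg (2 * Real.pi * Complex.I)
      rw [Complex.exp_two_pi_mul_I] at this
      simpa using this

lemma twistMap_mem {S : Set ℂ} {c : ℂ} {r₁ r₂ s : ℝ} (hs : s = 1 ∨ s = -1) (hr : r₁ < r₂)
    (hS : ∀ z, r₁ < ‖z - c‖ → ‖z - c‖ < r₂ → z ∈ S) {z : ℂ} (hz : z ∈ S) :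
    twistMap c r₁ r₂ s z ∈ S := by
  by_cases h : r₁ < ‖z - c‖ ∧ ‖z - c‖ < r₂
  · rw [← norm_twistMap_sub c r₁ r₂ s z] at h
    exact hS _ h.1 h.2
  · rwa [twistMap_eq_self hs hr h]

/-- The right-handed Dehn twist of `S` supported in the round annulus `r₁ < ‖z - c‖ < r₂`
contained in `S`, that is, the twist about the core circle of this annulus. An arc that crosses
the annulus turns to the right: the image of a radial ray leaving the inner circle turns clockwise
by `2π` until it reaches the outer circle. -/
def dehnTwist (S : Set ℂ) (c : ℂ) (r₁ r₂ : ℝ) (hr : r₁ < r₂)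
    (hS : ∀ z, r₁ < ‖z - c‖ → ‖z - c‖ < r₂ → z ∈ S) : RelHomeo S :=
  ⟨{ toFun := fun x => ⟨twistMap c r₁ r₂ 1 x, twistMap_mem (Or.inl rfl) hr hS x.2⟩
     invFun := fun x => ⟨twistMap c r₁ r₂ (-1) x, twistMap_mem (Or.inr rfl) hr hS x.2⟩
     left_inv := fun x => Subtype.ext (twistMap_twistMap c r₁ r₂ 1 x)
     right_inv := fun x => Subtype.ext (by simpa using twistMap_twistMap c r₁ r₂ (-1) x)
     continuous_toFun :=
       ((continuous_twistMap c r₁ r₂ 1).comp continuous_subtype_val).subtype_mk _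
     continuous_invFun :=
       ((continuous_twistMap c r₁ r₂ (-1)).comp continuous_subtype_val).subtype_mk _ }, by
    intro x hx
    refine Subtype.ext (twistMap_eq_self (Or.inl rfl) hr fun h => ?_)
    have ho : IsOpen {z : ℂ | r₁ < ‖z - c‖ ∧ ‖z - c‖ < r₂} :=
      IsOpen.and (isOpen_lt continuous_const (continuous_id.sub continuous_const).norm)
        (isOpen_lt (continuous_id.sub continuous_const).norm continuous_const)
    exact hx.2 (mem_interior.2 ⟨_, fun z hz => hS z hz.1 hz.2, ho, h⟩)⟩

/-- The four-holed sphere, as a disk with three round holes in a row. -/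
def fourHoledSphere : Set ℂ := {z | ‖z‖ ≤ 10 ∧ 1 ≤ ‖z + 4‖ ∧ 1 ≤ ‖z‖ ∧ 1 ≤ ‖z - 4‖}

lemma annulus_subset {c : ℝ} {r₁ r₂ : ℝ} (h0 : |c| + r₂ ≤ 10)
    (h1 : |c + 4| + 1 ≤ r₁ ∨ r₂ + 1 ≤ |c + 4|) (h2 : |c| + 1 ≤ r₁ ∨ r₂ + 1 ≤ |c|)
    (h3 : |c - 4| + 1 ≤ r₁ ∨ r₂ + 1 ≤ |c - 4|) (z : ℂ) (hz₁ : r₁ < ‖z - c‖)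
    (hz₂ : ‖z - c‖ < r₂) : z ∈ fourHoledSphere := by
  have key : ∀ p : ℝ, (|c - p| + 1 ≤ r₁ ∨ r₂ + 1 ≤ |c - p|) → 1 ≤ ‖z - p‖ := by
    intro p hp
    have e : ‖(c : ℂ) - p‖ = |c - p| := by
      rw [← Complex.ofReal_sub, Complex.norm_real, Real.norm_eq_abs]
    have t1 := norm_sub_le_norm_sub_add_norm_sub z (p : ℂ) (c : ℂ)
    have t2 := norm_sub_le_norm_sub_add_norm_sub (c : ℂ) z (p : ℂ)
    rw [norm_sub_rev (p : ℂ) c] at t1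
    rw [norm_sub_rev (c : ℂ) z] at t2
    rcases hp with hp | hp <;> linarith
  have ec : ‖(c : ℂ)‖ = |c| := by rw [Complex.norm_real, Real.norm_eq_abs]
  have t := norm_add_le (z - c) (c : ℂ)
  rw [sub_add_cancel] at t
  refine ⟨by linarith, ?_, ?_, ?_⟩
  · simpa using key (-4) (by simpa using h1)
  · simpa using key 0 (by simpa using h2)
  · simpa using key 4 (by simpa using h3)

/-- The mapping class of the right-handed Dehn twist of the four-holed sphere about the core of the
annulus `r₁ < ‖z - c‖ < r₂` with real centre `c`. -/
def twistClass (c r₁ r₂ : ℝ) (hr : r₁ < r₂) (h0 : |c| + r₂ ≤ 10)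
    (h1 : |c + 4| + 1 ≤ r₁ ∨ r₂ + 1 ≤ |c + 4|) (h2 : |c| + 1 ≤ r₁ ∨ r₂ + 1 ≤ |c|)
    (h3 : |c - 4| + 1 ≤ r₁ ∨ r₂ + 1 ≤ |c - 4|) : MappingClassGroup fourHoledSphere :=
  mappingClass (dehnTwist fourHoledSphere c r₁ r₂ hr (annulus_subset h0 h1 h2 h3))

/-- The twist about `a`, parallel to the boundary of the first hole. -/
def τa : MappingClassGroup fourHoledSphere :=
  twistClass (-4) 1 2 (by norm_num) (by norm_num [abs_of_nonpos]) (by norm_num)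
    (by norm_num [abs_of_nonpos]) (by norm_num [abs_of_nonpos])

/-- The twist about `b`, parallel to the boundary of the second hole. -/
def τb : MappingClassGroup fourHoledSphere :=
  twistClass 0 1 2 (by norm_num) (by norm_num) (by norm_num) (by norm_num) (by norm_num)

/-- The twist about `c`, parallel to the boundary of the third hole. -/
def τc : MappingClassGroup fourHoledSphere :=
  twistClass 4 1 2 (by norm_num) (by norm_num) (by norm_num) (by norm_num) (by norm_num)

/-- The twist about `d`, parallel to the outer boundary. -/
def τd : MappingClassGroup fourHoledSphere :=
  twistClass 0 9 10 (by norm_num) (by norm_num) (by norm_num) (by norm_num) (by norm_num)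

/-- The twist about `e`, which encloses the first and the second hole. -/
def τe : MappingClassGroup fourHoledSphere :=
  twistClass (-2) 3 4 (by norm_num) (by norm_num) (by norm_num) (by norm_num) (by norm_num)

/-- The twist about `f`, which encloses the second and the third hole. -/
def τf : MappingClassGroup fourHoledSphere :=
  twistClass 2 3 4 (by norm_num) (by norm_num) (by norm_num) (by norm_num) (by norm_num)

/-! ### Braids on three strands -/

/-- Ordered triples of distinct points of the plane. -/
abbrev Conf : Type := {x : Fin 3 → ℂ // Function.Injective x}

/-- Two ordered triples are equivalent if they have the same underlying set. -/
def confSetoid : Setoid Conf where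
  r x y := Set.range x.1 = Set.range y.1
  iseqv := ⟨fun _ => rfl, fun h => h.symm, fun h h' => h.trans h'⟩

/-- Unordered triples of distinct points of the plane. -/
abbrev UConf : Type := Quotient confSetoid

/-- Forgetting the order. -/
def forgetOrder : C(Conf, UConf) := ⟨Quotient.mk confSetoid, continuous_quot_mk⟩

/-- The base configuration: the centres of the three holes, from left to right. -/
def basePoint : Conf := ⟨![-4, 0, 4], by
  intro i j h
  fin_cases i <;> fin_cases j <;> first | rfl | (exfalso; norm_num at h)⟩

/-- The braid group on three strands. The opposite multiplication makes the product `x * y` the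
braid `x` followed by the braid `y`. -/
abbrev BraidGroup : Type := (FundamentalGroup UConf (forgetOrder basePoint))ᵐᵒᵖ

/-- The braid of a loop of unordered configurations. -/
def braidOfLoop (γ : Path (forgetOrder basePoint) (forgetOrder basePoint)) : BraidGroup :=
  MulOpposite.op (FundamentalGroup.fromPath (Path.Homotopic.Quotient.mk γ))

lemma exp_pi_ne {t : ℝ} {a : ℂ} (ha : ‖a‖ ≠ 1) : Complex.exp ((Real.pi * t : ℝ) * Complex.I) ≠ a :=
  fun h => ha (by rw [← h, Complex.norm_exp_ofReal_mul_I])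

/-- The first two points are interchanged by a counterclockwise half rotation about `-2`. -/
def halfTwist₁ (t : ℝ) : Conf :=
  ⟨![-2 - 2 * Complex.exp ((Real.pi * t : ℝ) * Complex.I),
    -2 + 2 * Complex.exp ((Real.pi * t : ℝ) * Complex.I), 4], by
    have h0 := exp_pi_ne (t := t) (a := 0) (by norm_num)
    have h3 := exp_pi_ne (t := t) (a := 3) (by norm_num)
    have h3' := exp_pi_ne (t := t) (a := -3) (by norm_num)
    generalize Complex.exp ((Real.pi * t : ℝ) * Complex.I) = w at *
    intro i j h
    fin_cases i <;> fin_cases j <;> first | rfl | (exfalso; simp at h; grind)⟩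

/-- The last two points are interchanged by a counterclockwise half rotation about `2`. -/
def halfTwist₂ (t : ℝ) : Conf :=
  ⟨![-4, 2 - 2 * Complex.exp ((Real.pi * t : ℝ) * Complex.I),
    2 + 2 * Complex.exp ((Real.pi * t : ℝ) * Complex.I)], by
    have h0 := exp_pi_ne (t := t) (a := 0) (by norm_num)
    have h3 := exp_pi_ne (t := t) (a := 3) (by norm_num)
    have h3' := exp_pi_ne (t := t) (a := -3) (by norm_num)
    generalize Complex.exp ((Real.pi * t : ℝ) * Complex.I) = w at *
    intro i j h
    fin_cases i <;> fin_cases j <;> first | rfl | (exfalso; simp at h; grind)⟩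

lemma continuous_halfTwist₁ : Continuous halfTwist₁ := by
  refine Continuous.subtype_mk (continuous_pi fun i => ?_) _
  fin_cases i <;> simp <;> fun_prop

lemma continuous_halfTwist₂ : Continuous halfTwist₂ := by
  refine Continuous.subtype_mk (continuous_pi fun i => ?_) _
  fin_cases i <;> simp <;> fun_prop

/-- The generator `σ₁`: the first two strands make a right-handed half twist. -/
def σ₁ : BraidGroup := braidOfLoop
  { toFun := fun t => forgetOrder (halfTwist₁ t)
    continuous_toFun :=
      forgetOrder.continuous.comp (continuous_halfTwist₁.comp continuous_subtype_val)
    source' := by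
      congr 1
      apply Subtype.ext
      norm_num [halfTwist₁, basePoint]
    target' := by
      apply Quotient.sound
      change Set.range _ = Set.range _
      norm_num [halfTwist₁, basePoint]
      grind }

/-- The generator `σ₂`: the last two strands make a right-handed half twist. -/
def σ₂ : BraidGroup := braidOfLoop
  { toFun := fun t => forgetOrder (halfTwist₂ t)
    continuous_toFun :=
      forgetOrder.continuous.comp (continuous_halfTwist₂.comp continuous_subtype_val)
    source' := by
      congr 1
      apply Subtype.ext
      norm_num [halfTwist₂, basePoint]
    target' := by
      apply Quotient.sound
      change Set.range _ = Set.range _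
      norm_num [halfTwist₂, basePoint]
      grind }

/-- A geometric pure braid, given by the motion of its three strands. -/
abbrev PureBraid : Type := Path basePoint basePoint

/-- The class of a geometric pure braid in the braid group. -/
def PureBraid.toBraid (b : PureBraid) : BraidGroup := braidOfLoop (b.map forgetOrder.continuous)

/-! ### The three-sphere, braid closures and orientations -/

/-- The unit sphere of `ℂ²`. -/
abbrev S3 : Type := Metric.sphere (0 : EuclideanSpace ℂ (Fin 2)) 1

/-- The map `ℂ × ℝ → S³`, `(z, θ) ↦ (z, exp (iθ)) / √(1 + |z|²)`. It identifies `ℂ × ℝ / 2πℤ` with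
the complement of the unknotted circle on which the second coordinate vanishes (the braid axis),
and it carries the orientation of `ℂ × ℝ` to the orientation of `S³` as the boundary of the ball. -/
def sphereCoord (p : ℂ × ℝ) : S3 :=
  ⟨((Real.sqrt (1 + ‖p.1‖ ^ 2))⁻¹ : ℝ) • !₂[p.1, Complex.exp (p.2 * Complex.I)], by
    have h : 0 < Real.sqrt (1 + ‖p.1‖ ^ 2) := Real.sqrt_pos.2 (by positivity)
    rw [mem_sphere_zero_iff_norm, norm_smul, EuclideanSpace.norm_eq]
    simp only [Fin.sum_univ_two, Matrix.cons_val_zero, Matrix.cons_val_one,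
      Complex.norm_exp_ofReal_mul_I, one_pow]
    rw [add_comm (‖p.1‖ ^ 2) 1, Real.norm_of_nonneg (inv_nonneg.2 h.le), inv_mul_cancel₀ h.ne']⟩

/-- The `i`-th component of the closure of a pure braid. -/
def PureBraid.closure (b : PureBraid) (i : Fin 3) : Set S3 :=
  Set.range fun t : I => sphereCoord ((b t).1 i, 2 * Real.pi * t)

/-- The germ of `f` at `p` has local degree one: near `p`, the map `f` is homotopic, as a map of
pairs `(U, U ∖ {p}) → (V, V ∖ {f p})`, to a translation. A local homeomorphism has this property
if and only if it preserves the orientation at `p`. -/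
def HasLocalDegreeOne (f : ℂ × ℝ → ℂ × ℝ) (p : ℂ × ℝ) : Prop :=
  ∃ r > 0, ∃ H : ℝ × (ℂ × ℝ) → ℂ × ℝ,
    ContinuousOn H (Set.Icc 0 1 ×ˢ Metric.ball p r) ∧
    (∀ q ∈ Metric.ball p r, H (0, q) = f q) ∧
    (∀ q ∈ Metric.ball p r, H (1, q) = f p + (q - p)) ∧
    (∀ s ∈ Set.Icc (0 : ℝ) 1, ∀ q ∈ Metric.ball p r, H (s, q) = f p ↔ q = p)

/-- Let the 3-manifolds `M` and `N` be oriented by local coordinates in `ℂ × ℝ` (`R q m` says that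
`m` is the point with coordinates `q`). An open embedding `h` of a connected `M` in `N` preserves
the orientation if it does so at one point, when read in the coordinates. -/
def PreservesOrientation {M N : Type} (R : ℂ × ℝ → M → Prop) (R' : ℂ × ℝ → N → Prop)
    (h : M → N) : Prop :=
  ∃ (p : ℂ × ℝ) (f : ℂ × ℝ → ℂ × ℝ),
    (∀ᶠ q in nhds p, ∃ m, R q m ∧ R' (f q) (h m)) ∧ HasLocalDegreeOne f p

/-- Coordinates of the open solid torus `S¹ × ℂ`. -/
def torusCoord (q : ℂ × ℝ) (m : Circle × ℂ) : Prop := m = (Circle.exp q.2, q.1)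

/-- Coordinates of the three-sphere. -/
def s3Coord (q : ℂ × ℝ) (x : S3) : Prop := x = sphereCoord q

/-- Coordinates of an open book: the product of the interior of the page and the open interval. -/
def openBookCoord {S : Set ℂ} (φ : RelHomeo S) (q : ℂ × ℝ) (y : OpenBook φ) : Prop :=
  ∃ (x : S) (t : I), (x : ℂ) ∈ interior S ∧ 0 < t ∧ t < 1 ∧ q = ((x : ℂ), (t : ℝ)) ∧
    y = Quot.mk _ (x, t)

/-! ### Dehn surgery -/

/-- An oriented tubular neighbourhood of a knot `K` in the three-sphere, with a product structure:
an orientation-preserving open embedding of `S¹ × ℂ` that carries `S¹ × {0}` onto `K`. -/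
structure Tube (K : Set S3) where
  toFun : Circle × ℂ → S3
  isOpenEmbedding : Topology.IsOpenEmbedding toFun
  core : K = Set.range fun u => toFun (u, 0)
  orientation : PreservesOrientation torusCoord s3Coord toFun

namespace Tube

variable {K : Set S3} (e : Tube K)

lemma notMem (u : Circle) {w : ℂ} (hw : w ≠ 0) : e.toFun (u, w) ∉ K := by
  intro h
  obtain ⟨v, hv⟩ := e.core.subset h
  exact hw (congrArg Prod.snd (e.isOpenEmbedding.injective hv)).symm

/-- A common base point of the longitude and the meridian. -/
def base : {x : S3 // x ∉ K} := ⟨e.toFun (1, 1), e.notMem 1 one_ne_zero⟩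

/-- The longitude `S¹ × {1}` of the tube, a parallel copy of the knot. -/
def longitude : Path e.base e.base where
  toFun t := ⟨e.toFun (Circle.exp (2 * Real.pi * t), 1), e.notMem _ one_ne_zero⟩
  continuous_toFun :=
    (e.isOpenEmbedding.continuous.comp (by fun_prop)).subtype_mk _
  source' := by simp [base]
  target' := by simp [base]

/-- The meridian `{1} × S¹` of the tube. -/
def meridian : Path e.base e.base where
  toFun t := ⟨e.toFun (1, (Circle.exp (2 * Real.pi * t) : ℂ)), e.notMem _ (Circle.coe_ne_zero _)⟩
  continuous_toFun :=
    (e.isOpenEmbedding.continuous.comp (by fun_prop)).subtype_mk _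
  source' := by simp [base]
  target' := by simp [base]

/-- The class of a loop in the first homology group of the knot complement, the abelianized
fundamental group. -/
def homologyClass (γ : Path e.base e.base) :
    Abelianization (FundamentalGroup {x : S3 // x ∉ K} e.base) :=
  Abelianization.of (FundamentalGroup.fromPath (Path.Homotopic.Quotient.mk γ))

/-- The longitude of the tube has linking number `n` with the knot: in the homology of the knot
complement it is `n` times the meridian. Equivalently, it has slope `n` with respect to the
meridian and the null-homologous (Seifert) longitude. -/
def HasFraming (n : ℤ) : Prop := e.homologyClass e.longitude = e.homologyClass e.meridian ^ n

end Tube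

/-- The exterior of a link: the open solid tori `S¹ × {‖w‖ < 1}` are removed. -/
def Exterior {n : ℕ} {K : Fin n → Set S3} (e : ∀ i, Tube (K i)) : Type :=
  {x : S3 // ∀ i u w, ‖w‖ < 1 → (e i).toFun (u, w) ≠ x}

instance {n : ℕ} {K : Fin n → Set S3} (e : ∀ i, Tube (K i)) : TopologicalSpace (Exterior e) :=
  inferInstanceAs (TopologicalSpace {x : S3 // ∀ i u w, ‖w‖ < 1 → (e i).toFun (u, w) ≠ x})

/-- One solid torus `D² × S¹` for each component is glued to the exterior. The point `(u, v)` of the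
boundary torus is glued to the point `(u, v)` of the boundary of the `i`-th tube, so the meridian
`∂D² × {v}` is glued to a longitude of the tube. -/
inductive SurgeryRel {n : ℕ} {K : Fin n → Set S3} (e : ∀ i, Tube (K i)) :
    Exterior e ⊕ (Fin n × Metric.closedBall (0 : ℂ) 1 × Circle) →
      Exterior e ⊕ (Fin n × Metric.closedBall (0 : ℂ) 1 × Circle) → Prop
  | glue (i : Fin n) (d : Metric.closedBall (0 : ℂ) 1) (u v : Circle) (x : Exterior e)
      (hd : (d : ℂ) = u) (hx : x.1 = (e i).toFun (u, (v : ℂ))) :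
      SurgeryRel e (Sum.inr (i, d, v)) (Sum.inl x)

/-- The result of Dehn surgery along the longitudes of the tubes. -/
def Surgery {n : ℕ} {K : Fin n → Set S3} (e : ∀ i, Tube (K i)) : Type := Quot (SurgeryRel e)

instance {n : ℕ} {K : Fin n → Set S3} (e : ∀ i, Tube (K i)) : TopologicalSpace (Surgery e) :=
  inferInstanceAs (TopologicalSpace (Quot (SurgeryRel e)))

/-- Coordinates of the surgered manifold: those of the three-sphere, in the interior of the link
exterior. -/
def surgeryCoord {n : ℕ} {K : Fin n → Set S3} (e : ∀ i, Tube (K i)) (q : ℂ × ℝ)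
    (y : Surgery e) : Prop :=
  ∃ x : Exterior e, (∀ i u w, ‖w‖ ≤ 1 → (e i).toFun (u, w) ≠ x.1) ∧ s3Coord q x.1 ∧
    y = Quot.mk _ (Sum.inl x)

/-- The manifold `Y`, oriented by the coordinates `R`, is obtained by Dehn surgery on the link in
the three-sphere with components `K i` and with (integral) surgery coefficients `c i`: there is an
orientation-preserving homeomorphism of `Y` with the result of the surgery. -/
def IsDehnSurgery (Y : Type) [TopologicalSpace Y] (R : ℂ × ℝ → Y → Prop) {n : ℕ}
    (K : Fin n → Set S3) (c : Fin n → ℤ) : Prop :=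
  ∃ e : ∀ i, Tube (K i),
    (∀ i j, i ≠ j → Disjoint (Set.range (e i).toFun) (Set.range (e j).toFun)) ∧
    (∀ i, (e i).HasFraming (c i)) ∧
    ∃ h : Y ≃ₜ Surgery e, PreservesOrientation R (surgeryCoord e) h

end OpenBookSurgery

end

open scoped unitInterval

noncomputable section

namespace OpenBookSurgery

/-! ### Ordered configurations cover unordered configurations -/

/-! The right-handed twist about a round curve is the time-one map of an isotopy of the plane that
rotates the enclosed disk once counterclockwise. A `Motion` is an isotopy of this kind that carries
the three holes rigidly. It records three things at once: its end map on the page, the pure braid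
traced by the centres of the holes, and the number of full turns of each hole. All three are
multiplicative under concatenation, so the triples that occur form a subgroup `realized`, and only
the six twists have to be examined. Each twist adds one turn to every hole that it encloses. The
braids are trivial for a, b, c, a full twist of two strands for e and f, and the full twist of all
strands for d; the last one is the square of σ₂σ₁σ₂ by an explicit homotopy
(`homotopic_halfRotation`). This gives `exists_realized_monodromy`.

Let a motion end at ψ. Place the point x of the page at time t at the moved point in the page of S³
at angle 2πt. This respects the gluing of (x,1) to (ψ x,0), sends the outer boundary to the braid
axis, and leaves out neighbourhoods of the closed strands. In the open book the boundary circle of a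
hole is collapsed in the time direction, which amounts to a solid torus whose meridian is the track
of a boundary point of the hole, a parallel of the strand that turns with the hole. Hence the open
book is the surgery along these parallels (`exists_surgery_homeo`). A parallel that does not turn
can be pushed to a point of the axis off the strand, so the turning one has linking number equal to
the number of turns (`hasFraming_tube`).

It remains to remove the choices. The open book depends only on the mapping class
(`exists_openBook_homeo`). Surgery depends only on the homotopy class of the pure braid, since
nearby braids differ by a homeomorphism of S³ isotopic to the identity
(`IsDehnSurgery.of_homotopic`). Pure braids with equal class in the braid group are homotopic, since
ordered configurations cover unordered ones (`pureToBraid_injective`). Orientation is tested at one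
point; the motion is made to wait until time 1/2, so that all maps are explicit there. -/

/-- Permutations act on ordered configurations by relabelling the points. -/
instance confMulAction : MulAction (Equiv.Perm (Fin 3)) Conf where
  smul g x := ⟨fun i => x.1 (g⁻¹ i), x.2.comp (g⁻¹).injective⟩
  one_smul _ := rfl
  mul_smul g h x := by
    apply Subtype.ext
    funext i
    change x.1 ((g * h)⁻¹ i) = x.1 (h⁻¹ (g⁻¹ i))
    rw [mul_inv_rev, Equiv.Perm.mul_apply]

lemma continuous_conf_apply (i : Fin 3) : Continuous fun x : Conf => x.1 i :=
  (continuous_apply i).comp continuous_subtype_val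

lemma forgetOrder_eq_iff {x y : Conf} :
    forgetOrder x = forgetOrder y ↔ Set.range x.1 = Set.range y.1 :=
  Quotient.eq (r := confSetoid)

/-- Relabelling acts freely. If every point moves by less than half its distance to the other
points, no nontrivial relabelling of the new configuration can again be that close to the old one;
this is the evenly covered neighbourhood. -/
lemma isQuotientCoveringMap_forgetOrder :
    IsQuotientCoveringMap forgetOrder (Equiv.Perm (Fin 3)) where
  toIsQuotientMap := isQuotientMap_quot_mk
  continuous_const_smul g :=
    Continuous.subtype_mk (continuous_pi fun i => continuous_conf_apply (g⁻¹ i)) _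
  apply_eq_iff_mem_orbit {x y} := by
    rw [forgetOrder_eq_iff]
    constructor
    · intro h
      have hx : ∀ i, ∃ j, y.1 j = x.1 i := fun i => by
        have : x.1 i ∈ Set.range y.1 := h ▸ Set.mem_range_self i
        exact this
      choose s hs using hx
      have hsi : Function.Injective s := fun i j hij => x.2 (by rw [← hs i, ← hs j, hij])
      let e : Equiv.Perm (Fin 3) := Equiv.ofBijective s (Finite.injective_iff_bijective.1 hsi)
      refine ⟨e⁻¹, Subtype.ext (funext fun i => ?_)⟩
      change y.1 ((e⁻¹)⁻¹ i) = x.1 i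
      rw [inv_inv]
      exact hs i
    · rintro ⟨g, rfl⟩
      exact (g⁻¹).surjective.range_comp y.1
  disjoint x := by
    refine ⟨{y | ∀ i j, i ≠ j → 2 * dist (y.1 i) (x.1 i) < dist (x.1 i) (x.1 j)}, ?_, ?_⟩
    · refine Filter.eventually_all.2 fun i => Filter.eventually_all.2 fun j =>
        Filter.eventually_imp_distrib_left.2 fun hij => ?_
      have hc : Continuous fun y : Conf => 2 * dist (y.1 i) (x.1 i) :=
        continuous_const.mul ((continuous_conf_apply i).dist continuous_const)
      refine hc.continuousAt.eventually_lt continuousAt_const ?_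
      simpa using x.2.ne hij
    · rintro g ⟨_, ⟨y, hy, rfl⟩, hgy⟩
      by_contra hg
      have : ∃ i, g⁻¹ i ≠ i := by
        by_contra! h
        exact hg (inv_eq_one.1 (Equiv.ext h))
      obtain ⟨i, hi⟩ := this
      have h1 := hgy i (g⁻¹ i) hi.symm
      have h2 := hy (g⁻¹ i) i hi
      change 2 * dist (y.1 (g⁻¹ i)) (x.1 i) < _ at h1
      have h3 := dist_triangle_left (x.1 i) (x.1 (g⁻¹ i)) (y.1 (g⁻¹ i))
      rw [dist_comm (x.1 (g⁻¹ i))] at h2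
      linarith

/-- The pure braid group, with the product `x * y` being `x` followed by `y`. -/
abbrev PureBraidGroup : Type := (FundamentalGroup Conf basePoint)ᵐᵒᵖ

/-- The class of a geometric pure braid in the pure braid group. -/
def PureBraid.toPure (b : PureBraid) : PureBraidGroup :=
  MulOpposite.op (FundamentalGroup.fromPath (Path.Homotopic.Quotient.mk b))

/-- The inclusion of the pure braid group in the braid group. -/
def pureToBraid : PureBraidGroup →* BraidGroup :=
  MonoidHom.op (FundamentalGroup.map forgetOrder basePoint)

lemma pureToBraid_toPure (b : PureBraid) : pureToBraid b.toPure = b.toBraid := rfl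

/-- Homotopies lift along a covering, so a covering is injective on fundamental groups. This turns
the hypothesis on the class of `b` in the braid group into a homotopy of ordered configurations. -/
lemma pureToBraid_injective : Function.Injective pureToBraid := by
  intro x y h
  apply MulOpposite.unop_injective
  exact isQuotientCoveringMap_forgetOrder.isCoveringMap.injective_path_homotopic_map
    basePoint basePoint (MulOpposite.op_injective h)

lemma toPure_trans (b b' : PureBraid) : PureBraid.toPure (b.trans b') = b.toPure * b'.toPure := rfl

lemma toPure_refl : PureBraid.toPure (Path.refl basePoint) = 1 := rfl

lemma toPure_symm (b : PureBraid) : PureBraid.toPure (Path.symm b) = b.toPure⁻¹ := rfl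

lemma toPure_eq_iff {b b' : PureBraid} : b.toPure = b'.toPure ↔ Path.Homotopic b b' :=
  ⟨fun h => Path.Homotopic.Quotient.exact (MulOpposite.op_injective h),
    fun h => MulOpposite.unop_injective (Path.Homotopic.Quotient.eq.2 h)⟩

lemma braidOfLoop_trans (p q : Path (forgetOrder basePoint) (forgetOrder basePoint)) :
    braidOfLoop (p.trans q) = braidOfLoop p * braidOfLoop q := rfl

lemma braidOfLoop_eq {p q : Path (forgetOrder basePoint) (forgetOrder basePoint)}
    (h : Path.Homotopic p q) : braidOfLoop p = braidOfLoop q :=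
  MulOpposite.unop_injective (Path.Homotopic.Quotient.eq.2 h)

/-! ### Pure braids given by rotations -/

lemma basePoint_zero : basePoint.1 0 = -4 := rfl
lemma basePoint_one : basePoint.1 1 = 0 := rfl
lemma basePoint_two : basePoint.1 2 = 4 := rfl

/-- The first two points make a full counterclockwise rotation about `-2`. -/
def fullTwist₁ : PureBraid where
  toFun t := halfTwist₁ (2 * t)
  continuous_toFun := continuous_halfTwist₁.comp (by fun_prop)
  source' := by
    apply Subtype.ext
    norm_num [halfTwist₁, basePoint]
  target' := by
    apply Subtype.ext
    have : Complex.exp (Real.pi * 2 * Complex.I) = 1 := by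
      rw [mul_comm (Real.pi : ℂ)]; exact Complex.exp_two_pi_mul_I
    norm_num [halfTwist₁, basePoint, this]

/-- The last two points make a full counterclockwise rotation about `2`. -/
def fullTwist₂ : PureBraid where
  toFun t := halfTwist₂ (2 * t)
  continuous_toFun := continuous_halfTwist₂.comp (by fun_prop)
  source' := by
    apply Subtype.ext
    norm_num [halfTwist₂, basePoint]
  target' := by
    apply Subtype.ext
    have : Complex.exp (Real.pi * 2 * Complex.I) = 1 := by
      rw [mul_comm (Real.pi : ℂ)]; exact Complex.exp_two_pi_mul_I
    norm_num [halfTwist₂, basePoint, this]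

/-- The three points are rotated about the origin by the angle `π t`. -/
def rotation (t : ℝ) : Conf :=
  ⟨fun i => Complex.exp ((Real.pi * t : ℝ) * Complex.I) * basePoint.1 i,
    fun _ _ h => basePoint.2 (mul_left_cancel₀ (Complex.exp_ne_zero _) h)⟩

lemma rotation_apply (t : ℝ) : (rotation t).1 =
    fun i => Complex.exp ((Real.pi * t : ℝ) * Complex.I) * basePoint.1 i := rfl

lemma continuous_rotation : Continuous rotation :=
  Continuous.subtype_mk (continuous_pi fun i => by fun_prop) _

/-- All three points make a full counterclockwise rotation about the origin. -/
def fullTwist : PureBraid where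
  toFun t := rotation (2 * t)
  continuous_toFun := continuous_rotation.comp (by fun_prop)
  source' := by
    apply Subtype.ext
    simp [rotation]
  target' := by
    apply Subtype.ext
    have : Complex.exp (Real.pi * 2 * Complex.I) = 1 := by
      rw [mul_comm (Real.pi : ℂ)]; exact Complex.exp_two_pi_mul_I
    simp [rotation, this]

lemma exp_pi_mul_add_one (t : ℝ) : Complex.exp ((Real.pi * (t + 1) : ℝ) * Complex.I) =
    -Complex.exp ((Real.pi * t : ℝ) * Complex.I) := by
  rw [mul_add, mul_one, Complex.ofReal_add, add_mul, Complex.exp_add, Complex.exp_pi_mul_I,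
    mul_neg_one]

lemma range_fin_three (x : Fin 3 → ℂ) : Set.range x = {x 0, x 1, x 2} := by
  ext z
  simp [Fin.exists_fin_succ, eq_comm]

lemma forgetOrder_halfTwist₁_add_one (t : ℝ) :
    forgetOrder (halfTwist₁ (t + 1)) = forgetOrder (halfTwist₁ t) := by
  rw [forgetOrder_eq_iff, range_fin_three, range_fin_three]
  simp only [halfTwist₁, exp_pi_mul_add_one, Matrix.cons_val]
  ext z
  simp only [Set.mem_insert_iff, Set.mem_singleton_iff]
  grind

lemma forgetOrder_halfTwist₂_add_one (t : ℝ) :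
    forgetOrder (halfTwist₂ (t + 1)) = forgetOrder (halfTwist₂ t) := by
  rw [forgetOrder_eq_iff, range_fin_three, range_fin_three]
  simp only [halfTwist₂, exp_pi_mul_add_one, Matrix.cons_val]
  ext z
  simp only [Set.mem_insert_iff, Set.mem_singleton_iff]
  grind

lemma forgetOrder_rotation_add_one (t : ℝ) :
    forgetOrder (rotation (t + 1)) = forgetOrder (rotation t) := by
  rw [forgetOrder_eq_iff, range_fin_three, range_fin_three]
  simp only [rotation, exp_pi_mul_add_one, basePoint_zero, basePoint_one, basePoint_two]
  ext z
  simp only [Set.mem_insert_iff, Set.mem_singleton_iff]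
  grind

/-- A loop that repeats itself after half of the time is the square of its first half. -/
lemma eq_trans_self {X : Type*} [TopologicalSpace X] {x : X} (f : ℝ → X)
    (hf : ∀ t, f (t + 1) = f t) (p q : Path x x) (hp : ∀ t : I, p t = f (2 * t))
    (hq : ∀ t : I, q t = f t) : p = q.trans q := by
  ext t
  rw [Path.trans_apply, hp]
  split_ifs with h
  · rw [hq]
  · rw [hq]
    change f (2 * t) = f (2 * t - 1)
    rw [← hf (2 * t - 1), sub_add_cancel]

lemma exists_loop_σ₁ : ∃ q : Path (forgetOrder basePoint) (forgetOrder basePoint),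
    (∀ t : I, q t = forgetOrder (halfTwist₁ t)) ∧ σ₁ = braidOfLoop q := ⟨_, fun _ => rfl, rfl⟩

lemma exists_loop_σ₂ : ∃ q : Path (forgetOrder basePoint) (forgetOrder basePoint),
    (∀ t : I, q t = forgetOrder (halfTwist₂ t)) ∧ σ₂ = braidOfLoop q := ⟨_, fun _ => rfl, rfl⟩

lemma toBraid_fullTwist₁ : fullTwist₁.toBraid = σ₁ ^ 2 := by
  obtain ⟨q, hq, hσ⟩ := exists_loop_σ₁
  rw [PureBraid.toBraid, eq_trans_self (fun t => forgetOrder (halfTwist₁ t))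
    forgetOrder_halfTwist₁_add_one
    (Path.map fullTwist₁ forgetOrder.continuous) q (fun _ => rfl) hq,
    braidOfLoop_trans, pow_two, hσ]

lemma toBraid_fullTwist₂ : fullTwist₂.toBraid = σ₂ ^ 2 := by
  obtain ⟨q, hq, hσ⟩ := exists_loop_σ₂
  rw [PureBraid.toBraid, eq_trans_self (fun t => forgetOrder (halfTwist₂ t))
    forgetOrder_halfTwist₂_add_one
    (Path.map fullTwist₂ forgetOrder.continuous) q (fun _ => rfl) hq,
    braidOfLoop_trans, pow_two, hσ]

/-! ### The half twist of three strands -/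

/-- Paths of configurations are homotopic if the straight-line homotopy avoids collisions. -/
lemma homotopic_of_segment {x y : Conf} (p q : Path x y)
    (h : ∀ (s t : I) (i j : Fin 3), i < j →
      (1 - s : ℂ) * ((p t).1 j - (p t).1 i) + s * ((q t).1 j - (q t).1 i) ≠ 0) :
    Path.Homotopic p q := by
  have hinj : ∀ s t : I, Function.Injective fun i : Fin 3 =>
      (1 - s : ℂ) * (p t).1 i + s * (q t).1 i := by
    intro s t i j hij
    by_contra hne
    have hij' : (1 - s : ℂ) * (p t).1 i + s * (q t).1 i =
      (1 - s : ℂ) * (p t).1 j + s * (q t).1 j := hij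
    rcases lt_or_gt_of_ne hne with hlt | hlt
    · exact h s t i j hlt (by linear_combination -hij')
    · exact h s t j i hlt (by linear_combination hij')
  refine ⟨{ toFun := fun st => ⟨_, hinj st.1 st.2⟩, continuous_toFun := ?_, map_zero_left := ?_,
            map_one_left := ?_, prop' := ?_ }⟩
  · refine Continuous.subtype_mk (continuous_pi fun i => ?_) _
    have h1 := (continuous_conf_apply i).comp p.continuous
    have h2 := (continuous_conf_apply i).comp q.continuous
    have h1' := h1.comp (continuous_snd (X := I) (Y := I))
    have h2' := h2.comp (continuous_snd (X := I) (Y := I))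
    have hs : Continuous fun st : I × I => ((st.1 : ℝ) : ℂ) := by fun_prop
    exact ((continuous_const.sub hs).mul h1').add (hs.mul h2')
  · intro t
    exact Subtype.ext (funext fun i => by simp)
  · intro t
    exact Subtype.ext (funext fun i => by simp)
  · rintro s t (rfl | ht)
    · exact Subtype.ext (funext fun i => by simp [← add_mul])
    · rw [Set.mem_singleton_iff] at ht
      subst ht
      exact Subtype.ext (funext fun i => by simp [← add_mul])

lemma pair_cases {i j : Fin 3} (h : i < j) :
    (i = 0 ∧ j = 1) ∨ (i = 0 ∧ j = 2) ∨ (i = 1 ∧ j = 2) := by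
  revert i j
  decide

lemma forall_fin_three {P : Fin 3 → Prop} (h0 : P 0) (h1 : P 1) (h2 : P 2) (i : Fin 3) : P i := by
  fin_cases i
  exacts [h0, h1, h2]

/-- After multiplication by `c` the vector `a` lies in the closed right half-plane and `b` in the
open one. A convex combination can then vanish only at `s = 0`, where it equals `a`. -/
lemma segment_ne_zero (c : ℂ) {a b : ℂ} (s : I) (ha : a ≠ 0) (ha' : 0 ≤ (c * a).re)
    (hb : 0 < (c * b).re) : (1 - s : ℂ) * a + s * b ≠ 0 := by
  intro h
  have h' : ((1 - s : ℝ) : ℂ) * (c * a) + ((s : ℝ) : ℂ) * (c * b) = 0 := by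
    push_cast
    linear_combination c * h
  have hre := congrArg Complex.re h'
  rw [Complex.add_re, Complex.re_ofReal_mul, Complex.re_ofReal_mul, Complex.zero_re] at hre
  have h1 : 0 ≤ (1 - s : ℝ) * (c * a).re := mul_nonneg (sub_nonneg.2 s.2.2) ha'
  have h2 : 0 ≤ (s : ℝ) * (c * b).re := mul_nonneg s.2.1 hb.le
  have h3 : (s : ℝ) * (c * b).re = 0 := by linarith
  have h4 : (s : ℝ) = 0 := (mul_eq_zero.1 h3).resolve_right hb.ne'
  rw [h4] at h
  exact ha (by simpa using h)

lemma re_exp_pi (t : ℝ) :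
    (Complex.exp ((Real.pi * t : ℝ) * Complex.I)).re = Real.cos (Real.pi * t) :=
  Complex.exp_ofReal_mul_I_re _

lemma im_exp_pi (t : ℝ) :
    (Complex.exp ((Real.pi * t : ℝ) * Complex.I)).im = Real.sin (Real.pi * t) :=
  Complex.exp_ofReal_mul_I_im _

lemma sin_pi_nonneg {t : ℝ} (h0 : 0 ≤ t) (h1 : t ≤ 1) : 0 ≤ Real.sin (Real.pi * t) :=
  Real.sin_nonneg_of_nonneg_of_le_pi (by positivity) (by nlinarith [Real.pi_pos])

lemma sin_pi_pos {t : ℝ} (h0 : 0 < t) (h1 : t < 1) : 0 < Real.sin (Real.pi * t) :=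
  Real.sin_pos_of_pos_of_lt_pi (by positivity) (by nlinarith [Real.pi_pos])

lemma halfTwist₁_apply (t : ℝ) : (halfTwist₁ t).1 =
    ![-2 - 2 * Complex.exp ((Real.pi * t : ℝ) * Complex.I),
      -2 + 2 * Complex.exp ((Real.pi * t : ℝ) * Complex.I), 4] := rfl

lemma halfTwist₂_apply (t : ℝ) : (halfTwist₂ t).1 =
    ![-4, 2 - 2 * Complex.exp ((Real.pi * t : ℝ) * Complex.I),
      2 + 2 * Complex.exp ((Real.pi * t : ℝ) * Complex.I)] := rfl

lemma swap_smul_halfTwist₁ (t : ℝ) : (Equiv.swap (1 : Fin 3) 2 • halfTwist₁ t).1 =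
    ![-2 - 2 * Complex.exp ((Real.pi * t : ℝ) * Complex.I), 4,
      -2 + 2 * Complex.exp ((Real.pi * t : ℝ) * Complex.I)] :=
  funext (forall_fin_three rfl rfl rfl)

lemma rotate_smul_halfTwist₂ (t : ℝ) : ((finRotate 3)⁻¹ • halfTwist₂ t).1 =
    ![2 - 2 * Complex.exp ((Real.pi * t : ℝ) * Complex.I),
      2 + 2 * Complex.exp ((Real.pi * t : ℝ) * Complex.I), -4] :=
  funext (forall_fin_three rfl rfl rfl)

lemma exp_pi_zero : Complex.exp ((Real.pi * (0 : ℝ) : ℝ) * Complex.I) = 1 := by simp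

lemma exp_pi_one : Complex.exp ((Real.pi * (1 : ℝ) : ℝ) * Complex.I) = -1 := by simp

/-- The configuration opposite to the base configuration. -/
def oppositePoint : Conf := rotation 1

/-- The configuration after one half twist of the last two strands. -/
def afterSigmaTwo : Conf := halfTwist₂ 1

/-- The configuration after the half twists `σ₂` and `σ₁`. -/
def afterSigmaTwoOne : Conf := Equiv.swap (1 : Fin 3) 2 • halfTwist₁ 1

/-- The ordered lift of `σ₂`. -/
def liftInitial : Path basePoint afterSigmaTwo where
  toFun t := halfTwist₂ t
  continuous_toFun := continuous_halfTwist₂.comp continuous_subtype_val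
  source' := by
    apply Subtype.ext
    norm_num [halfTwist₂, basePoint]
  target' := rfl

/-- The ordered lift of `σ₁` at `afterSigmaTwo`. -/
def liftMiddle : Path afterSigmaTwo afterSigmaTwoOne where
  toFun t := Equiv.swap (1 : Fin 3) 2 • halfTwist₁ t
  continuous_toFun := (isQuotientCoveringMap_forgetOrder.continuous_const_smul _).comp
    (continuous_halfTwist₁.comp continuous_subtype_val)
  source' := by
    apply Subtype.ext
    rw [afterSigmaTwo, Set.Icc.coe_zero, swap_smul_halfTwist₁, halfTwist₂_apply,
      exp_pi_zero, exp_pi_one]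
    norm_num
  target' := rfl

/-- The ordered lift of `σ₂` at `afterSigmaTwoOne`. -/
def liftFinal : Path afterSigmaTwoOne oppositePoint where
  toFun t := (finRotate 3)⁻¹ • halfTwist₂ t
  continuous_toFun := (isQuotientCoveringMap_forgetOrder.continuous_const_smul _).comp
    (continuous_halfTwist₂.comp continuous_subtype_val)
  source' := by
    apply Subtype.ext
    rw [afterSigmaTwoOne, Set.Icc.coe_zero, swap_smul_halfTwist₁, rotate_smul_halfTwist₂,
      exp_pi_zero,
      exp_pi_one]
    norm_num
  target' := by
    apply Subtype.ext
    rw [oppositePoint, Set.Icc.coe_one, rotate_smul_halfTwist₂, rotation_apply, exp_pi_one]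
    funext i
    revert i
    refine forall_fin_three ?_ ?_ ?_
    · norm_num [basePoint_zero]
    · norm_num [basePoint_one]
    · simp [basePoint_two]

/-- The half rotation of the three points about the origin. -/
def halfRotation : Path basePoint oppositePoint where
  toFun t := rotation t
  continuous_toFun := continuous_rotation.comp continuous_subtype_val
  source' := by
    apply Subtype.ext
    simp [rotation]
  target' := rfl

lemma rotation_sub_re (c : ℂ) (t : ℝ) (i j : Fin 3) (k : ℝ)
    (hk : basePoint.1 j - basePoint.1 i = k) :
    (c * ((rotation t).1 j - (rotation t).1 i)).re =
      k * (c * Complex.exp ((Real.pi * t : ℝ) * Complex.I)).re := by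
  have : c * ((rotation t).1 j - (rotation t).1 i) =
      (k : ℂ) * (c * Complex.exp ((Real.pi * t : ℝ) * Complex.I)) := by
    simp only [rotation]
    rw [← hk]
    ring
  rw [this, Complex.re_ofReal_mul]

/-- The base points are real and increasing, so for `i < j` the differences in the rotated
configuration are positive multiples of one and the same unit vector. One test direction `c` then
decides the collision question. -/
lemma segment_ne_zero_rotation (x : Conf) (s : I) {t : ℝ} {i j : Fin 3} (hij : i < j) (c : ℂ)
    (hx : 0 ≤ (c * (x.1 j - x.1 i)).re)
    (hc : 0 < (c * Complex.exp ((Real.pi * t : ℝ) * Complex.I)).re) :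
    (1 - s : ℂ) * (x.1 j - x.1 i) + s * ((rotation t).1 j - (rotation t).1 i) ≠ 0 := by
  have hk : ∃ k : ℝ, 0 < k ∧ basePoint.1 j - basePoint.1 i = k := by
    rcases pair_cases hij with ⟨rfl, rfl⟩ | ⟨rfl, rfl⟩ | ⟨rfl, rfl⟩
    · exact ⟨4, by norm_num, by norm_num [basePoint_zero, basePoint_one, basePoint_two]⟩
    · exact ⟨8, by norm_num, by norm_num [basePoint_zero, basePoint_one, basePoint_two]⟩
    · exact ⟨4, by norm_num, by norm_num [basePoint_zero, basePoint_one, basePoint_two]⟩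
  obtain ⟨k, hk0, hk⟩ := hk
  refine segment_ne_zero c s (sub_ne_zero.2 (x.2.ne hij.ne')) hx ?_
  rw [rotation_sub_re c t i j k hk]
  exact mul_pos hk0 hc

lemma neg_I_mul_re (z : ℂ) : (-Complex.I * z).re = z.im := by simp

/-- For `0 < t < 1` the rotated differences point into the open upper half-plane, and testing with
`-I` works whenever the lift of σ₂σ₁σ₂ has a difference with nonnegative imaginary part. This fails
for two pairs only: the first two points during the initial half twist and the last two during the
final one. There the real parts are compared instead: both are nonnegative in the first case (`t ≤
1/4`), and both are nonpositive in the second (`t > 1/2`). -/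
lemma homotopic_halfRotation :
    Path.Homotopic ((liftInitial.trans liftMiddle).trans liftFinal) halfRotation := by
  refine homotopic_of_segment _ _ fun s t i j hij => ?_
  -- At the two ends the sine vanishes and the half-plane test is not strict, but there both paths
  -- are at the same configuration.
  rcases eq_or_lt_of_le t.2.1 with h0 | h0
  · have : t = 0 := Subtype.ext h0.symm
    subst this
    rw [Path.source, Path.source, ← add_mul, sub_add_cancel, one_mul]
    exact sub_ne_zero.2 (basePoint.2.ne hij.ne')
  rcases eq_or_lt_of_le t.2.2 with h1 | h1
  · have : t = 1 := Subtype.ext h1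
    subst this
    rw [Path.target, Path.target, ← add_mul, sub_add_cancel, one_mul]
    exact sub_ne_zero.2 (oppositePoint.2.ne hij.ne')
  have him : 0 < (-Complex.I * Complex.exp ((Real.pi * t : ℝ) * Complex.I)).re := by
    rw [neg_I_mul_re, im_exp_pi]
    exact sin_pi_pos h0 h1
  change (1 - s : ℂ) * (_ - _) + s * ((rotation t).1 j - (rotation t).1 i) ≠ 0
  rw [Path.trans_apply]
  split_ifs with hA
  · rw [Path.trans_apply]
    split_ifs with hB
    · have hB' : (2 * (2 * t) : ℝ) ≤ 1 := by
        have : (2 * t : ℝ) ≤ 1 / 2 := hB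
        linarith
      change (1 - s : ℂ) * ((halfTwist₂ (2 * (2 * t))).1 j - (halfTwist₂ (2 * (2 * t))).1 i) + _ ≠ 0
      have hsin := sin_pi_nonneg (t := 2 * (2 * t)) (by positivity) hB'
      have hcos := Real.cos_le_one (Real.pi * (2 * (2 * t)))
      rw [← im_exp_pi] at hsin
      rw [← re_exp_pi] at hcos
      rcases pair_cases hij with ⟨rfl, rfl⟩ | ⟨rfl, rfl⟩ | ⟨rfl, rfl⟩
      · refine segment_ne_zero_rotation _ s hij 1 ?_ ?_
        · rw [halfTwist₂_apply]
          generalize Complex.exp ((Real.pi * (2 * (2 * t)) : ℝ) * Complex.I) = w at *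
          simp
          linarith
        · rw [one_mul, re_exp_pi]
          refine Real.cos_pos_of_mem_Ioo ⟨?_, ?_⟩ <;> nlinarith [Real.pi_pos]
      all_goals
        refine segment_ne_zero_rotation _ s hij _ ?_ him
        rw [neg_I_mul_re, halfTwist₂_apply]
        generalize Complex.exp ((Real.pi * (2 * (2 * t)) : ℝ) * Complex.I) = w at *
        simp
        linarith
    · have hB' : (1 / 2 : ℝ) < 2 * t := not_le.1 hB
      change (1 - s : ℂ) * ((Equiv.swap (1 : Fin 3) 2 • halfTwist₁ (2 * (2 * t) - 1)).1 j -
        (Equiv.swap (1 : Fin 3) 2 • halfTwist₁ (2 * (2 * t) - 1)).1 i) + _ ≠ 0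
      have hsin := sin_pi_nonneg (t := 2 * (2 * t) - 1) (by linarith) (by linarith)
      rw [← im_exp_pi] at hsin
      refine segment_ne_zero_rotation _ s hij _ ?_ him
      rw [neg_I_mul_re, swap_smul_halfTwist₁]
      generalize Complex.exp ((Real.pi * (2 * (2 * t) - 1) : ℝ) * Complex.I) = w at *
      rcases pair_cases hij with ⟨rfl, rfl⟩ | ⟨rfl, rfl⟩ | ⟨rfl, rfl⟩ <;> simp <;> linarith
  · have hA' : (1 / 2 : ℝ) < t := not_le.1 hA
    change (1 - s : ℂ) * (((finRotate 3)⁻¹ • halfTwist₂ (2 * t - 1)).1 j -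
      ((finRotate 3)⁻¹ • halfTwist₂ (2 * t - 1)).1 i) + _ ≠ 0
    have hsin := sin_pi_nonneg (t := 2 * t - 1) (by linarith) (by linarith)
    have hcos := Real.neg_one_le_cos (Real.pi * (2 * t - 1))
    rw [← im_exp_pi] at hsin
    rw [← re_exp_pi] at hcos
    rcases pair_cases hij with ⟨rfl, rfl⟩ | ⟨rfl, rfl⟩ | ⟨rfl, rfl⟩
    case inr.inr =>
      refine segment_ne_zero_rotation _ s hij (-1) ?_ ?_
      · rw [rotate_smul_halfTwist₂]
        generalize Complex.exp ((Real.pi * (2 * t - 1) : ℝ) * Complex.I) = w at *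
        simp
        linarith
      · rw [neg_one_mul, Complex.neg_re, re_exp_pi, neg_pos]
        refine Real.cos_neg_of_pi_div_two_lt_of_lt ?_ ?_ <;> nlinarith [Real.pi_pos]
    all_goals
      refine segment_ne_zero_rotation _ s hij _ ?_ him
      rw [neg_I_mul_re, rotate_smul_halfTwist₂]
      generalize Complex.exp ((Real.pi * (2 * t - 1) : ℝ) * Complex.I) = w at *
      simp
      linarith

lemma forgetOrder_smul (g : Equiv.Perm (Fin 3)) (x : Conf) :
    forgetOrder (g • x) = forgetOrder x :=
  isQuotientCoveringMap_forgetOrder.map_smul g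

/-- Rotation by π preserves the set of base points, so the full rotation is the square of the half
rotation as a loop of unordered triples; the half rotation is then deformed to the three half
twists. -/
lemma toBraid_fullTwist : fullTwist.toBraid = (σ₂ * σ₁ * σ₂) ^ 2 := by
  obtain ⟨q₁, hq₁, hσ₁⟩ := exists_loop_σ₁
  obtain ⟨q₂, hq₂, hσ₂⟩ := exists_loop_σ₂
  have hopp : forgetOrder basePoint = forgetOrder oppositePoint := by
    have h := forgetOrder_rotation_add_one 0
    rw [zero_add] at h
    rw [oppositePoint, h]
    congr 1
    exact Subtype.ext (by simp [rotation])
  have key := (homotopic_halfRotation.map forgetOrder).pathCast rfl hopp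
  -- The permutations that labelled the ordered lifts disappear here, and the two paths agree
  -- pointwise, with no reparametrization.
  have hleft :
      (((liftInitial.trans liftMiddle).trans liftFinal).map forgetOrder.continuous).cast rfl hopp =
      (q₂.trans q₁).trans q₂ := by
    ext t
    rw [Path.cast_coe, Path.map_coe, Function.comp_apply, Path.trans_apply, Path.trans_apply]
    split_ifs with hA
    · rw [Path.trans_apply, Path.trans_apply]
      split_ifs with hB
      · rw [hq₂]
        rfl
      · rw [hq₁]
        exact forgetOrder_smul _ _
    · rw [hq₂]
      exact forgetOrder_smul _ _
  rw [hleft] at key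
  rw [PureBraid.toBraid, eq_trans_self (fun t => forgetOrder (rotation t))
    forgetOrder_rotation_add_one
    (Path.map fullTwist forgetOrder.continuous)
    ((halfRotation.map forgetOrder.continuous).cast rfl hopp) (fun _ => rfl) (fun _ => rfl),
    braidOfLoop_trans, ← braidOfLoop_eq key, pow_two, hσ₁, hσ₂]
  rfl

/-! ### Motions of the plane that move the holes rigidly -/

/-- A motion of the plane, parametrized by the time interval `[0, 1]` and constant outside of it,
that starts at the identity, has support in the disk of radius `9`, moves the disks of radius `3/2`
about the centres of the holes rigidly, and brings them back to their places at the end, after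
`framing i` full rotations. -/
structure Motion where
  toHomeo : ℝ → ℂ ≃ₜ ℂ
  angle : Fin 3 → ℝ → ℝ
  framing : Fin 3 → ℤ
  continuous_toHomeo : Continuous fun p : ℝ × ℂ => toHomeo p.1 p.2
  continuous_angle : ∀ i, Continuous (angle i)
  start : ∀ t ≤ 0, ∀ z, toHomeo t z = z
  finish : ∀ t, 1 ≤ t → ∀ z, toHomeo t z = toHomeo 1 z
  angle_start : ∀ i, ∀ t ≤ 0, angle i t = 0
  angle_finish : ∀ i t, 1 ≤ t → angle i t = framing i * (2 * Real.pi)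
  outer : ∀ t z, 9 ≤ ‖z‖ → toHomeo t z = z
  rigid : ∀ t i z, ‖z - basePoint.1 i‖ ≤ 3 / 2 → toHomeo t z =
    toHomeo t (basePoint.1 i) + Complex.exp (angle i t * Complex.I) * (z - basePoint.1 i)
  closed : ∀ i, toHomeo 1 (basePoint.1 i) = basePoint.1 i

lemma exp_int_mul_two_pi (n : ℤ) : Complex.exp ((n * (2 * Real.pi) : ℝ) * Complex.I) = 1 := by
  rw [Complex.exp_eq_one_iff]
  exact ⟨n, by push_cast; ring⟩

namespace Motion

lemma finish_disk (m : Motion) {i : Fin 3} {z : ℂ} (hz : ‖z - basePoint.1 i‖ ≤ 3 / 2) :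
    m.toHomeo 1 z = z := by
  rw [m.rigid 1 i z hz, m.closed, m.angle_finish i 1 le_rfl, exp_int_mul_two_pi]
  ring

/-- The pure braid traced by the centres of the holes. -/
def trace (m : Motion) : PureBraid where
  toFun t := ⟨fun i => m.toHomeo t (basePoint.1 i), (m.toHomeo t).injective.comp basePoint.2⟩
  continuous_toFun := Continuous.subtype_mk (continuous_pi fun _ =>
    m.continuous_toHomeo.comp (continuous_subtype_val.prodMk continuous_const)) _
  source' := Subtype.ext (funext fun _ => m.start _ le_rfl _)
  target' := Subtype.ext (funext fun i => m.closed i)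

lemma trace_apply (m : Motion) (t : I) (i : Fin 3) :
    (m.trace t).1 i = m.toHomeo t (basePoint.1 i) := rfl

/-- The motion that does not move. -/
def still : Motion where
  toHomeo _ := Homeomorph.refl ℂ
  angle _ _ := 0
  framing _ := 0
  continuous_toHomeo := continuous_snd
  continuous_angle _ := continuous_const
  start _ _ _ := rfl
  finish _ _ _ := rfl
  angle_start _ _ _ := rfl
  angle_finish _ _ _ := by simp
  outer _ _ _ := rfl
  rigid _ _ _ _ := by simp
  closed _ := rfl

/-- First perform the motion `m`, then the motion `m'`. -/
def concat (m m' : Motion) : Motion where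
  toHomeo t := (m.toHomeo (2 * t)).trans (m'.toHomeo (2 * t - 1))
  angle i t := m.angle i (2 * t) + m'.angle i (2 * t - 1)
  framing i := m.framing i + m'.framing i
  continuous_toHomeo := by
    have h : Continuous fun p : ℝ × ℂ => m.toHomeo (2 * p.1) p.2 :=
      m.continuous_toHomeo.comp (f := fun p : ℝ × ℂ => (2 * p.1, p.2)) (by fun_prop)
    exact m'.continuous_toHomeo.comp
      ((by fun_prop : Continuous fun p : ℝ × ℂ => 2 * p.1 - 1).prodMk h)
  continuous_angle i := by
    have h := m.continuous_angle i
    have h' := m'.continuous_angle i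
    fun_prop
  start t ht z := by
    rw [Homeomorph.trans_apply, m.start _ (by linarith), m'.start _ (by linarith)]
  finish t ht z := by
    rw [Homeomorph.trans_apply, Homeomorph.trans_apply, m.finish _ (by linarith),
      m'.finish _ (by linarith), m.finish (2 * 1) (by norm_num),
      m'.finish (2 * 1 - 1) (by norm_num)]
  angle_start i t ht := by
    rw [m.angle_start i _ (by linarith), m'.angle_start i _ (by linarith), add_zero]
  angle_finish i t ht := by
    rw [m.angle_finish i _ (by linarith), m'.angle_finish i _ (by linarith)]
    push_cast
    ring
  outer t z hz := by
    rw [Homeomorph.trans_apply, m.outer _ z hz, m'.outer _ z hz]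
  rigid t i z hz := by
    rw [Homeomorph.trans_apply, Homeomorph.trans_apply]
    -- At each time at most one of the motions is under way. In the second half the first one has
    -- returned each disk after whole turns, so its angle contributes the factor 1.
    rcases le_total (2 * t) 1 with h | h
    · rw [m'.start _ (by linarith), m'.start _ (by linarith), m'.angle_start i _ (by linarith),
        add_zero]
      exact m.rigid _ i z hz
    · rw [m.finish _ h z, m.finish _ h, m.closed, m.finish_disk hz, m.angle_finish i _ h,
        Complex.ofReal_add, add_mul, Complex.exp_add, exp_int_mul_two_pi, one_mul]
      exact m'.rigid _ i z hz
  closed i := by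
    rw [Homeomorph.trans_apply, m.finish _ (by norm_num), m.closed, m'.finish _ (by norm_num),
      m'.closed]

lemma trace_concat (m m' : Motion) : (m.concat m').trace = m.trace.trans m'.trace := by
  refine Path.ext (funext fun t => Subtype.ext (funext fun i => ?_))
  rw [trace_apply, Path.trans_apply]
  change m'.toHomeo (2 * t - 1) (m.toHomeo (2 * t) (basePoint.1 i)) = _
  split_ifs with h
  · exact m'.start _ (by linarith) _
  · rw [m.finish _ (by linarith), m.closed]
    rfl

/-- Perform the motion `m` backwards. -/
def reverse (m : Motion) : Motion where
  -- Composing with the inverse of the end map makes the backward motion start at the identity; near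
  -- the holes that end map is the identity, so the trace is simply reversed.
  toHomeo t := (m.toHomeo 1).symm.trans (m.toHomeo (1 - t))
  angle i t := m.angle i (1 - t) - m.framing i * (2 * Real.pi)
  framing i := -m.framing i
  continuous_toHomeo := by
    exact m.continuous_toHomeo.comp ((by fun_prop : Continuous fun p : ℝ × ℂ => 1 - p.1).prodMk
      ((m.toHomeo 1).symm.continuous.comp continuous_snd))
  continuous_angle i := by
    have h := m.continuous_angle i
    fun_prop
  start t ht z := by
    rw [Homeomorph.trans_apply, m.finish _ (by linarith), Homeomorph.apply_symm_apply]
  finish t ht z := by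
    rw [Homeomorph.trans_apply, Homeomorph.trans_apply, m.start _ (by linarith),
      m.start _ (by linarith)]
  angle_start i t ht := by rw [m.angle_finish i _ (by linarith), sub_self]
  angle_finish i t ht := by
    rw [m.angle_start i _ (by linarith)]
    push_cast
    ring
  outer t z hz := by
    have h : (m.toHomeo 1).symm z = z := (Homeomorph.symm_apply_eq _).2 (m.outer 1 z hz).symm
    rw [Homeomorph.trans_apply, h, m.outer _ z hz]
  rigid t i z hz := by
    have h : (m.toHomeo 1).symm z = z := (Homeomorph.symm_apply_eq _).2 (m.finish_disk hz).symm
    have h' : (m.toHomeo 1).symm (basePoint.1 i) = basePoint.1 i :=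
      (Homeomorph.symm_apply_eq _).2 (m.closed i).symm
    rw [Homeomorph.trans_apply, Homeomorph.trans_apply, h, h', Complex.ofReal_sub, sub_mul,
      Complex.exp_sub, exp_int_mul_two_pi, div_one]
    exact m.rigid _ i z hz
  closed i := by
    rw [Homeomorph.trans_apply, m.start _ (by norm_num), Homeomorph.symm_apply_eq, m.closed]

lemma trace_reverse (m : Motion) : m.reverse.trace = m.trace.symm := by
  refine Path.ext (funext fun t => Subtype.ext (funext fun i => ?_))
  change m.toHomeo (1 - t) ((m.toHomeo 1).symm (basePoint.1 i)) =
    m.toHomeo (unitInterval.symm t) (basePoint.1 i)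
  rw [(Homeomorph.symm_apply_eq _).2 (m.closed i).symm]
  rfl

/-- The final position of the motion restricts to the homeomorphism `φ` of the page. -/
def EndsAt (m : Motion) (φ : RelHomeo fourHoledSphere) : Prop :=
  ∀ x : fourHoledSphere, m.toHomeo 1 x = (φ : fourHoledSphere ≃ₜ fourHoledSphere) x

end Motion

/-- The triples of a homeomorphism of the page, a pure braid and a triple of framings that belong to
a common motion. -/
def realized : Subgroup ((RelHomeo fourHoledSphere)ᵐᵒᵖ × PureBraidGroup ×
    Multiplicative (Fin 3 → ℤ)) where
  carrier := {p | ∃ m : Motion, m.EndsAt p.1.unop ∧ m.trace.toPure = p.2.1 ∧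
    m.framing = p.2.2.toAdd}
  one_mem' := ⟨Motion.still, fun _ => rfl, rfl, rfl⟩
  mul_mem' := by
    rintro ⟨φ, x, n⟩ ⟨φ', x', n'⟩ ⟨m, h1, h2, h3⟩ ⟨m', h1', h2', h3'⟩
    refine ⟨m.concat m', fun z => ?_, ?_, ?_⟩
    · change m'.toHomeo (2 * 1 - 1) (m.toHomeo (2 * 1) z) = _
      rw [m.finish _ (by norm_num), m'.finish _ (by norm_num), h1, h1']
      rfl
    · rw [Motion.trace_concat, toPure_trans, h2, h2']
      rfl
    · change m.framing + m'.framing = _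
      rw [h3, h3']
      rfl
  inv_mem' := by
    rintro ⟨φ, x, n⟩ ⟨m, h1, h2, h3⟩
    refine ⟨m.reverse, fun z => ?_, ?_, ?_⟩
    · change m.toHomeo (1 - 1) ((m.toHomeo 1).symm z) = _
      rw [m.start _ (by norm_num), Homeomorph.symm_apply_eq]
      change (z : ℂ) = m.toHomeo 1 ((φ.unop⁻¹ : RelHomeo fourHoledSphere).1 z)
      rw [h1]
      change (z : ℂ) = (φ.unop.1 (φ.unop.1.symm z) : fourHoledSphere)
      rw [Homeomorph.apply_symm_apply]
    · rw [Motion.trace_reverse, toPure_symm, h2]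
      rfl
    · change -m.framing = _
      rw [h3]
      rfl

/-! ### Motions given by twists -/

lemma twistAngle_of_le {r₁ r₂ r : ℝ} (hr : r₁ < r₂) (h : r ≤ r₁) :
    twistAngle r₁ r₂ r = 2 * Real.pi := by
  have h3 : 1 ≤ (r₂ - r) / (r₂ - r₁) := by
    rw [le_div_iff₀ (sub_pos.2 hr)]
    linarith
  rw [twistAngle, min_eq_left h3, max_eq_right zero_le_one, mul_one]

lemma twistAngle_of_ge {r₁ r₂ r : ℝ} (hr : r₁ < r₂) (h : r₂ ≤ r) : twistAngle r₁ r₂ r = 0 := by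
  have h3 : (r₂ - r) / (r₂ - r₁) ≤ 0 :=
    div_nonpos_of_nonpos_of_nonneg (by linarith) (sub_pos.2 hr).le
  rw [twistAngle, min_eq_right (by linarith), max_eq_left h3, mul_zero]

lemma twistMap_inner {c : ℂ} {r₁ r₂ : ℝ} (s : ℝ) (hr : r₁ < r₂) {z : ℂ} (hz : ‖z - c‖ ≤ r₁) :
    twistMap c r₁ r₂ s z = c + (z - c) * Complex.exp ((s * (2 * Real.pi) : ℝ) * Complex.I) := by
  rw [twistMap, twistAngle_of_le hr hz]

lemma twistMap_outer {c : ℂ} {r₁ r₂ : ℝ} (s : ℝ) (hr : r₁ < r₂) {z : ℂ} (hz : r₂ ≤ ‖z - c‖) :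
    twistMap c r₁ r₂ s z = z := by
  rw [twistMap, twistAngle_of_ge hr hz]
  simp

lemma twistMap_zero (c : ℂ) (r₁ r₂ : ℝ) (z : ℂ) : twistMap c r₁ r₂ 0 z = z := by
  simp [twistMap]

/-- The twist map as a homeomorphism of the plane. -/
def twistHomeo (c : ℂ) (r₁ r₂ s : ℝ) : ℂ ≃ₜ ℂ where
  toFun := twistMap c r₁ r₂ s
  invFun := twistMap c r₁ r₂ (-s)
  left_inv := twistMap_twistMap c r₁ r₂ s
  right_inv z := by simpa using twistMap_twistMap c r₁ r₂ (-s) z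
  continuous_toFun := continuous_twistMap c r₁ r₂ s
  continuous_invFun := continuous_twistMap c r₁ r₂ (-s)

/-- The nearest point of the unit interval. -/
def clamp (t : ℝ) : ℝ := max 0 (min 1 t)

lemma continuous_clamp : Continuous clamp := by
  unfold clamp
  fun_prop

lemma clamp_of_nonpos {t : ℝ} (h : t ≤ 0) : clamp t = 0 :=
  max_eq_left ((min_le_right _ _).trans h)

lemma clamp_of_one_le {t : ℝ} (h : 1 ≤ t) : clamp t = 1 := by
  rw [clamp, min_eq_left h, max_eq_right zero_le_one]

lemma clamp_of_mem (t : I) : clamp t = t := by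
  rw [clamp, min_eq_right t.2.2, max_eq_right t.2.1]

lemma clamp_mem (t : ℝ) : clamp t ∈ Set.Icc (0 : ℝ) 1 :=
  ⟨le_max_left _ _, max_le zero_le_one (min_le_left _ _)⟩

/-- The rotation of a disk that contains the holes with index in `J` and is disjoint from the
others. -/
def twistMotion (c : ℂ) (r₁ r₂ : ℝ) (J : Finset (Fin 3)) (hr : r₁ < r₂) (hc : ‖c‖ + r₂ ≤ 9)
    (hin : ∀ i ∈ J, ‖basePoint.1 i - c‖ + 3 / 2 ≤ r₁)
    (hout : ∀ i ∉ J, r₂ + 3 / 2 ≤ ‖basePoint.1 i - c‖) : Motion where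
  toHomeo t := twistHomeo c r₁ r₂ (clamp t)
  angle i t := clamp t * ((if i ∈ J then 1 else 0 : ℤ) * (2 * Real.pi))
  framing i := if i ∈ J then 1 else 0
  continuous_toHomeo := by
    have h := continuous_clamp
    change Continuous fun p : ℝ × ℂ => twistMap c r₁ r₂ (clamp p.1) p.2
    unfold twistMap twistAngle
    fun_prop
  continuous_angle i := by
    have h := continuous_clamp
    fun_prop
  start t ht z := by
    change twistMap c r₁ r₂ (clamp t) z = z
    rw [clamp_of_nonpos ht, twistMap_zero]
  finish t ht z := by rw [clamp_of_one_le ht, clamp_of_one_le le_rfl]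
  angle_start i t ht := by rw [clamp_of_nonpos ht, zero_mul]
  angle_finish i t ht := by rw [clamp_of_one_le ht, one_mul]
  outer t z hz := twistMap_outer _ hr (by
    have := norm_sub_norm_le z c
    linarith)
  rigid t i z hz := by
    change twistMap c r₁ r₂ (clamp t) z = twistMap c r₁ r₂ (clamp t) _ + _
    have h1 := norm_sub_le_norm_sub_add_norm_sub z (basePoint.1 i) c
    have h2 := norm_sub_le_norm_sub_add_norm_sub (basePoint.1 i) z c
    rw [norm_sub_rev (basePoint.1 i) z] at h2
    by_cases hi : i ∈ J
    · have := hin i hi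
      rw [twistMap_inner _ hr (by linarith), twistMap_inner _ hr (by linarith), if_pos hi]
      push_cast
      ring_nf
    · have := hout i hi
      rw [twistMap_outer _ hr (by linarith), twistMap_outer _ hr (by linarith), if_neg hi]
      simp
  closed i := by
    change twistMap c r₁ r₂ (clamp 1) _ = _
    rw [clamp_of_one_le le_rfl]
    refine twistMap_eq_self (Or.inl rfl) hr fun h => ?_
    by_cases hi : i ∈ J
    · linarith [hin i hi]
    · linarith [hout i hi]

lemma twistMotion_trace_apply {c : ℂ} {r₁ r₂ : ℝ} {J : Finset (Fin 3)} (hr : r₁ < r₂)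
    (hc : ‖c‖ + r₂ ≤ 9) (hin : ∀ i ∈ J, ‖basePoint.1 i - c‖ + 3 / 2 ≤ r₁)
    (hout : ∀ i ∉ J, r₂ + 3 / 2 ≤ ‖basePoint.1 i - c‖) (t : I) (i : Fin 3) :
    ((twistMotion c r₁ r₂ J hr hc hin hout).trace t).1 i =
      if i ∈ J then
        c + (basePoint.1 i - c) * Complex.exp ((Real.pi * (2 * t) : ℝ) * Complex.I)
      else basePoint.1 i := by
  change twistMap c r₁ r₂ (clamp t) _ = _
  rw [clamp_of_mem]
  split_ifs with hi
  · rw [twistMap_inner _ hr (by linarith [hin i hi])]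
    rw [show (t * (2 * Real.pi) : ℝ) = Real.pi * (2 * t) by ring]
  · exact twistMap_outer _ hr (by linarith [hout i hi])

/-- The framings of a rotation of the holes in `J`. -/
def indicator (J : Finset (Fin 3)) : Multiplicative (Fin 3 → ℤ) :=
  Multiplicative.ofAdd fun i => if i ∈ J then (1 : ℤ) else 0

/-- The twist, the pure braid and the framings of a rotation. -/
lemma twist_mem_realized {c : ℂ} {r₁ r₂ : ℝ} (J : Finset (Fin 3)) (hr : r₁ < r₂)
    (hS : ∀ z, r₁ < ‖z - c‖ → ‖z - c‖ < r₂ → z ∈ fourHoledSphere) (hc : ‖c‖ + r₂ ≤ 9)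
    (hin : ∀ i ∈ J, ‖basePoint.1 i - c‖ + 3 / 2 ≤ r₁)
    (hout : ∀ i ∉ J, r₂ + 3 / 2 ≤ ‖basePoint.1 i - c‖) (b : PureBraid)
    (hb : ∀ t : I, ∀ i, (b t).1 i = if i ∈ J then
        c + (basePoint.1 i - c) * Complex.exp ((Real.pi * (2 * t) : ℝ) * Complex.I)
      else basePoint.1 i) :
    (MulOpposite.op (dehnTwist fourHoledSphere c r₁ r₂ hr hS), b.toPure,
      indicator J) ∈ realized := by
  refine ⟨twistMotion c r₁ r₂ J hr hc hin hout, fun x => ?_, ?_, rfl⟩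
  · change twistMap c r₁ r₂ (clamp 1) x = twistMap c r₁ r₂ 1 x
    rw [clamp_of_one_le le_rfl]
  · congr 1
    refine Path.ext (funext fun t => Subtype.ext (funext fun i => ?_))
    rw [twistMotion_trace_apply, hb]

/-! ### Independence of the twist class of the radii -/

lemma mappingClass_eq_iff {S : Set ℂ} {f g : RelHomeo S} :
    mappingClass f = mappingClass g ↔ f⁻¹ * g ∈ IsotopicToId S := by
  rw [mappingClass, mappingClass, MulOpposite.op_inj, QuotientGroup.eq]

lemma mappingClass_eq_of_isotopicRel {S : Set ℂ} {f g : RelHomeo S} (h : IsotopicRel S f g) :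
    mappingClass f = mappingClass g := by
  obtain ⟨F, hF, hF0, hF1⟩ := h
  rw [mappingClass_eq_iff]
  refine ⟨fun t => f⁻¹ * F t, ?_, by simp [hF0], by simp [hF1]⟩
  exact (f⁻¹ : RelHomeo S).1.continuous.comp hF

/-- Shrinking the support of a twist does not change its mapping class. -/
lemma mappingClass_dehnTwist_shrink {S : Set ℂ} {c : ℂ} {r₁ r₂ r₁' r₂' : ℝ} (hr : r₁ < r₂)
    (hr' : r₁' < r₂') (h₁ : r₁ ≤ r₁') (h₂ : r₂' ≤ r₂)
    (hS : ∀ z, r₁ < ‖z - c‖ → ‖z - c‖ < r₂ → z ∈ S)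
    (hS' : ∀ z, r₁' < ‖z - c‖ → ‖z - c‖ < r₂' → z ∈ S) :
    mappingClass (dehnTwist S c r₁ r₂ hr hS) = mappingClass (dehnTwist S c r₁' r₂' hr' hS') := by
  apply mappingClass_eq_of_isotopicRel
  have hlt : ∀ t : I, r₁ + t * (r₁' - r₁) < r₂ + t * (r₂' - r₂) := fun t => by
    have h0 := t.2.1
    have h1 := t.2.2
    rcases eq_or_lt_of_le h0 with h | h
    · rw [← h]; linarith
    · nlinarith
  have hsub : ∀ t : I, ∀ z, r₁ + t * (r₁' - r₁) < ‖z - c‖ → ‖z - c‖ < r₂ + t * (r₂' - r₂) →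
      z ∈ S := fun t z hz hz' => by
    have h0 := t.2.1
    exact hS z (by nlinarith) (by nlinarith)
  refine ⟨fun t => dehnTwist S c _ _ (hlt t) (hsub t), ?_, ?_, ?_⟩
  · refine Continuous.subtype_mk ?_ _
    have hne : ∀ p : I × S, r₂ + p.1 * (r₂' - r₂) - (r₁ + p.1 * (r₁' - r₁)) ≠ 0 :=
      fun p => (sub_pos.2 (hlt p.1)).ne'
    change Continuous fun p : I × S =>
      twistMap c (r₁ + p.1 * (r₁' - r₁)) (r₂ + p.1 * (r₂' - r₂)) 1 p.2
    unfold twistMap twistAngle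
    fun_prop (disch := exact hne)
  · refine Subtype.ext (Homeomorph.ext fun x => Subtype.ext ?_)
    change twistMap c (r₁ + (0 : ℝ) * (r₁' - r₁)) (r₂ + (0 : ℝ) * (r₂' - r₂)) 1 x =
      twistMap c r₁ r₂ 1 x
    rw [zero_mul, zero_mul, add_zero, add_zero]
  · refine Subtype.ext (Homeomorph.ext fun x => Subtype.ext ?_)
    change twistMap c (r₁ + (1 : ℝ) * (r₁' - r₁)) (r₂ + (1 : ℝ) * (r₂' - r₂)) 1 x =
      twistMap c r₁' r₂' 1 x
    rw [one_mul, one_mul, add_sub_cancel, add_sub_cancel]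

/-! ### The six standard twists -/

lemma norm_basePoint_sub (i : Fin 3) (c : ℝ) :
    ‖basePoint.1 i - c‖ = |![-4, 0, 4] i - c| := by
  have h : basePoint.1 i = ((![-4, 0, 4] i : ℝ) : ℂ) := by
    revert i
    refine forall_fin_three ?_ ?_ ?_ <;> simp [basePoint]
  rw [h, ← Complex.ofReal_sub, Complex.norm_real, Real.norm_eq_abs]

/-- A twist class about a curve that bounds a disk with the holes in `J`, together with the pure
braid `b` and the framings of the corresponding rotation. -/
lemma exists_realized_of_twist (τ : MappingClassGroup fourHoledSphere) (c r₁ r₂ : ℝ)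
    (J : Finset (Fin 3)) (hr : r₁ < r₂) (hc : |c| + r₂ ≤ 9)
    (hin : ∀ i ∈ J, |![-4, 0, 4] i - c| + 3 / 2 ≤ r₁)
    (hout : ∀ i ∉ J, r₂ + 3 / 2 ≤ |![-4, 0, 4] i - c|)
    (hS : ∀ z : ℂ, r₁ < ‖z - c‖ → ‖z - c‖ < r₂ → z ∈ fourHoledSphere)
    (hτ : τ = mappingClass (dehnTwist fourHoledSphere c r₁ r₂ hr hS)) (b : PureBraid)
    (hb : ∀ t : I, ∀ i, (b t).1 i = if i ∈ J then
        (c : ℂ) + (basePoint.1 i - c) * Complex.exp ((Real.pi * (2 * t) : ℝ) * Complex.I)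
      else basePoint.1 i) :
    ∃ ψ : RelHomeo fourHoledSphere, mappingClass ψ = τ ∧ (MulOpposite.op ψ, b.toPure,
      indicator J) ∈ realized := by
  refine ⟨_, hτ.symm, twist_mem_realized J hr hS ?_ ?_ ?_ b hb⟩
  · rwa [Complex.norm_real, Real.norm_eq_abs]
  · exact fun i hi => by rw [norm_basePoint_sub]; exact hin i hi
  · exact fun i hi => by rw [norm_basePoint_sub]; exact hout i hi

/-- The rotating disk has to contain the whole disk of radius 3/2 on which motions are rigid, so the
annulus is first shrunk from inner radius 1 to 3/2. A rotation about the centre of the hole moves no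
centre, whence the trivial braid. -/
lemma exists_realized_a : ∃ ψ : RelHomeo fourHoledSphere, mappingClass ψ = τa ∧
    (MulOpposite.op ψ, 1, indicator {0}) ∈ realized := by
  refine exists_realized_of_twist τa (-4) (3 / 2) 2 {0} (by norm_num) (by norm_num) ?_ ?_ ?_
    (mappingClass_dehnTwist_shrink _ _ (by norm_num) le_rfl _ _) (Path.refl basePoint) ?_
  · refine forall_fin_three ?_ ?_ ?_ <;> simp
  · refine forall_fin_three ?_ ?_ ?_ <;> simp <;> norm_num
  · exact fun z h h' => annulus_subset (c := -4) (r₁ := 1) (r₂ := 2) (by norm_num) (by norm_num)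
      (by norm_num) (by norm_num) z (by linarith) h'
  · refine fun t => forall_fin_three ?_ ?_ ?_ <;> simp [basePoint_zero]

lemma exists_realized_b : ∃ ψ : RelHomeo fourHoledSphere, mappingClass ψ = τb ∧
    (MulOpposite.op ψ, 1, indicator {1}) ∈ realized := by
  refine exists_realized_of_twist τb 0 (3 / 2) 2 {1} (by norm_num) (by norm_num) ?_ ?_ ?_
    (mappingClass_dehnTwist_shrink _ _ (by norm_num) le_rfl _ _) (Path.refl basePoint) ?_
  · refine forall_fin_three ?_ ?_ ?_ <;> simp
  · refine forall_fin_three ?_ ?_ ?_ <;> simp <;> norm_num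
  · exact fun z h h' => annulus_subset (c := 0) (r₁ := 1) (r₂ := 2) (by norm_num) (by norm_num)
      (by norm_num) (by norm_num) z (by linarith) h'
  · refine fun t => forall_fin_three ?_ ?_ ?_ <;> simp [basePoint_one]

lemma exists_realized_c : ∃ ψ : RelHomeo fourHoledSphere, mappingClass ψ = τc ∧
    (MulOpposite.op ψ, 1, indicator {2}) ∈ realized := by
  refine exists_realized_of_twist τc 4 (3 / 2) 2 {2} (by norm_num) (by norm_num) ?_ ?_ ?_
    (mappingClass_dehnTwist_shrink _ _ (by norm_num) le_rfl _ _) (Path.refl basePoint) ?_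
  · refine forall_fin_three ?_ ?_ ?_ <;> simp
  · refine forall_fin_three ?_ ?_ ?_ <;> simp <;> norm_num
  · exact fun z h h' => annulus_subset (c := 4) (r₁ := 1) (r₂ := 2) (by norm_num) (by norm_num)
      (by norm_num) (by norm_num) z (by linarith) h'
  · refine fun t => forall_fin_three ?_ ?_ ?_ <;> simp [basePoint_two]

/-- Motions are fixed outside radius 9, so the twist in the annulus 9 to 10 is moved to the annulus
8 to 9; both are shrinkings of the twist supported in 8 to 10. -/
lemma exists_realized_d : ∃ ψ : RelHomeo fourHoledSphere, mappingClass ψ = τd ∧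
    (MulOpposite.op ψ, fullTwist.toPure,
      indicator Finset.univ) ∈ realized := by
  have hS : ∀ z : ℂ, 8 < ‖z - (0 : ℝ)‖ → ‖z - (0 : ℝ)‖ < 10 → z ∈ fourHoledSphere :=
    fun z => annulus_subset (c := 0) (by norm_num) (by norm_num) (by norm_num) (by norm_num) z
  refine exists_realized_of_twist τd 0 8 9 Finset.univ (by norm_num) (by norm_num) ?_ ?_
    (fun z h h' => hS z h (by linarith))
    ((mappingClass_dehnTwist_shrink (by norm_num) _ (by norm_num) le_rfl hS _).symm.trans
      (mappingClass_dehnTwist_shrink _ _ le_rfl (by norm_num) hS _)) fullTwist ?_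
  · refine forall_fin_three ?_ ?_ ?_ <;> simp <;> norm_num
  · simp
  · intro t i
    change Complex.exp ((Real.pi * (2 * t) : ℝ) * Complex.I) * basePoint.1 i = _
    rw [if_pos (Finset.mem_univ i)]
    push_cast
    ring

lemma exists_realized_e : ∃ ψ : RelHomeo fourHoledSphere, mappingClass ψ = τe ∧
    (MulOpposite.op ψ, fullTwist₁.toPure,
      indicator {0, 1}) ∈ realized := by
  -- The inner radius is 7/2 = 2 + 3/2: the enclosed centres lie at distance 2 from the axis of
  -- rotation, and their rigid disks have radius 3/2.
  refine exists_realized_of_twist τe (-2) (7 / 2) 4 {0, 1} (by norm_num) (by norm_num) ?_ ?_ ?_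
    (mappingClass_dehnTwist_shrink _ _ (by norm_num) le_rfl _ _) fullTwist₁ ?_
  · refine forall_fin_three ?_ ?_ ?_ <;> simp <;> norm_num
  · refine forall_fin_three ?_ ?_ ?_ <;> simp
    norm_num
  · exact fun z h h' => annulus_subset (c := -2) (r₁ := 3) (r₂ := 4) (by norm_num) (by norm_num)
      (by norm_num) (by norm_num) z (by linarith) h'
  · intro t i
    change (halfTwist₁ (2 * t)).1 i = _
    rw [halfTwist₁_apply]
    generalize Complex.exp ((Real.pi * (2 * t) : ℝ) * Complex.I) = w
    revert i
    refine forall_fin_three ?_ ?_ ?_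
    · simp [basePoint_zero]; ring
    · simp [basePoint_one]
    · simp [basePoint_two]

lemma exists_realized_f : ∃ ψ : RelHomeo fourHoledSphere, mappingClass ψ = τf ∧
    (MulOpposite.op ψ, fullTwist₂.toPure,
      indicator {1, 2}) ∈ realized := by
  refine exists_realized_of_twist τf 2 (7 / 2) 4 {1, 2} (by norm_num) (by norm_num) ?_ ?_ ?_
    (mappingClass_dehnTwist_shrink _ _ (by norm_num) le_rfl _ _) fullTwist₂ ?_
  · refine forall_fin_three ?_ ?_ ?_ <;> simp <;> norm_num
  · refine forall_fin_three ?_ ?_ ?_ <;> norm_num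
  · exact fun z h h' => annulus_subset (c := 2) (r₁ := 3) (r₂ := 4) (by norm_num) (by norm_num)
      (by norm_num) (by norm_num) z (by linarith) h'
  · intro t i
    change (halfTwist₂ (2 * t)).1 i = _
    rw [halfTwist₂_apply]
    generalize Complex.exp ((Real.pi * (2 * t) : ℝ) * Complex.I) = w
    revert i
    refine forall_fin_three ?_ ?_ ?_
    · simp [basePoint_zero]
    · simp [basePoint_one]; ring
    · simp [basePoint_two]; norm_num

/-- The set of mapping classes, pure braids and framings that are realized by motions. -/
def realizedClasses : Subgroup (MappingClassGroup fourHoledSphere × PureBraidGroup ×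
    Multiplicative (Fin 3 → ℤ)) :=
  realized.map (MonoidHom.prodMap (MonoidHom.op (QuotientGroup.mk' (IsotopicToId fourHoledSphere)))
    (MonoidHom.id _))

lemma mem_realizedClasses {x : MappingClassGroup fourHoledSphere × PureBraidGroup ×
    Multiplicative (Fin 3 → ℤ)} : x ∈ realizedClasses ↔
      ∃ ψ : RelHomeo fourHoledSphere, mappingClass ψ = x.1 ∧
        (MulOpposite.op ψ, x.2) ∈ realized := by
  constructor
  · rintro ⟨⟨ψ, y⟩, hy, rfl⟩
    exact ⟨ψ.unop, rfl, hy⟩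
  · rintro ⟨ψ, hψ, h⟩
    exact ⟨(MulOpposite.op ψ, x.2), h, Prod.ext hψ rfl⟩

/-- The pure braid of the monodromy. -/
def monodromyPure (δ : ℤ) {k : ℕ} (ε η : Fin k → ℤ) : PureBraidGroup :=
  fullTwist.toPure ^ δ *
    (List.ofFn fun i => fullTwist₁.toPure ^ ε i * fullTwist₂.toPure ^ η i).prod

lemma pureToBraid_monodromyPure (δ : ℤ) {k : ℕ} (ε η : Fin k → ℤ) :
    pureToBraid (monodromyPure δ ε η) = (σ₂ * σ₁ * σ₂) ^ (2 * δ) *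
      (List.ofFn fun i => σ₁ ^ (2 * ε i) * σ₂ ^ (2 * η i)).prod := by
  rw [monodromyPure, map_mul, map_list_prod, map_zpow, pureToBraid_toPure, toBraid_fullTwist,
    List.map_ofFn, zpow_mul]
  congr 3
  funext i
  rw [Function.comp_apply, map_mul, map_zpow, map_zpow, pureToBraid_toPure, pureToBraid_toPure,
    toBraid_fullTwist₁, toBraid_fullTwist₂, zpow_mul, zpow_mul]
  rfl

/-- The monodromy, its pure braid and its framings are realized by a motion. -/
lemma exists_realized_monodromy (α β γ δ : ℤ) {k : ℕ} (ε η : Fin k → ℤ) :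
    ∃ ψ : RelHomeo fourHoledSphere, mappingClass ψ =
      τa ^ α * τb ^ β * τc ^ γ * τd ^ δ * (List.ofFn fun i => τe ^ ε i * τf ^ η i).prod ∧
    (MulOpposite.op ψ, monodromyPure δ ε η, Multiplicative.ofAdd
      ![α + δ + (∑ i, ε i), β + δ + (∑ i, ε i) + (∑ i, η i), γ + δ + (∑ i, η i)]) ∈ realized := by
  have ha : (τa, 1, indicator {0}) ∈ realizedClasses :=
    mem_realizedClasses.2 exists_realized_a
  have hb : (τb, 1, indicator {1}) ∈ realizedClasses :=
    mem_realizedClasses.2 exists_realized_b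
  have hc : (τc, 1, indicator {2}) ∈ realizedClasses :=
    mem_realizedClasses.2 exists_realized_c
  have hd : (τd, fullTwist.toPure, indicator Finset.univ) ∈ realizedClasses :=
    mem_realizedClasses.2 exists_realized_d
  have he : (τe, fullTwist₁.toPure, indicator {0, 1}) ∈ realizedClasses :=
    mem_realizedClasses.2 exists_realized_e
  have hf : (τf, fullTwist₂.toPure, indicator {1, 2}) ∈ realizedClasses :=
    mem_realizedClasses.2 exists_realized_f
  have hprod := list_prod_mem (S := realizedClasses) (l := List.ofFn fun i =>
      (τe, fullTwist₁.toPure, indicator {0, 1}) ^ ε i *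
      (τf, fullTwist₂.toPure, indicator {1, 2}) ^ η i) (by
    intro x hx
    obtain ⟨i, rfl⟩ := List.mem_ofFn.1 hx
    exact mul_mem (zpow_mem he _) (zpow_mem hf _))
  -- The word is formed in the group of triples. Its third component adds each exponent to the holes
  -- enclosed by the curve, which produces the three surgery coefficients.
  have key := mul_mem (mul_mem (mul_mem (mul_mem (zpow_mem ha α) (zpow_mem hb β)) (zpow_mem hc γ))
    (zpow_mem hd δ)) hprod
  refine (mem_realizedClasses (x := (_, _))).1 ?_
  convert key using 1
  refine Prod.ext ?_ (Prod.ext ?_ ?_)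
  · rw [Prod.fst_mul, ← MonoidHom.coe_fst, map_list_prod, List.map_ofFn]
    rfl
  · rw [Prod.snd_mul, Prod.fst_mul, ← MonoidHom.coe_snd, ← MonoidHom.coe_fst, map_list_prod,
      map_list_prod, List.map_ofFn, List.map_ofFn]
    simp only [MonoidHom.coe_snd, MonoidHom.coe_fst, Prod.snd_mul, Prod.fst_mul, Prod.pow_mk,
      one_zpow, one_mul]
    rfl
  · rw [Prod.snd_mul, Prod.snd_mul, ← MonoidHom.coe_snd, ← MonoidHom.coe_snd, map_list_prod,
      map_list_prod, List.map_ofFn, List.map_ofFn, List.prod_ofFn]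
    apply Multiplicative.toAdd.injective
    simp only [MonoidHom.coe_snd, Prod.pow_mk, toAdd_mul, toAdd_zpow, toAdd_prod,
      indicator, toAdd_ofAdd, Function.comp_apply, Prod.mk_mul_mk]
    funext i
    simp only [Pi.add_apply, Pi.smul_apply, Finset.sum_apply]
    revert i
    refine forall_fin_three ?_ ?_ ?_
    · simp
    · simp [Finset.sum_add_distrib]; ring
    · simp

/-! ### Loops as functions on the circle -/

/-- The point of the circle at the time `t`. -/
def turn (t : ℝ) : Circle := Circle.exp (2 * Real.pi * t)

lemma continuous_turn : Continuous turn := by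
  unfold turn
  fun_prop

lemma turn_eq_iff {s t : ℝ} : turn s = turn t ↔ ∃ n : ℤ, s = t + n := by
  rw [turn, turn, Circle.exp_eq_exp]
  refine exists_congr fun n => ⟨fun h => ?_, fun h => by rw [h]; ring⟩
  have h' : 2 * Real.pi * s = 2 * Real.pi * (t + n) := by linarith
  exact mul_left_cancel₀ Real.two_pi_pos.ne' h'

lemma turn_add_int (t : ℝ) (n : ℤ) : turn (t + n) = turn t := turn_eq_iff.2 ⟨n, rfl⟩

lemma turn_zero : turn 0 = 1 := by simp [turn]

lemma turn_one : turn 1 = 1 := by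
  rw [← turn_zero]
  exact turn_eq_iff.2 ⟨1, by simp⟩

lemma coe_turn (t : ℝ) : (turn t : ℂ) = Complex.exp ((2 * Real.pi * t : ℝ) * Complex.I) := rfl

lemma turn_eq_cases {s t : I} (h : turn s = turn t) :
    s = t ∨ (s = 0 ∧ t = 1) ∨ (s = 1 ∧ t = 0) := by
  obtain ⟨n, hn⟩ := turn_eq_iff.1 h
  have hs := s.2
  have ht := t.2
  have h1 : n ≤ 1 := by
    have : (n : ℝ) ≤ 1 := by linarith [hs.2, ht.1]
    exact_mod_cast this
  have h2 : -1 ≤ n := by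
    have : (-1 : ℝ) ≤ n := by linarith [hs.1, ht.2]
    exact_mod_cast this
  have h3 : n = -1 ∨ n = 0 ∨ n = 1 := by omega
  rcases h3 with rfl | rfl | rfl
  · right; left
    push_cast at hn
    exact ⟨Subtype.ext (by change (s : ℝ) = 0; linarith [hs.1, ht.2]),
      Subtype.ext (by change (t : ℝ) = 1; linarith [hs.1, ht.2])⟩
  · left
    exact Subtype.ext (by simpa using hn)
  · right; right
    push_cast at hn
    exact ⟨Subtype.ext (by change (s : ℝ) = 1; linarith [hs.2, ht.1]),
      Subtype.ext (by change (t : ℝ) = 0; linarith [hs.2, ht.1])⟩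

lemma turn_surjective : Function.Surjective fun t : I => turn t := by
  intro u
  set x : ℝ := Complex.arg u / (2 * Real.pi) with hx
  have hu : turn x = u := by
    rw [turn, hx, mul_div_cancel₀ _ Real.two_pi_pos.ne', Circle.exp_arg]
  refine ⟨⟨Int.fract x, Int.fract_nonneg x, (Int.fract_lt_one x).le⟩, ?_⟩
  change turn (Int.fract x) = u
  rw [← hu, ← turn_add_int (Int.fract x) ⌊x⌋, Int.fract_add_floor]

/-- A time at which the circle passes through a given point. -/
def time (u : Circle) : I := (turn_surjective u).choose

lemma turn_time (u : Circle) : turn (time u) = u := (turn_surjective u).choose_spec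

lemma isQuotientMap_turn : Topology.IsQuotientMap fun t : I => turn t :=
  .of_surjective_continuous turn_surjective (continuous_turn.comp continuous_subtype_val)

/-- `time` is an arbitrary section of the circle parametrization, in general discontinuous. Its only
ambiguity is the choice between 0 and 1, and the condition `f 0 = f 1` makes it harmless. -/
lemma apply_time_turn {X : Type*} {f : I → X} (h : f 0 = f 1) (t : I) :
    f (time (turn t)) = f t := by
  rcases turn_eq_cases (turn_time (turn t)) with h1 | ⟨h1, h2⟩ | ⟨h1, h2⟩
  · rw [h1]
  · rw [h1, h2, h]
  · rw [h1, h2, h]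

/-- Continuity can be tested after composing with the quotient map from the interval to the circle,
where the section disappears. -/
lemma continuous_comp_time {X : Type*} [TopologicalSpace X] {f : I → X} (hf : Continuous f)
    (h : f 0 = f 1) : Continuous fun u => f (time u) := by
  rw [isQuotientMap_turn.continuous_iff]
  exact hf.congr fun t => (apply_time_turn h t).symm

/-! ### Coordinates on the three-sphere -/

/-- An inverse that is continuous on an open range makes a continuous map an open embedding. -/
lemma isOpenEmbedding_of_inverse {X Y : Type*} [TopologicalSpace X] [TopologicalSpace Y]
    {f : X → Y} (g : Y → X) {U : Set Y} (hf : Continuous f) (hU : IsOpen U) (hg : ContinuousOn g U)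
    (hfU : ∀ x, f x ∈ U) (hgf : ∀ x, g (f x) = x) (hfg : ∀ y ∈ U, f (g y) = y) :
    Topology.IsOpenEmbedding f :=
  OpenPartialHomeomorph.isOpenEmbedding
    { toFun := f
      invFun := g
      source := Set.univ
      target := U
      map_source' := fun x _ => hfU x
      map_target' := fun _ _ => Set.mem_univ _
      left_inv' := fun x _ => hgf x
      right_inv' := hfg
      open_source := isOpen_univ
      open_target := hU
      continuousOn_toFun := hf.continuousOn
      continuousOn_invFun := hg } rfl

lemma sqrt_pos_of_ne {z w : ℂ} (h : z ≠ 0 ∨ w ≠ 0) : 0 < Real.sqrt (‖z‖ ^ 2 + ‖w‖ ^ 2) := by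
  apply Real.sqrt_pos.2
  rcases h with h | h
  · have := norm_pos_iff.2 h
    positivity
  · have := norm_pos_iff.2 h
    positivity

/-- The point of the three-sphere in the direction of a non-zero vector. -/
def proj (z w : ℂ) (h : z ≠ 0 ∨ w ≠ 0) : S3 :=
  ⟨((Real.sqrt (‖z‖ ^ 2 + ‖w‖ ^ 2))⁻¹ : ℝ) • !₂[z, w], by
    rw [mem_sphere_zero_iff_norm, norm_smul, EuclideanSpace.norm_eq]
    simp only [Fin.sum_univ_two, Matrix.cons_val_zero, Matrix.cons_val_one]
    rw [Real.norm_of_nonneg (inv_nonneg.2 (sqrt_pos_of_ne h).le),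
      inv_mul_cancel₀ (sqrt_pos_of_ne h).ne']⟩

lemma proj_zero {z w : ℂ} (h : z ≠ 0 ∨ w ≠ 0) :
    (proj z w h).1 0 = ((Real.sqrt (‖z‖ ^ 2 + ‖w‖ ^ 2))⁻¹ : ℝ) * z := by
  simp [proj]

lemma proj_one {z w : ℂ} (h : z ≠ 0 ∨ w ≠ 0) :
    (proj z w h).1 1 = ((Real.sqrt (‖z‖ ^ 2 + ‖w‖ ^ 2))⁻¹ : ℝ) * w := by
  simp [proj]

lemma continuous_s3_apply (i : Fin 2) : Continuous fun x : S3 => x.1 i := by fun_prop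

lemma s3_ext {x y : S3} (h0 : x.1 0 = y.1 0) (h1 : x.1 1 = y.1 1) : x = y := by
  apply Subtype.ext
  ext i
  fin_cases i
  · exact h0
  · exact h1

/-- Points of the sphere correspond to open rays in ℂ². Later computations use unnormalized
representatives and compare them up to a positive factor. -/
lemma proj_eq_iff {z w z' w' : ℂ} {h : z ≠ 0 ∨ w ≠ 0} {h' : z' ≠ 0 ∨ w' ≠ 0} :
    proj z w h = proj z' w' h' ↔ ∃ r : ℝ, 0 < r ∧ z = r * z' ∧ w = r * w' := by
  have p := sqrt_pos_of_ne h
  have p' := sqrt_pos_of_ne h'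
  constructor
  · intro e
    have e0 := congrArg (fun x : S3 => x.1 0) e
    have e1 := congrArg (fun x : S3 => x.1 1) e
    simp only [proj_zero, proj_one] at e0 e1
    generalize Real.sqrt (‖z‖ ^ 2 + ‖w‖ ^ 2) = a at *
    generalize Real.sqrt (‖z'‖ ^ 2 + ‖w'‖ ^ 2) = a' at *
    have ha : (a : ℂ) ≠ 0 := by exact_mod_cast p.ne'
    have ha' : (a' : ℂ) ≠ 0 := by exact_mod_cast p'.ne'
    refine ⟨a / a', by positivity, ?_, ?_⟩
    · push_cast at e0 ⊢
      field_simp at e0 ⊢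
      linear_combination e0
    · push_cast at e1 ⊢
      field_simp at e1 ⊢
      linear_combination e1
  · rintro ⟨r, hr, rfl, rfl⟩
    have hs : Real.sqrt (‖(r : ℂ) * z'‖ ^ 2 + ‖(r : ℂ) * w'‖ ^ 2) =
        r * Real.sqrt (‖z'‖ ^ 2 + ‖w'‖ ^ 2) := by
      rw [norm_mul, norm_mul, Complex.norm_real, Real.norm_of_nonneg hr.le, mul_pow, mul_pow,
        ← mul_add, Real.sqrt_mul (by positivity), Real.sqrt_sq hr.le]
    have hr' : (r : ℂ) ≠ 0 := by exact_mod_cast hr.ne'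
    apply s3_ext
    · rw [proj_zero, proj_zero, hs]
      push_cast
      rw [mul_inv]
      field_simp
    · rw [proj_one, proj_one, hs]
      push_cast
      rw [mul_inv]
      field_simp

lemma proj_congr {z w z' w' : ℂ} {h : z ≠ 0 ∨ w ≠ 0} {h' : z' ≠ 0 ∨ w' ≠ 0} (hz : z = z')
    (hw : w = w') : proj z w h = proj z' w' h' := by
  subst hz hw
  rfl

lemma s3_norm (x : S3) : ‖x.1 0‖ ^ 2 + ‖x.1 1‖ ^ 2 = 1 := by
  have h := mem_sphere_zero_iff_norm.1 x.2
  rw [EuclideanSpace.norm_eq, Real.sqrt_eq_one, Fin.sum_univ_two] at h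
  exact h

lemma s3_ne_zero (x : S3) : x.1 0 ≠ 0 ∨ x.1 1 ≠ 0 := by
  by_contra! h
  have := s3_norm x
  rw [h.1, h.2] at this
  norm_num at this

lemma proj_self (x : S3) : proj (x.1 0) (x.1 1) (s3_ne_zero x) = x := by
  apply s3_ext
  · rw [proj_zero, s3_norm]
    simp
  · rw [proj_one, s3_norm]
    simp

lemma continuous_proj {X : Type*} [TopologicalSpace X] {f g : X → ℂ} (hf : Continuous f)
    (hg : Continuous g) (h : ∀ x, f x ≠ 0 ∨ g x ≠ 0) :
    Continuous fun x => proj (f x) (g x) (h x) := by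
  refine Continuous.subtype_mk ?_ _
  have hs : ∀ x, Real.sqrt (‖f x‖ ^ 2 + ‖g x‖ ^ 2) ≠ 0 := fun x => (sqrt_pos_of_ne (h x)).ne'
  have h1 : Continuous fun x => (Real.sqrt (‖f x‖ ^ 2 + ‖g x‖ ^ 2))⁻¹ :=
    Continuous.inv₀ (by fun_prop) hs
  refine h1.smul ((PiLp.continuous_toLp 2 _).comp (continuous_pi fun i => ?_))
  fin_cases i
  · exact hf
  · exact hg

/-- The point of the three-sphere over the point `z` of the page at the angle `u`. -/
def cyl (p : Circle × ℂ) : S3 := proj p.2 p.1 (Or.inr p.1.coe_ne_zero)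

lemma continuous_cyl : Continuous cyl :=
  continuous_proj continuous_snd (continuous_subtype_val.comp continuous_fst) _

lemma cyl_injective : Function.Injective cyl := by
  rintro ⟨u, z⟩ ⟨u', z'⟩ h
  obtain ⟨r, hr, hz, hu⟩ := proj_eq_iff.1 h
  have hn := congrArg norm hu
  rw [norm_mul, Circle.norm_coe, Circle.norm_coe, Complex.norm_real, Real.norm_of_nonneg hr.le,
    mul_one] at hn
  subst hn
  simp only [Complex.ofReal_one, one_mul] at hz hu
  exact Prod.ext (Circle.ext hu) hz

lemma sphereCoord_eq_cyl (z : ℂ) (θ : ℝ) : sphereCoord (z, θ) = cyl (Circle.exp θ, z) := by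
  apply Subtype.ext
  simp only [sphereCoord, cyl, proj, Circle.coe_exp, Complex.norm_exp_ofReal_mul_I, one_pow]
  rw [add_comm]

lemma sphereCoord_turn (z : ℂ) (t : ℝ) : sphereCoord (z, 2 * Real.pi * t) = cyl (turn t, z) :=
  sphereCoord_eq_cyl z _

lemma cyl_one_ne_zero (p : Circle × ℂ) : (cyl p).1 1 ≠ 0 := by
  rw [cyl, proj_one]
  exact mul_ne_zero
    (Complex.ofReal_ne_zero.2 (inv_pos.2 (sqrt_pos_of_ne (Or.inr p.1.coe_ne_zero))).ne')
    p.1.coe_ne_zero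

/-- The direction of a complex number. -/
def direction (w : ℂ) : Circle := Circle.exp (Complex.arg w)

lemma coe_direction {w : ℂ} (h : w ≠ 0) : (direction w : ℂ) = w / ‖w‖ := by
  have hn : (‖w‖ : ℂ) ≠ 0 := by exact_mod_cast (norm_pos_iff.2 h).ne'
  rw [direction, Circle.coe_exp, eq_div_iff hn, mul_comm]
  exact Complex.norm_mul_exp_arg_mul_I w

lemma continuousOn_direction : ContinuousOn direction {w : ℂ | w ≠ 0} := by
  have hi : Topology.IsInducing fun u : Circle => (u : ℂ) := ⟨rfl⟩
  have h : ContinuousOn (fun w : ℂ => w / ‖w‖) {w : ℂ | w ≠ 0} :=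
    continuousOn_id.div (by fun_prop) fun w hw => by exact_mod_cast (norm_pos_iff.2 hw).ne'
  exact hi.continuousOn_iff.2 (h.congr fun w hw => coe_direction hw)

/-- The inverse of `cyl`. -/
def cylInv (x : S3) : Circle × ℂ := (direction (x.1 1), x.1 0 / ‖x.1 1‖)

lemma continuousOn_cylInv : ContinuousOn cylInv {x : S3 | x.1 1 ≠ 0} := by
  refine ContinuousOn.prodMk ?_ ?_
  · exact continuousOn_direction.comp (continuous_s3_apply 1).continuousOn fun x hx => hx
  · exact (continuous_s3_apply 0).continuousOn.div
      (Complex.continuous_ofReal.comp (continuous_s3_apply 1).norm).continuousOn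
      fun x hx => Complex.ofReal_ne_zero.2 (norm_pos_iff.2 hx).ne'

lemma cyl_cylInv {x : S3} (hx : x.1 1 ≠ 0) : cyl (cylInv x) = x := by
  have hp := norm_pos_iff.2 hx
  have hn : (‖x.1 1‖ : ℂ) ≠ 0 := by exact_mod_cast hp.ne'
  rw [← proj_self x]
  refine proj_eq_iff.2 ⟨‖x.1 1‖⁻¹, by positivity, ?_, ?_⟩
  · rw [proj_self]
    simp only [cylInv]
    push_cast
    field_simp
  · rw [proj_self]
    simp only [cylInv]
    rw [coe_direction hx]
    push_cast
    field_simp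

lemma isOpen_s3_one_ne_zero : IsOpen {x : S3 | x.1 1 ≠ 0} :=
  isOpen_ne_fun (continuous_s3_apply 1) continuous_const

lemma cylInv_cyl (p : Circle × ℂ) : cylInv (cyl p) = p :=
  cyl_injective (cyl_cylInv (cyl_one_ne_zero p))

lemma isOpenEmbedding_cyl : Topology.IsOpenEmbedding cyl :=
  isOpenEmbedding_of_inverse cylInv continuous_cyl isOpen_s3_one_ne_zero continuousOn_cylInv
    cyl_one_ne_zero cylInv_cyl fun _ => cyl_cylInv

/-! ### The radial compression of the plane -/

/-- The radial compression of the plane to the disk of radius `3/2`. It carries the unit circle to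
the circle of radius `5/4`. -/
def radial (w : ℂ) : ℂ := ((3 / 2) / (1 / 5 + ‖w‖) : ℝ) * w

lemma radial_denom_pos (w : ℂ) : 0 < 1 / 5 + ‖w‖ := by positivity

lemma continuous_radial : Continuous radial := by
  unfold radial
  have h : ∀ w : ℂ, 1 / 5 + ‖w‖ ≠ 0 := fun w => (radial_denom_pos w).ne'
  fun_prop (disch := exact h _)

lemma norm_radial (w : ℂ) : ‖radial w‖ = 3 / 2 * ‖w‖ / (1 / 5 + ‖w‖) := by
  have := radial_denom_pos w
  rw [radial, norm_mul, Complex.norm_real, Real.norm_of_nonneg (by positivity)]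
  ring

lemma norm_radial_lt (w : ℂ) : ‖radial w‖ < 3 / 2 := by
  rw [norm_radial, div_lt_iff₀ (radial_denom_pos w)]
  linarith

lemma radial_zero : radial 0 = 0 := by simp [radial]

lemma norm_radial_lt_iff {w : ℂ} : ‖radial w‖ < 5 / 4 ↔ ‖w‖ < 1 := by
  rw [norm_radial, div_lt_iff₀ (radial_denom_pos w)]
  constructor <;> intro h <;> linarith

lemma radial_of_norm_one {w : ℂ} (h : ‖w‖ = 1) : radial w = (5 / 4 : ℝ) * w := by
  rw [radial, h]
  norm_num

/-- The inverse of the radial compression. -/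
def radialInv (y : ℂ) : ℂ := ((1 / 5) / (3 / 2 - ‖y‖) : ℝ) * y

lemma radialInv_radial (w : ℂ) : radialInv (radial w) = w := by
  have hp := radial_denom_pos w
  have h : 3 / 2 - ‖radial w‖ = (3 / 10) / (1 / 5 + ‖w‖) := by
    rw [norm_radial]
    field_simp
    ring
  rw [radialInv, h, radial, ← mul_assoc, ← Complex.ofReal_mul]
  have : (1 / 5 / (3 / 10 / (1 / 5 + ‖w‖)) * (3 / 2 / (1 / 5 + ‖w‖)) : ℝ) = 1 := by
    field_simp
    norm_num
  rw [this, Complex.ofReal_one, one_mul]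

lemma radial_radialInv {y : ℂ} (hy : ‖y‖ < 3 / 2) : radial (radialInv y) = y := by
  have hp : 0 < 3 / 2 - ‖y‖ := by linarith
  obtain ⟨d, hd⟩ : ∃ d, d = 3 / 2 - ‖y‖ := ⟨_, rfl⟩
  have hd' : ‖y‖ = 3 / 2 - d := by linarith
  rw [← hd] at hp
  have h : 1 / 5 + ‖radialInv y‖ = (3 / 10) / (3 / 2 - ‖y‖) := by
    rw [radialInv, norm_mul, Complex.norm_real, ← hd, Real.norm_of_nonneg (by positivity), hd']
    field_simp
    ring
  rw [radial, h, radialInv, ← mul_assoc, ← Complex.ofReal_mul, ← hd]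
  have : (3 / 2 / (3 / 10 / d) * (1 / 5 / d) : ℝ) = 1 := by
    field_simp
    norm_num
  rw [this, Complex.ofReal_one, one_mul]

lemma isOpenEmbedding_radial : Topology.IsOpenEmbedding radial := by
  refine isOpenEmbedding_of_inverse radialInv (U := {y | ‖y‖ < 3 / 2}) continuous_radial
    (isOpen_lt continuous_norm continuous_const) ?_ norm_radial_lt radialInv_radial
    fun y hy => radial_radialInv hy
  unfold radialInv
  refine ContinuousOn.mul (Complex.continuous_ofReal.comp_continuousOn ?_) continuousOn_id
  refine continuousOn_const.div (by fun_prop) fun y hy => ?_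
  exact ne_of_gt (sub_pos.2 hy)

/-! ### Loops in the image of a plane -/

section Lattice

variable {E X : Type*} [TopologicalSpace E] [TopologicalSpace X]

/-- The image of a path, with prescribed names of the end points. -/
def pushPath (F : C(E, X)) {x y : E} (P : Path x y) {a b : X} (ha : a = F x) (hb : b = F y) :
    Path a b :=
  (P.map F.continuous).cast ha hb

lemma pushPath_apply (F : C(E, X)) {x y : E} (P : Path x y) {a b : X} (ha : a = F x)
    (hb : b = F y) (t : I) : pushPath F P ha hb t = F (P t) := rfl

/-- Homotopies in the simply connected source are pushed forward, so only the end points of the path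
upstairs matter. -/
lemma pushPath_homotopic [SimplyConnectedSpace E] (F : C(E, X)) {x y : E} (P Q : Path x y)
    {a b : X} (ha : a = F x) (hb : b = F y) :
    Path.Homotopic (pushPath F P ha hb) (pushPath F Q ha hb) :=
  ((SimplyConnectedSpace.paths_homotopic P Q).map F).pathCast ha hb

lemma pushPath_trans (F : C(E, X)) {x y z : E} (P : Path x y) (Q : Path y z) {a b c : X}
    (ha : a = F x) (hb : b = F y) (hc : c = F z) :
    pushPath F (P.trans Q) ha hc = (pushPath F P ha hb).trans (pushPath F Q hb hc) := by
  ext t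
  rw [pushPath_apply, Path.trans_apply, Path.trans_apply]
  split_ifs <;> rfl

/-- A loop that contracts to a point through loops is trivial. -/
lemma homotopic_refl_of_square (G : C(ℝ × ℝ, X)) (h : ∀ s, G (s, 1) = G (s, 0))
    (h1 : ∀ t, G (1, t) = G (1, 0)) {a : X} (ha : a = G (0, 0)) (p : Path a a)
    (hp : ∀ t : I, p t = G (0, t)) : Path.Homotopic p (Path.refl a) := by
  let P : Path ((0, 0) : ℝ × ℝ) (0, 1) :=
    ⟨⟨fun t => (0, t), by fun_prop⟩, by simp, by simp⟩
  let A : Path ((0, 0) : ℝ × ℝ) (1, 0) :=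
    ⟨⟨fun t => (t, 0), by fun_prop⟩, by simp, by simp⟩
  let C : Path ((1, 0) : ℝ × ℝ) (1, 1) :=
    ⟨⟨fun t => (1, t), by fun_prop⟩, by simp, by simp⟩
  let B : Path ((1, 1) : ℝ × ℝ) (0, 1) :=
    ⟨⟨fun t => (unitInterval.symm t, 1), by fun_prop⟩, by simp, by simp⟩
  have ha' : a = G (0, 1) := ha.trans (h 0).symm
  have hpP : p = pushPath G P ha ha' := by
    ext t
    exact hp t
  have hC : pushPath G C rfl (h 1).symm = Path.refl (G (1, 0)) := by
    ext t
    exact h1 t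
  have hB : pushPath G B (h 1).symm ha' = (pushPath G A ha rfl).symm := by
    ext t
    exact h _
  rw [hpP]
  -- The left side of the square is replaced by the other three sides. The far side is constant, and
  -- the two remaining ones have inverse images, so the product contracts.
  refine (pushPath_homotopic G P ((A.trans C).trans B) ha ha').trans ?_
  rw [pushPath_trans G _ _ ha (h 1).symm ha', pushPath_trans G _ _ ha rfl (h 1).symm, hC, hB]
  exact (Path.Homotopic.hcomp ⟨Path.Homotopy.transRefl _⟩ (Path.Homotopic.refl _)).trans
    ⟨(Path.Homotopy.reflTransSymm _).symm⟩

variable (F : C(ℝ × ℝ, X)) {a : X} (ha : a = F (0, 0))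

lemma eq_lattice (F : C(ℝ × ℝ, X)) {a : X} (ha : a = F (0, 0))
    (hF : ∀ (v : ℝ × ℝ) (p q : ℤ), F (v.1 + p, v.2 + q) = F v) (p q : ℤ) :
    a = F ((p : ℝ), (q : ℝ)) := by
  rw [ha]
  simpa using (hF (0, 0) p q).symm

/-- The class of the image of a path between lattice points under a doubly periodic map. -/
def latticeHom (hF : ∀ (v : ℝ × ℝ) (p q : ℤ), F (v.1 + p, v.2 + q) = F v) :
    Multiplicative (ℤ × ℤ) →* (FundamentalGroup X a)ᵐᵒᵖ where
  toFun v := MulOpposite.op (FundamentalGroup.fromPath (Path.Homotopic.Quotient.mk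
    (pushPath F (PathConnectedSpace.somePath ((0, 0) : ℝ × ℝ)
      ((v.toAdd.1 : ℝ), (v.toAdd.2 : ℝ))) ha (eq_lattice F ha hF _ _))))
  map_one' := by
    apply MulOpposite.unop_injective
    refine Path.Homotopic.Quotient.eq.2 ?_
    have : (((1 : Multiplicative (ℤ × ℤ)).toAdd.1 : ℝ),
        ((1 : Multiplicative (ℤ × ℤ)).toAdd.2 : ℝ)) = ((0, 0) : ℝ × ℝ) := by simp
    refine (pushPath_homotopic F _ ((Path.refl (0, 0)).cast rfl this) ha _).trans ?_
    have h : pushPath F ((Path.refl ((0, 0) : ℝ × ℝ)).cast rfl this) ha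
        (eq_lattice F ha hF _ _) = Path.refl a := by
      ext t
      exact ha.symm
    rw [h]
  map_mul' v w := by
    apply MulOpposite.unop_injective
    refine Path.Homotopic.Quotient.eq.2 ?_
    let P := PathConnectedSpace.somePath ((0, 0) : ℝ × ℝ) ((v.toAdd.1 : ℝ), (v.toAdd.2 : ℝ))
    let Q := PathConnectedSpace.somePath ((0, 0) : ℝ × ℝ) ((w.toAdd.1 : ℝ), (w.toAdd.2 : ℝ))
    -- A translate of `Q` by the lattice vector of `v`: it continues `P`, and by periodicity it has
    -- the same image as `Q`.
    let Q' : Path ((v.toAdd.1 : ℝ), (v.toAdd.2 : ℝ))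
        (((v * w).toAdd.1 : ℝ), ((v * w).toAdd.2 : ℝ)) :=
      ⟨⟨fun t => ((Q t).1 + v.toAdd.1, (Q t).2 + v.toAdd.2), by fun_prop⟩, by simp,
        by simp [add_comm]⟩
    refine (pushPath_homotopic F _ (P.trans Q') ha _).trans ?_
    rw [pushPath_trans F _ _ ha (eq_lattice F ha hF _ _)]
    have hQ : pushPath F Q' (eq_lattice F ha hF _ _) (eq_lattice F ha hF _ _) =
        pushPath F Q ha (eq_lattice F ha hF _ _) := by
      ext t
      exact hF (Q t) _ _
    rw [hQ]

/-- The value may be computed with any path between the lattice points: a straight one for the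
longitude and the meridian, a graph over the time axis for the parallel that does not turn. -/
lemma latticeHom_apply (hF : ∀ (v : ℝ × ℝ) (p q : ℤ), F (v.1 + p, v.2 + q) = F v) (p q : ℤ)
    (P : Path ((0, 0) : ℝ × ℝ) ((p : ℝ), (q : ℝ))) (γ : Path a a)
    (hγ : ∀ t, γ t = F (P t)) :
    (latticeHom F ha hF (Multiplicative.ofAdd (p, q))).unop =
      FundamentalGroup.fromPath (Path.Homotopic.Quotient.mk γ) := by
  have : γ = pushPath F P ha (eq_lattice F ha hF p q) := by
    ext t
    exact hγ t
  rw [this]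
  exact Path.Homotopic.Quotient.eq.2 (pushPath_homotopic F _ _ _ _)

end Lattice

/-! ### The tubes of a motion -/

namespace Motion

variable (m : Motion) (i : Fin 3)

/-- The centre of the `i`-th hole at the time that belongs to a point of the circle. -/
def center (u : Circle) : ℂ := m.toHomeo (time u) (basePoint.1 i)

/-- The rotation of the `i`-th hole at the time that belongs to a point of the circle. -/
def rot (u : Circle) : ℂ := Complex.exp (m.angle i (time u) * Complex.I)

lemma center_loop : m.toHomeo (0 : I) (basePoint.1 i) = m.toHomeo (1 : I) (basePoint.1 i) := by
  rw [Set.Icc.coe_zero, Set.Icc.coe_one, m.start _ le_rfl, m.closed]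

lemma rot_loop : Complex.exp (m.angle i (0 : I) * Complex.I) =
    Complex.exp (m.angle i (1 : I) * Complex.I) := by
  rw [Set.Icc.coe_zero, Set.Icc.coe_one, m.angle_start _ _ le_rfl, m.angle_finish _ _ le_rfl,
    exp_int_mul_two_pi]
  simp

lemma center_turn (t : I) : m.center i (turn t) = m.toHomeo t (basePoint.1 i) :=
  apply_time_turn (f := fun t : I => m.toHomeo t (basePoint.1 i)) (m.center_loop i) t

lemma rot_turn (t : I) : m.rot i (turn t) = Complex.exp (m.angle i t * Complex.I) :=
  apply_time_turn (f := fun t : I => Complex.exp (m.angle i t * Complex.I)) (m.rot_loop i) t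

lemma continuous_center : Continuous (m.center i) :=
  continuous_comp_time (f := fun t : I => m.toHomeo t (basePoint.1 i))
    (m.continuous_toHomeo.comp (continuous_subtype_val.prodMk continuous_const)) (m.center_loop i)

lemma continuous_rot : Continuous (m.rot i) := by
  have h := m.continuous_angle i
  exact continuous_comp_time (f := fun t : I => Complex.exp (m.angle i t * Complex.I))
    (by fun_prop) (m.rot_loop i)

lemma rot_ne_zero (u : Circle) : m.rot i u ≠ 0 := Complex.exp_ne_zero _

/-- On the rigid disk the motion is a translation combined with a rotation. This identifies the
tube, defined by a formula continuous on the circle, with the track of the disk under the motion. -/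
lemma center_add_rot_mul (u : Circle) {y : ℂ} (hy : ‖y‖ ≤ 3 / 2) :
    m.center i u + m.rot i u * y = m.toHomeo (time u) (basePoint.1 i + y) := by
  rw [m.rigid (time u) i (basePoint.1 i + y) (by simpa using hy), add_sub_cancel_left]
  rfl

/-- The motion of the tubular neighbourhood of the `i`-th strand. -/
def shear : Circle × ℂ ≃ₜ Circle × ℂ where
  toFun p := (p.1, m.center i p.1 + m.rot i p.1 * p.2)
  invFun p := (p.1, (m.rot i p.1)⁻¹ * (p.2 - m.center i p.1))
  left_inv p := by
    have := m.rot_ne_zero i p.1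
    simp [this]
  right_inv p := by
    have := m.rot_ne_zero i p.1
    simp [this]
  continuous_toFun := by
    have h1 := m.continuous_center i
    have h2 := m.continuous_rot i
    fun_prop
  continuous_invFun := by
    have h1 := m.continuous_center i
    have h2 := m.continuous_rot i
    have h3 : Continuous fun p : Circle × ℂ => (m.rot i p.1)⁻¹ :=
      (h2.comp continuous_fst).inv₀ fun p => m.rot_ne_zero i p.1
    fun_prop

/-- The tubular neighbourhood of the closed `i`-th strand. -/
def tubeFun (p : Circle × ℂ) : S3 := cyl (p.1, m.center i p.1 + m.rot i p.1 * radial p.2)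

lemma isOpenEmbedding_tubeFun : Topology.IsOpenEmbedding (m.tubeFun i) :=
  isOpenEmbedding_cyl.comp ((m.shear i).isOpenEmbedding.comp
    (Topology.IsOpenEmbedding.id.prodMap isOpenEmbedding_radial))

lemma tubeFun_eq (p : Circle × ℂ) :
    m.tubeFun i p = cyl (p.1, m.toHomeo (time p.1) (basePoint.1 i + radial p.2)) := by
  rw [tubeFun, m.center_add_rot_mul i p.1 (norm_radial_lt _).le]

lemma range_tubeFun_zero : m.trace.closure i = Set.range fun u => m.tubeFun i (u, 0) := by
  have h : ∀ t : I, sphereCoord ((m.trace t).1 i, 2 * Real.pi * t) = m.tubeFun i (turn t, 0) := by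
    intro t
    rw [sphereCoord_turn, tubeFun, radial_zero, mul_zero, add_zero, m.center_turn]
    rfl
  apply Set.Subset.antisymm
  · rintro _ ⟨t, rfl⟩
    exact ⟨turn t, (h t).symm⟩
  · rintro _ ⟨u, rfl⟩
    refine ⟨time u, (h (time u)).trans ?_⟩
    rw [turn_time]

/-- The motion does not start before the time `1/2`. -/
def Delayed : Prop :=
  (∀ t ≤ 1 / 2, ∀ z, m.toHomeo t z = z) ∧ ∀ i, ∀ t ≤ 1 / 2, m.angle i t = 0

/-- Waiting first changes the trace only by a homotopy. It provides a span of time in which the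
motion is the identity and orientations can be read off. -/
lemma delayed_concat_still : (still.concat m).Delayed := by
  refine ⟨fun t ht z => ?_, fun i t ht => ?_⟩
  · exact m.start _ (by linarith) z
  · change 0 + m.angle i (2 * t - 1) = 0
    rw [m.angle_start i _ (by linarith), add_zero]

lemma exists_turn_eq_exp {θ : ℝ} (h0 : 0 < θ) (h1 : θ < Real.pi) :
    ∃ t : I, Circle.exp θ = turn t ∧ (t : ℝ) ≤ 1 / 2 := by
  have hpi := Real.pi_pos
  have h2 : θ / (2 * Real.pi) ≤ 1 / 2 := by
    rw [div_le_iff₀ (by positivity)]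
    linarith
  refine ⟨⟨θ / (2 * Real.pi), by positivity, by linarith⟩, ?_, h2⟩
  rw [turn]
  congr 1
  field_simp

/-- The compression multiplies by a positive real factor, which is interpolated linearly to 1; the
factor stays positive, so zeros occur only at the centre. -/
lemma hasLocalDegreeOne_radial (c : ℂ) (θ : ℝ) :
    HasLocalDegreeOne (fun q => (c + radial q.1, q.2)) (0, θ) := by
  refine ⟨1, one_pos, fun p => (c + ((1 - p.1) * ((3 / 2) / (1 / 5 + ‖p.2.1‖)) + p.1 : ℝ) * p.2.1,
    p.2.2), ?_, ?_, ?_, ?_⟩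
  · have h : ∀ p : ℝ × ℂ × ℝ, 1 / 5 + ‖p.2.1‖ ≠ 0 := fun p => (radial_denom_pos p.2.1).ne'
    exact Continuous.continuousOn (by fun_prop (disch := exact h))
  · intro q _
    simp [radial]
  · intro q _
    ext <;> simp [radial_zero]
  · intro s hs q _
    have hk : 0 < (1 - s) * ((3 / 2) / (1 / 5 + ‖q.1‖)) + s := by
      have hk' : 0 < (3 / 2) / (1 / 5 + ‖q.1‖) := div_pos (by norm_num) (radial_denom_pos _)
      rcases eq_or_lt_of_le hs.1 with h | h
      · rw [← h]
        linarith
      · have := mul_nonneg (sub_nonneg.2 hs.2) hk'.le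
        linarith
    have hk' : (((1 - s) * ((3 / 2) / (1 / 5 + ‖q.1‖)) + s : ℝ) : ℂ) ≠ 0 :=
      Complex.ofReal_ne_zero.2 hk.ne'
    simp only [radial_zero, add_zero, add_eq_left, mul_eq_zero, hk', false_or,
      Prod.ext_iff]

variable {m}

/-- The tubular neighbourhood of the closed `i`-th strand, framed by the rotation of the hole. -/
def tube (hm : m.Delayed) : Tube (m.trace.closure i) where
  toFun := m.tubeFun i
  isOpenEmbedding := m.isOpenEmbedding_tubeFun i
  core := m.range_tubeFun_zero i
  orientation := by
    -- The angle π/2 is time 1/4, inside the waiting period, so near this point the tube is a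
    -- translated radial compression.
    refine ⟨(0, Real.pi / 2), fun q => (basePoint.1 i + radial q.1, q.2), ?_,
      hasLocalDegreeOne_radial _ _⟩
    have ho : ∀ᶠ q : ℂ × ℝ in nhds (0, Real.pi / 2), 0 < q.2 ∧ q.2 < Real.pi :=
      (continuous_snd.tendsto _).eventually
        (Ioo_mem_nhds (by positivity) (half_lt_self Real.pi_pos))
    filter_upwards [ho] with q hq
    refine ⟨_, rfl, ?_⟩
    obtain ⟨t, ht, ht'⟩ := exists_turn_eq_exp hq.1 hq.2
    change m.tubeFun i (Circle.exp q.2, q.1) = sphereCoord _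
    rw [sphereCoord_eq_cyl, tubeFun, ht, center_turn, rot_turn, hm.1 _ ht', hm.2 i _ ht']
    simp

/-! ### The framing of the tubes -/

variable (hm : m.Delayed)

lemma cyl_notMem_closure {u : Circle} {z : ℂ} (h : z ≠ m.center i u) :
    cyl (u, z) ∉ m.trace.closure i := by
  rw [range_tubeFun_zero]
  rintro ⟨v, hv⟩
  have := cyl_injective hv
  simp only [Prod.mk.injEq, radial_zero, mul_zero, add_zero] at this
  obtain ⟨rfl, h'⟩ := this
  exact h h'.symm

/-- The universal covering of the boundary torus of a tube. -/
def torusMap : C(ℝ × ℝ, {x : S3 // x ∉ m.trace.closure i}) where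
  toFun v := ⟨(tube i hm).toFun (turn v.1, (turn v.2 : ℂ)),
    (tube i hm).notMem _ (Circle.coe_ne_zero _)⟩
  continuous_toFun := by
    refine Continuous.subtype_mk ((tube i hm).isOpenEmbedding.continuous.comp ?_) _
    have := continuous_turn
    have h2 : Continuous fun v : ℝ × ℝ => (turn v.2 : ℂ) :=
      continuous_subtype_val.comp (this.comp continuous_snd)
    fun_prop

lemma torusMap_periodic (v : ℝ × ℝ) (p q : ℤ) :
    torusMap i hm (v.1 + p, v.2 + q) = torusMap i hm v := by
  apply Subtype.ext
  change (tube i hm).toFun (turn (v.1 + p), (turn (v.2 + q) : ℂ)) = _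
  rw [turn_add_int, turn_add_int]
  rfl

lemma torusMap_zero : (tube i hm).base = torusMap i hm (0, 0) := by
  apply Subtype.ext
  change (tube i hm).toFun (1, 1) = (tube i hm).toFun (turn 0, (turn 0 : ℂ))
  rw [turn_zero, Circle.coe_one]

lemma center_add_div_ne {r : ℝ} (hr : 0 < r) (u : Circle) :
    m.center i u + (((5 / 4) / r : ℝ) : ℂ) ≠ m.center i u := by
  intro h
  rw [add_eq_left, Complex.ofReal_eq_zero] at h
  exact (div_pos (by norm_num) hr).ne' h

lemma push_ne_zero (r : ℝ) (hr : 0 ≤ r) (u : Circle) :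
    r * m.center i u + (5 / 4 : ℝ) ≠ 0 ∨ r * (u : ℂ) ≠ 0 := by
  rcases eq_or_lt_of_le hr with h | h
  · left
    rw [← h]
    norm_num
  · exact Or.inr (mul_ne_zero (Complex.ofReal_ne_zero.2 h.ne') u.coe_ne_zero)

/-- For `r > 0` this is the point of the fibre over `u` displaced from the strand by the nonzero
number `(5/4)/r`. As `r` tends to 0 the displacement goes to infinity, and at `r = 0` the point lies
on the braid axis, which the closed strand avoids. -/
lemma push_notMem (r : ℝ) (hr : 0 ≤ r) (u : Circle) :
    proj (r * m.center i u + (5 / 4 : ℝ)) (r * (u : ℂ)) (push_ne_zero i r hr u) ∉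
      m.trace.closure i := by
  rcases eq_or_lt_of_le hr with h | h
  · rw [range_tubeFun_zero]
    rintro ⟨v, hv⟩
    have h1 := cyl_one_ne_zero (v, m.center i v + m.rot i v * radial 0)
    change cyl _ = _ at hv
    rw [hv, proj_one, ← h] at h1
    simp at h1
  · have hr' : (r : ℂ) ≠ 0 := Complex.ofReal_ne_zero.2 h.ne'
    have : proj (r * m.center i u + (5 / 4 : ℝ)) (r * (u : ℂ)) (push_ne_zero i r hr u) =
        cyl (u, m.center i u + (((5 / 4) / r : ℝ) : ℂ)) := by
      refine proj_eq_iff.2 ⟨r, h, ?_, rfl⟩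
      push_cast
      field_simp
    rw [this]
    exact cyl_notMem_closure i (center_add_div_ne i h u)

/-- The parallel copies of the strand are pushed to the braid axis. -/
def pushMap : C(ℝ × ℝ, {x : S3 // x ∉ m.trace.closure i}) where
  toFun v := ⟨_, push_notMem i (max 0 (1 - v.1)) (le_max_left _ _) (turn v.2)⟩
  continuous_toFun := by
    have h1 := m.continuous_center i
    have h2 := continuous_turn
    have h3 : Continuous fun v : ℝ × ℝ => (turn v.2 : ℂ) :=
      continuous_subtype_val.comp (h2.comp continuous_snd)
    exact Continuous.subtype_mk (continuous_proj (by fun_prop) (by fun_prop) _) _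

lemma pushMap_apply (s t : ℝ) : (pushMap (m := m) i (s, t)).1 =
    proj ((max 0 (1 - s) : ℝ) * m.center i (turn t) + (5 / 4 : ℝ))
      ((max 0 (1 - s) : ℝ) * (turn t : ℂ))
      (push_ne_zero i _ (le_max_left _ _) _) := rfl

lemma pushMap_zero (t : ℝ) :
    (pushMap (m := m) i (0, t)).1 = cyl (turn t, m.center i (turn t) + (5 / 4 : ℝ)) := by
  rw [pushMap_apply]
  refine proj_congr ?_ ?_
  · simp
  · simp

/-- Running backwards along the meridian by the current angle cancels the rotation of the hole, and
a parallel at the constant displacement 5/4 remains. -/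
lemma torusMap_neg_angle (t : I) :
    torusMap i hm (t, -(m.angle i t / (2 * Real.pi))) = pushMap i (0, t) := by
  apply Subtype.ext
  rw [pushMap_zero]
  change cyl (turn t, m.center i (turn t) + m.rot i (turn t) * radial _) = _
  have hpi := Real.pi_ne_zero
  rw [radial_of_norm_one (Circle.norm_coe _), rot_turn, coe_turn, mul_left_comm, ← Complex.exp_add]
  have : (m.angle i t : ℂ) * Complex.I +
      ((2 * Real.pi * -(m.angle i t / (2 * Real.pi)) : ℝ) : ℂ) * Complex.I = 0 := by
    rw [← add_mul, ← Complex.ofReal_add]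
    have : m.angle i t + 2 * Real.pi * -(m.angle i t / (2 * Real.pi)) = 0 := by
      field_simp
      ring
    rw [this, Complex.ofReal_zero, zero_mul]
  rw [this, Complex.exp_zero, mul_one]

/-- The parallel that does not turn has class (1, -n) in the lattice of the boundary torus, with n
the framing. Pushing it to a single point of the axis shows that this class is trivial in the
complement, so the longitude (1, 0) has the class of n times the meridian (0, 1). -/
lemma hasFraming_tube : (tube i hm).HasFraming (m.framing i) := by
  set L := latticeHom (torusMap i hm) (torusMap_zero i hm) (torusMap_periodic i hm) with hL
  have hlong := latticeHom_apply (torusMap i hm) (torusMap_zero i hm) (torusMap_periodic i hm) 1 0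
    ⟨⟨fun t => (t, 0), by fun_prop⟩, by simp, by simp⟩ (tube i hm).longitude (fun t => by
      apply Subtype.ext
      change _ = (tube i hm).toFun (turn t, (turn 0 : ℂ))
      rw [turn_zero]
      rfl)
  have hmer := latticeHom_apply (torusMap i hm) (torusMap_zero i hm) (torusMap_periodic i hm) 0 1
    ⟨⟨fun t => (0, t), by fun_prop⟩, by simp, by simp⟩ (tube i hm).meridian (fun t => by
      apply Subtype.ext
      change _ = (tube i hm).toFun (turn 0, (turn t : ℂ))
      rw [turn_zero]
      rfl)
  have hangle := m.continuous_angle i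
  have hpi := Real.pi_ne_zero
  let P : Path ((0, 0) : ℝ × ℝ) (((1 : ℤ) : ℝ), ((-m.framing i : ℤ) : ℝ)) :=
    ⟨⟨fun t => (t, -(m.angle i t / (2 * Real.pi))), by fun_prop⟩,
      by simp [m.angle_start i 0 le_rfl],
      by simp [m.angle_finish i 1 le_rfl, hpi]⟩
  have hbase : (tube i hm).base = torusMap i hm (((1 : ℤ) : ℝ), ((-m.framing i : ℤ) : ℝ)) :=
    eq_lattice _ (torusMap_zero i hm) (torusMap_periodic i hm) _ _
  have hpush := latticeHom_apply (torusMap i hm) (torusMap_zero i hm) (torusMap_periodic i hm)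
    1 (-m.framing i) P (pushPath _ P (torusMap_zero i hm) hbase) (fun t => rfl)
  have htriv : Path.Homotopic (pushPath _ P (torusMap_zero i hm) hbase)
      (Path.refl (tube i hm).base) := by
    refine homotopic_refl_of_square (pushMap i) (fun s => ?_) (fun t => ?_) ?_ _ (fun t => ?_)
    · apply Subtype.ext
      rw [pushMap_apply, pushMap_apply]
      refine proj_congr ?_ ?_ <;> simp only [turn_one, turn_zero]
    · apply Subtype.ext
      rw [pushMap_apply, pushMap_apply]
      refine proj_congr ?_ ?_ <;> simp
    · have h := torusMap_neg_angle i hm 0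
      rw [Set.Icc.coe_zero, m.angle_start i 0 le_rfl, zero_div, neg_zero] at h
      rw [torusMap_zero i hm, h]
    · exact torusMap_neg_angle i hm t
  have h1 : L (Multiplicative.ofAdd (1, -m.framing i)) = 1 := by
    apply MulOpposite.unop_injective
    rw [hL, hpush]
    exact Path.Homotopic.Quotient.eq.2 htriv
  have h2 : L (Multiplicative.ofAdd (1, 0)) = L (Multiplicative.ofAdd (0, 1)) ^ m.framing i := by
    have h3 : Multiplicative.ofAdd ((1, 0) : ℤ × ℤ) = Multiplicative.ofAdd (1, -m.framing i) *
        Multiplicative.ofAdd (0, 1) ^ m.framing i := by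
      apply Multiplicative.toAdd.injective
      simp
    rw [h3, map_mul, map_zpow, h1, one_mul]
  rw [Tube.HasFraming, Tube.homologyClass, Tube.homologyClass, ← hlong, ← hmer, ← map_zpow,
    ← MulOpposite.unop_zpow, ← hL, h2]

end Motion

/-! ### The page -/

lemma mem_fourHoledSphere_iff {z : ℂ} :
    z ∈ fourHoledSphere ↔ ‖z‖ ≤ 10 ∧ ∀ i, 1 ≤ ‖z - basePoint.1 i‖ := by
  have h : (∀ i, 1 ≤ ‖z - basePoint.1 i‖) ↔ 1 ≤ ‖z + 4‖ ∧ 1 ≤ ‖z‖ ∧ 1 ≤ ‖z - 4‖ := by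
    constructor
    · intro h
      have h0 := h 0
      have h1 := h 1
      have h2 := h 2
      rw [basePoint_zero, sub_neg_eq_add] at h0
      rw [basePoint_one, sub_zero] at h1
      rw [basePoint_two] at h2
      exact ⟨h0, h1, h2⟩
    · rintro ⟨h0, h1, h2⟩
      refine forall_fin_three ?_ ?_ ?_
      · rwa [basePoint_zero, sub_neg_eq_add]
      · rwa [basePoint_one, sub_zero]
      · rwa [basePoint_two]
  rw [h]
  rfl

lemma norm_basePoint_le (i : Fin 3) : ‖basePoint.1 i‖ ≤ 4 := by
  revert i
  refine forall_fin_three ?_ ?_ ?_ <;> norm_num [basePoint_zero, basePoint_one, basePoint_two]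

lemma norm_basePoint_sub_ge {i j : Fin 3} (h : i ≠ j) : 4 ≤ ‖basePoint.1 i - basePoint.1 j‖ := by
  have key : ∀ {i j : Fin 3}, i < j → 4 ≤ ‖basePoint.1 i - basePoint.1 j‖ := fun h => by
    rcases pair_cases h with ⟨rfl, rfl⟩ | ⟨rfl, rfl⟩ | ⟨rfl, rfl⟩ <;>
      norm_num [basePoint_zero, basePoint_one, basePoint_two]
  rcases lt_or_gt_of_ne h with h | h
  · exact key h
  · rw [norm_sub_rev]
    exact key h

lemma eq_of_near {i j : Fin 3} {z : ℂ} (hi : ‖z - basePoint.1 i‖ ≤ 3 / 2)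
    (hj : ‖z - basePoint.1 j‖ ≤ 3 / 2) : i = j := by
  by_contra h
  have h1 := norm_basePoint_sub_ge h
  have h2 := norm_sub_le_norm_sub_add_norm_sub (basePoint.1 i) z (basePoint.1 j)
  rw [norm_sub_rev] at hi
  linarith

lemma isClosed_fourHoledSphere : IsClosed fourHoledSphere := by
  have h : fourHoledSphere = {z | ‖z‖ ≤ 10} ∩ ⋂ i, {z | 1 ≤ ‖z - basePoint.1 i‖} := by
    ext z
    simp [mem_fourHoledSphere_iff]
  rw [h]
  exact (isClosed_le continuous_norm continuous_const).inter
    (isClosed_iInter fun i => isClosed_le continuous_const (by fun_prop))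

instance : CompactSpace fourHoledSphere := by
  refine isCompact_iff_compactSpace.1 (Metric.isCompact_of_isClosed_isBounded
    isClosed_fourHoledSphere ?_)
  refine (Metric.isBounded_closedBall (x := (0 : ℂ)) (r := 10)).subset fun z hz => ?_
  rw [mem_closedBall_zero_iff]
  exact (mem_fourHoledSphere_iff.1 hz).1

lemma mem_interior_fourHoledSphere {z : ℂ} (h : ‖z‖ < 10) (h' : ∀ i, 1 < ‖z - basePoint.1 i‖) :
    z ∈ interior fourHoledSphere := by
  have ho : IsOpen ({z : ℂ | ‖z‖ < 10} ∩ ⋂ i, {z | 1 < ‖z - basePoint.1 i‖}) :=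
    (isOpen_lt continuous_norm continuous_const).inter
      (isOpen_iInter_of_finite fun i => isOpen_lt continuous_const (by fun_prop))
  refine mem_interior.2 ⟨_, fun w hw => ?_, ho, ⟨h, Set.mem_iInter.2 h'⟩⟩
  exact mem_fourHoledSphere_iff.2 ⟨le_of_lt hw.1, fun i => le_of_lt (Set.mem_iInter.1 hw.2 i)⟩

lemma frontier_cases {z : ℂ} (h : z ∈ fourHoledSphere) (hf : z ∈ frontier fourHoledSphere) :
    ‖z‖ = 10 ∨ ∃ i, ‖z - basePoint.1 i‖ = 1 := by
  by_contra! hn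
  obtain ⟨h1, h2⟩ := mem_fourHoledSphere_iff.1 h
  exact hf.2 (mem_interior_fourHoledSphere (lt_of_le_of_ne h1 hn.1)
    fun i => lt_of_le_of_ne (h2 i) (hn.2 i).symm)

lemma mem_frontier_of_norm {z : ℂ} (h : z ∈ fourHoledSphere) (hz : ‖z‖ = 10) :
    z ∈ frontier fourHoledSphere := by
  refine ⟨subset_closure h, fun hi => ?_⟩
  have hsub : fourHoledSphere ⊆ Metric.closedBall (0 : ℂ) 10 := fun w hw => by
    rw [mem_closedBall_zero_iff]
    exact (mem_fourHoledSphere_iff.1 hw).1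
  have := interior_mono hsub hi
  rw [interior_closedBall _ (by norm_num), mem_ball_zero_iff, hz] at this
  exact lt_irrefl _ this

lemma mem_frontier_of_hole {z : ℂ} (h : z ∈ fourHoledSphere) {i : Fin 3}
    (hz : ‖z - basePoint.1 i‖ = 1) : z ∈ frontier fourHoledSphere := by
  refine ⟨subset_closure h, fun hi => ?_⟩
  have hsub : fourHoledSphere ⊆ (Metric.ball (basePoint.1 i) 1)ᶜ := fun w hw hw' => by
    rw [mem_ball_iff_norm] at hw'
    exact absurd hw' (not_lt.2 ((mem_fourHoledSphere_iff.1 hw).2 i))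
  have := interior_mono hsub hi
  rw [interior_compl, closure_ball _ (by norm_num), Set.mem_compl_iff, mem_closedBall_iff_norm,
    hz] at this
  exact this le_rfl

/-! ### Homeomorphisms of quotients -/

/-- A homeomorphism that is compatible with two relations induces one of the quotients. -/
def quotHomeo {A B : Type*} [TopologicalSpace A] [TopologicalSpace B] {r : A → A → Prop}
    {s : B → B → Prop} (k : A ≃ₜ B) (h : ∀ a a', r a a' → Quot.mk s (k a) = Quot.mk s (k a'))
    (h' : ∀ b b', s b b' → Quot.mk r (k.symm b) = Quot.mk r (k.symm b')) : Quot r ≃ₜ Quot s where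
  toFun := Quot.lift (fun a => Quot.mk s (k a)) h
  invFun := Quot.lift (fun b => Quot.mk r (k.symm b)) h'
  left_inv := by
    rintro ⟨a⟩
    exact congrArg (Quot.mk r) (k.symm_apply_apply a)
  right_inv := by
    rintro ⟨b⟩
    exact congrArg (Quot.mk s) (k.apply_symm_apply b)
  continuous_toFun := continuous_quot_lift _ (continuous_quot_mk.comp k.continuous)
  continuous_invFun := continuous_quot_lift _ (continuous_quot_mk.comp k.symm.continuous)

lemma openBook_glue {S : Set ℂ} (φ : RelHomeo S) (x : S) :
    (Quot.mk (OpenBookRel φ) (x, 1) : OpenBook φ) = Quot.mk _ ((φ : S ≃ₜ S) x, 0) :=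
  Quot.sound (.glue x)

lemma openBook_collapse {S : Set ℂ} (φ : RelHomeo S) (x : S) (hx : (x : ℂ) ∈ frontier S)
    (s t : I) : (Quot.mk (OpenBookRel φ) (x, s) : OpenBook φ) = Quot.mk _ (x, t) :=
  Quot.sound (.collapse x hx s t)

/-- The open books of isotopic homeomorphisms are homeomorphic, by a map that is the identity on
the first half of the pages. -/
lemma exists_openBook_homeo {S : Set ℂ} [CompactSpace S] {φ ψ : RelHomeo S}
    (h : mappingClass φ = mappingClass ψ) : ∃ k : OpenBook φ ≃ₜ OpenBook ψ,
      ∀ (x : S) (t : I), (t : ℝ) ≤ 1 / 2 → k (Quot.mk _ (x, t)) = Quot.mk _ (x, t) := by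
  obtain ⟨F, hF, hF0, hF1⟩ := mappingClass_eq_iff.1 h.symm
  -- The isotopy from the identity to `ψ⁻¹ * φ` is run in the second half of the interval, which
  -- keeps the first half fixed for the orientation test.
  let τ : I → I := fun t => ⟨clamp (2 * t - 1), clamp_mem _⟩
  have hτ : Continuous τ := Continuous.subtype_mk (continuous_clamp.comp (by fun_prop)) _
  have hτ0 : ∀ t : I, (t : ℝ) ≤ 1 / 2 → τ t = 0 := fun t ht =>
    Subtype.ext (clamp_of_nonpos (by linarith))
  have hτ1 : τ 1 = 1 := Subtype.ext (clamp_of_one_le (by norm_num))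
  let e : S × I ≃ S × I :=
    { toFun := fun p => ((F (τ p.2) : S ≃ₜ S) p.1, p.2)
      invFun := fun p => ((F (τ p.2) : S ≃ₜ S).symm p.1, p.2)
      left_inv := fun p => by simp
      right_inv := fun p => by simp }
  have he : Continuous e :=
    (hF.comp ((hτ.comp continuous_snd).prodMk continuous_fst)).prodMk continuous_snd
  -- Compactness makes the inverse continuous, so joint continuity of the inverse isotopy need not
  -- be shown.
  let k : S × I ≃ₜ S × I := he.homeoOfEquivCompactToT2
  have hk : ∀ p, k p = ((F (τ p.2) : S ≃ₜ S) p.1, p.2) := fun _ => rfl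
  have hk' : ∀ p, k.symm p = ((F (τ p.2) : S ≃ₜ S).symm p.1, p.2) := fun _ => rfl
  have hstart : ∀ x : S, (F (τ 0) : S ≃ₜ S) x = x := fun x => by
    rw [hτ0 0 (by norm_num), hF0]
    rfl
  have hend : ∀ x : S, (ψ : S ≃ₜ S) ((F (τ 1) : S ≃ₜ S) x) = (φ : S ≃ₜ S) x := fun x => by
    rw [hτ1, hF1]
    change (ψ : S ≃ₜ S) ((ψ : S ≃ₜ S).symm ((φ : S ≃ₜ S) x)) = _
    rw [Homeomorph.apply_symm_apply]
  refine ⟨quotHomeo k ?_ ?_, fun x t ht => ?_⟩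
  · rintro _ _ (x | ⟨x, hx, s, t⟩)
    · rw [hk, hk]
      refine (openBook_glue ψ _).trans ?_
      change Quot.mk _ ((ψ : S ≃ₜ S) ((F (τ 1) : S ≃ₜ S) x), 0) = Quot.mk _ (_, 0)
      rw [hend, hstart]
    · rw [hk, hk]
      change Quot.mk _ ((F (τ s) : S ≃ₜ S) x, s) = Quot.mk _ ((F (τ t) : S ≃ₜ S) x, t)
      rw [(F (τ s)).2 x hx, (F (τ t)).2 x hx]
      exact openBook_collapse ψ x hx s t
  · rintro _ _ (x | ⟨x, hx, s, t⟩)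
    · rw [hk', hk']
      refine (openBook_glue φ _).trans ?_
      change Quot.mk _ ((φ : S ≃ₜ S) ((F (τ 1) : S ≃ₜ S).symm x), 0) =
        Quot.mk _ ((F (τ 0) : S ≃ₜ S).symm _, 0)
      rw [← hend, Homeomorph.apply_symm_apply, (Homeomorph.symm_apply_eq _).2 (hstart _).symm]
    · rw [hk', hk']
      change Quot.mk _ ((F (τ s) : S ≃ₜ S).symm x, s) = Quot.mk _ ((F (τ t) : S ≃ₜ S).symm x, t)
      rw [(Homeomorph.symm_apply_eq _).2 ((F (τ s)).2 x hx).symm,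
        (Homeomorph.symm_apply_eq _).2 ((F (τ t)).2 x hx).symm]
      exact openBook_collapse φ x hx s t
  · change Quot.mk _ (k (x, t)) = _
    rw [hk, hτ0 t ht, hF0]
    rfl

/-! ### The position of the pages in the three-sphere -/

/-- The distance to the outer boundary, cut off at `1`. -/
def height (z : ℂ) : ℝ := min 1 (10 - ‖z‖)

lemma continuous_height : Continuous height := by
  unfold height
  fun_prop

lemma height_of_le {z : ℂ} (h : ‖z‖ ≤ 9) : height z = 1 := min_eq_left (by linarith)

lemma height_of_ge {z : ℂ} (h : 9 ≤ ‖z‖) : height z = 10 - ‖z‖ := min_eq_right (by linarith)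

lemma height_pos {z : ℂ} (h : ‖z‖ < 10) : 0 < height z := lt_min one_pos (by linarith)

lemma height_of_eq {z : ℂ} (h : ‖z‖ = 10) : height z = 0 := by
  rw [height_of_ge (by linarith), h, sub_self]

namespace Motion

variable (m : Motion)

lemma norm_toHomeo_lt (t : ℝ) {z : ℂ} (h : ‖z‖ < 9) : ‖m.toHomeo t z‖ < 9 := by
  by_contra h'
  have h1 := m.outer t _ (not_lt.1 h')
  rw [(m.toHomeo t).injective h1] at h'
  exact h' h

lemma norm_toHomeo_le (t : ℝ) {z : ℂ} (h : ‖z‖ ≤ 9) : ‖m.toHomeo t z‖ ≤ 9 := by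
  rcases lt_or_eq_of_le h with h | h
  · exact (m.norm_toHomeo_lt t h).le
  · rw [m.outer t z h.ge, h]

/-- The position of the point `z` of the page at the time `t`. -/
def position (t : ℝ) (z : ℂ) : ℂ := m.toHomeo t z / height z

lemma position_of_le (t : ℝ) {z : ℂ} (h : ‖z‖ ≤ 9) : m.position t z = m.toHomeo t z := by
  rw [position, height_of_le h, Complex.ofReal_one, div_one]

lemma position_of_ge (t : ℝ) {z : ℂ} (h : 9 ≤ ‖z‖) :
    m.position t z = z / (10 - ‖z‖ : ℝ) := by
  rw [position, height_of_ge h, m.outer t z h]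

lemma norm_position_of_ge (t : ℝ) {z : ℂ} (h : 9 ≤ ‖z‖) (h' : ‖z‖ < 10) :
    ‖m.position t z‖ = ‖z‖ / (10 - ‖z‖) := by
  rw [m.position_of_ge t h, norm_div, Complex.norm_real, Real.norm_of_nonneg (by linarith)]

lemma norm_position_gt (t : ℝ) {z : ℂ} (h : 9 < ‖z‖) (h' : ‖z‖ < 10) :
    9 < ‖m.position t z‖ := by
  rw [m.norm_position_of_ge t h.le h', lt_div_iff₀ (by linarith)]
  linarith

/-- The closed disk of radius 9 is mapped into itself by the motion, while the collar between radii
9 and 10 is stretched radially, independently of time, over the outside. The two images are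
disjoint. -/
lemma position_injOn (t : ℝ) {z z' : ℂ} (hz : ‖z‖ < 10) (hz' : ‖z'‖ < 10)
    (h : m.position t z = m.position t z') : z = z' := by
  rcases le_or_gt ‖z‖ 9 with h1 | h1 <;> rcases le_or_gt ‖z'‖ 9 with h2 | h2
  · rw [m.position_of_le t h1, m.position_of_le t h2] at h
    exact (m.toHomeo t).injective h
  · have h3 := m.norm_position_gt t h2 hz'
    rw [← h, m.position_of_le t h1] at h3
    exact absurd (m.norm_toHomeo_le t h1) (not_le.2 h3)
  · have h3 := m.norm_position_gt t h1 hz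
    rw [h, m.position_of_le t h2] at h3
    exact absurd (m.norm_toHomeo_le t h2) (not_le.2 h3)
  · have h3 := congrArg norm h
    rw [m.norm_position_of_ge t h1.le hz, m.norm_position_of_ge t h2.le hz',
      div_eq_div_iff (by linarith) (by linarith)] at h3
    have h4 : ‖z‖ = ‖z'‖ := by linarith
    have h5 : ((10 - ‖z'‖ : ℝ) : ℂ) ≠ 0 := Complex.ofReal_ne_zero.2 (by linarith)
    rw [m.position_of_ge t h1.le, m.position_of_ge t h2.le, h4] at h
    exact (div_left_inj' h5).1 h

lemma exists_position_eq (t : ℝ) (ζ : ℂ) : ∃ z, ‖z‖ < 10 ∧ m.position t z = ζ := by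
  rcases le_or_gt ‖ζ‖ 9 with h | h
  · have h1 : ‖(m.toHomeo t).symm ζ‖ ≤ 9 := by
      by_contra! h2
      have h3 := m.outer t _ h2.le
      rw [Homeomorph.apply_symm_apply] at h3
      rw [← h3] at h2
      exact absurd h (not_le.2 h2)
    exact ⟨(m.toHomeo t).symm ζ, by linarith,
      by rw [m.position_of_le t h1, Homeomorph.apply_symm_apply]⟩
  · have hp : 0 < 1 + ‖ζ‖ := by linarith
    have hn : ‖((10 / (1 + ‖ζ‖) : ℝ) : ℂ) * ζ‖ = 10 * ‖ζ‖ / (1 + ‖ζ‖) := by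
      rw [norm_mul, Complex.norm_real, Real.norm_of_nonneg (by positivity)]
      ring
    -- The radius s of the preimage solves `s / (10 - s) = ‖ζ‖`, so s = 10‖ζ‖ / (1 + ‖ζ‖).
    refine ⟨((10 / (1 + ‖ζ‖) : ℝ) : ℂ) * ζ, ?_, ?_⟩
    · rw [hn, div_lt_iff₀ hp]
      linarith
    · have h9 : 9 ≤ ‖((10 / (1 + ‖ζ‖) : ℝ) : ℂ) * ζ‖ := by
        rw [hn, le_div_iff₀ hp]
        linarith
      rw [m.position_of_ge t h9, hn]
      have : 10 - 10 * ‖ζ‖ / (1 + ‖ζ‖) = 10 / (1 + ‖ζ‖) := by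
        field_simp
        ring
      rw [this, mul_div_cancel_left₀]
      exact Complex.ofReal_ne_zero.2 (by positivity)

lemma page_ne_zero (t : ℝ) {z : ℂ} (hz : ‖z‖ ≤ 10) :
    m.toHomeo t z ≠ 0 ∨ (height z : ℂ) * turn t ≠ 0 := by
  rcases lt_or_eq_of_le hz with h | h
  · exact Or.inr (mul_ne_zero (Complex.ofReal_ne_zero.2 (height_pos h).ne') (Circle.coe_ne_zero _))
  · left
    rw [m.outer t z (by linarith), ← norm_pos_iff]
    linarith

/-- The point of the three-sphere that belongs to the point `x` of the page at the time `t`. -/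
def page (x : fourHoledSphere) (t : I) : S3 :=
  proj (m.toHomeo t x) (height x * turn t) (m.page_ne_zero t (mem_fourHoledSphere_iff.1 x.2).1)

lemma continuous_page : Continuous fun p : fourHoledSphere × I => m.page p.1 p.2 := by
  have h1 : Continuous fun p : fourHoledSphere × I => m.toHomeo p.2 p.1 :=
    m.continuous_toHomeo.comp (f := fun p : fourHoledSphere × I => ((p.2 : ℝ), (p.1 : ℂ)))
      (by fun_prop)
  have h2 := continuous_height
  have h3 : Continuous fun p : fourHoledSphere × I => (turn p.2 : ℂ) :=
    continuous_subtype_val.comp (continuous_turn.comp (by fun_prop))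
  exact continuous_proj h1 (by fun_prop) _

lemma page_of_lt {x : fourHoledSphere} (hx : ‖(x : ℂ)‖ < 10) (t : I) :
    m.page x t = cyl (turn t, m.position t x) := by
  refine proj_eq_iff.2 ⟨height x, height_pos hx, ?_, rfl⟩
  have : (height x : ℂ) ≠ 0 := Complex.ofReal_ne_zero.2 (height_pos hx).ne'
  rw [position]
  field_simp

lemma page_of_eq {x : fourHoledSphere} (hx : ‖(x : ℂ)‖ = 10) (t : I) :
    (m.page x t).1 1 = 0 := by
  rw [page, proj_one, height_of_eq hx]
  simp

/-- Near a hole the motion ends where it began, so the choice between the times 0 and 1 does not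
matter. Away from the holes this would fail, because of the monodromy. -/
lemma toHomeo_time_turn {i : Fin 3} {z : ℂ} (hz : ‖z - basePoint.1 i‖ ≤ 3 / 2) (t : I) :
    m.toHomeo (time (turn t)) z = m.toHomeo t z := by
  refine apply_time_turn (f := fun t : I => m.toHomeo t z) ?_ t
  simp only [Set.Icc.coe_zero, Set.Icc.coe_one]
  rw [m.start _ le_rfl, m.finish_disk hz]

lemma norm_lt_of_near {i : Fin 3} {z : ℂ} (hz : ‖z - basePoint.1 i‖ ≤ 3 / 2) : ‖z‖ < 9 := by
  have h1 := norm_basePoint_le i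
  have h2 := norm_sub_norm_le z (basePoint.1 i)
  linarith

lemma tubeFun_turn (i : Fin 3) (t : I) (w : ℂ) :
    m.tubeFun i (turn t, w) = cyl (turn t, m.position t (basePoint.1 i + radial w)) := by
  have h : ‖basePoint.1 i + radial w - basePoint.1 i‖ ≤ 3 / 2 := by
    rw [add_sub_cancel_left]
    exact (norm_radial_lt w).le
  rw [tubeFun_eq, m.toHomeo_time_turn h, m.position_of_le t (norm_lt_of_near h).le]

/-- Off the axis a point of S³ determines its angle and, given the time, its point of the page. The
converse direction is `page_eq_tubeFun`. -/
lemma tubeFun_eq_page {i : Fin 3} {u : Circle} {w : ℂ} {x : fourHoledSphere} {t : I}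
    (h : m.tubeFun i (u, w) = m.page x t) : u = turn t ∧ (x : ℂ) = basePoint.1 i + radial w := by
  have hx : ‖(x : ℂ)‖ < 10 := by
    refine lt_of_le_of_ne (mem_fourHoledSphere_iff.1 x.2).1 fun hx => ?_
    have h1 := m.page_of_eq hx t
    rw [← h] at h1
    exact cyl_one_ne_zero _ h1
  rw [m.page_of_lt hx] at h
  have hu : u = turn t := congrArg Prod.fst (cyl_injective h)
  subst hu
  rw [tubeFun_turn] at h
  have h2 : ‖basePoint.1 i + radial w - basePoint.1 i‖ ≤ 3 / 2 := by
    rw [add_sub_cancel_left]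
    exact (norm_radial_lt w).le
  refine ⟨rfl, m.position_injOn t hx ?_ (congrArg Prod.snd (cyl_injective h)).symm⟩
  linarith [norm_lt_of_near h2]

lemma page_eq_tubeFun {i : Fin 3} {w : ℂ} {x : fourHoledSphere} (t : I)
    (h : (x : ℂ) = basePoint.1 i + radial w) : m.page x t = m.tubeFun i (turn t, w) := by
  have h2 : ‖basePoint.1 i + radial w - basePoint.1 i‖ ≤ 3 / 2 := by
    rw [add_sub_cancel_left]
    exact (norm_radial_lt w).le
  rw [m.page_of_lt (by rw [h]; linarith [norm_lt_of_near h2]), tubeFun_turn, h]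

lemma height_monodromy {φ : RelHomeo fourHoledSphere} (hφ : m.EndsAt φ) (x : fourHoledSphere) :
    height ((φ : fourHoledSphere ≃ₜ fourHoledSphere) x) = height x := by
  rw [← hφ]
  rcases le_total ‖(x : ℂ)‖ 9 with h | h
  · rw [height_of_le h, height_of_le (m.norm_toHomeo_le 1 h)]
  · rw [m.outer 1 _ h]

/-- This is where the gluing of the open book is matched: time 1 and time 0 are the same angle, and
the motion ends at the monodromy. -/
lemma page_monodromy {φ : RelHomeo fourHoledSphere} (hφ : m.EndsAt φ) (x : fourHoledSphere) :
    m.page x 1 = m.page ((φ : fourHoledSphere ≃ₜ fourHoledSphere) x) 0 := by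
  refine proj_congr ?_ ?_
  · rw [Set.Icc.coe_one, Set.Icc.coe_zero, m.start _ le_rfl, hφ]
  · rw [Set.Icc.coe_one, Set.Icc.coe_zero, turn_one, turn_zero, m.height_monodromy hφ]

/-- Points of the pages with the same position in the three-sphere agree in the open book. -/
lemma openBook_eq_of_page_eq {φ : RelHomeo fourHoledSphere} (hφ : m.EndsAt φ)
    {x x' : fourHoledSphere} {t t' : I} (h : m.page x t = m.page x' t') :
    (Quot.mk _ (x, t) : OpenBook φ) = Quot.mk _ (x', t') := by
  have hx := (mem_fourHoledSphere_iff.1 x.2).1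
  have hx' := (mem_fourHoledSphere_iff.1 x'.2).1
  have same : ∀ {x x' : fourHoledSphere} {t : I}, ‖(x : ℂ)‖ < 10 → ‖(x' : ℂ)‖ < 10 →
      m.page x t = m.page x' t → x = x' := fun hx hx' h => by
    rw [m.page_of_lt hx, m.page_of_lt hx'] at h
    exact Subtype.ext (m.position_injOn _ hx hx' (congrArg Prod.snd (cyl_injective h)))
  have hlt : ∀ {x : fourHoledSphere}, ‖(x : ℂ)‖ < 10 →
      ‖((φ : fourHoledSphere ≃ₜ fourHoledSphere) x : ℂ)‖ < 10 := fun {x} hx => by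
    rw [← hφ]
    rcases le_total ‖(x : ℂ)‖ 9 with h | h
    · linarith [m.norm_toHomeo_le 1 h]
    · rwa [m.outer 1 _ h]
  rcases lt_or_eq_of_le hx with h1 | h1 <;> rcases lt_or_eq_of_le hx' with h2 | h2
  · have hu : turn t = turn t' := by
      rw [m.page_of_lt h1, m.page_of_lt h2] at h
      exact congrArg Prod.fst (cyl_injective h)
    rcases turn_eq_cases hu with rfl | ⟨rfl, rfl⟩ | ⟨rfl, rfl⟩
    · rw [same h1 h2 h]
    · rw [openBook_glue]
      rw [m.page_monodromy hφ] at h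
      rw [same h1 (hlt h2) h]
    · rw [openBook_glue]
      rw [m.page_monodromy hφ] at h
      rw [same (hlt h1) h2 h]
  · have h3 := m.page_of_eq h2 t'
    rw [← h, m.page_of_lt h1] at h3
    exact absurd h3 (cyl_one_ne_zero _)
  · have h3 := m.page_of_eq h1 t
    rw [h, m.page_of_lt h2] at h3
    exact absurd h3 (cyl_one_ne_zero _)
  · have hxx : x = x' := by
      obtain ⟨r, hr, hz, -⟩ := proj_eq_iff.1 h
      rw [m.outer t _ (by linarith), m.outer t' _ (by linarith)] at hz
      have hn := congrArg norm hz
      rw [norm_mul, Complex.norm_real, Real.norm_of_nonneg hr.le, h1, h2] at hn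
      have hr1 : r = 1 := by linarith
      rw [hr1, Complex.ofReal_one, one_mul] at hz
      exact Subtype.ext hz
    subst hxx
    exact openBook_collapse φ x (mem_frontier_of_norm x.2 h1) t t'

/-- The point `z` may lie inside a hole, where it is not a point of the page, so the conclusion is
split: `y` lies on the page if `z` does, and on the tube if `z` lies in the rigid disk. -/
lemma exists_page_eq (y : S3) : ∃ (z : ℂ) (t : I), ‖z‖ ≤ 10 ∧
    (∀ hz : z ∈ fourHoledSphere, m.page ⟨z, hz⟩ t = y) ∧
    ∀ i w, z = basePoint.1 i + radial w → m.tubeFun i (turn t, w) = y := by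
  by_cases hy : y.1 1 = 0
  · have hn := s3_norm y
    rw [hy, norm_zero] at hn
    have hn' : ‖y.1 0‖ = 1 := by
      have := norm_nonneg (y.1 0)
      nlinarith
    have h10 : ‖(10 : ℂ) * y.1 0‖ = 10 := by
      rw [norm_mul, hn']
      norm_num
    refine ⟨10 * y.1 0, 0, h10.le, fun hz => ?_, fun i w h => ?_⟩
    · refine Eq.trans (proj_eq_iff.2 ⟨10, by norm_num, ?_, ?_⟩) (proj_self y)
      · rw [m.outer _ _ (by linarith)]
        norm_num
      · rw [height_of_eq h10, hy]
        simp
    · have h2 : ‖10 * y.1 0 - basePoint.1 i‖ ≤ 3 / 2 := by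
        rw [h, add_sub_cancel_left]
        exact (norm_radial_lt w).le
      have := norm_lt_of_near h2
      linarith
  · obtain ⟨z, hz, hp⟩ := m.exists_position_eq (time (cylInv y).1) (cylInv y).2
    have hc : cyl (turn (time (cylInv y).1), m.position (time (cylInv y).1) z) = y := by
      rw [hp, turn_time]
      exact cyl_cylInv hy
    refine ⟨z, time (cylInv y).1, hz.le, fun hz' => ?_, fun i w h => ?_⟩
    · rw [m.page_of_lt hz, hc]
    · rw [tubeFun_turn, ← h, hc]

end Motion

/-! ### The open book of a motion is the result of the surgery on its closed braid -/

/-- Two quotients of the quotients of `W` are homeomorphic if they make the same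
identifications. -/
lemma exists_quotHomeo {W A B : Type*} [TopologicalSpace W] [TopologicalSpace A]
    [TopologicalSpace B] {p : W → A} {q : W → B} (hp : Topology.IsQuotientMap p)
    (hq : Topology.IsQuotientMap q) {r : A → A → Prop} {s : B → B → Prop}
    (hpq : ∀ a b, p a = p b → Quot.mk s (q a) = Quot.mk s (q b))
    (hqp : ∀ a b, q a = q b → Quot.mk r (p a) = Quot.mk r (p b))
    (hr : ∀ x y, r x y → ∃ a b, p a = x ∧ p b = y ∧ Quot.mk s (q a) = Quot.mk s (q b))
    (hs : ∀ x y, s x y → ∃ a b, q a = x ∧ q b = y ∧ Quot.mk r (p a) = Quot.mk r (p b)) :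
    ∃ h : Quot r ≃ₜ Quot s, ∀ w, h (Quot.mk r (p w)) = Quot.mk s (q w) := by
  have hf : ∀ w, Quot.mk s (q (Function.surjInv hp.surjective (p w))) = Quot.mk s (q w) :=
    fun w => hpq _ _ (Function.surjInv_eq _ _)
  have hg : ∀ w, Quot.mk r (p (Function.surjInv hq.surjective (q w))) = Quot.mk r (p w) :=
    fun w => hqp _ _ (Function.surjInv_eq _ _)
  let f : Quot r → Quot s :=
    Quot.lift (fun a => Quot.mk s (q (Function.surjInv hp.surjective a))) fun x y h => by
      obtain ⟨a, b, rfl, rfl, hab⟩ := hr x y h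
      rw [hf, hf, hab]
  let g : Quot s → Quot r :=
    Quot.lift (fun a => Quot.mk r (p (Function.surjInv hq.surjective a))) fun x y h => by
      obtain ⟨a, b, rfl, rfl, hab⟩ := hs x y h
      rw [hg, hg, hab]
  have hf' : ∀ w, f (Quot.mk r (p w)) = Quot.mk s (q w) := hf
  have hg' : ∀ w, g (Quot.mk s (q w)) = Quot.mk r (p w) := hg
  refine ⟨⟨⟨f, g, ?_, ?_⟩, ?_, ?_⟩, hf'⟩
  · rintro ⟨x⟩
    obtain ⟨w, rfl⟩ := hp.surjective x
    rw [hf', hg']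
  · rintro ⟨x⟩
    obtain ⟨w, rfl⟩ := hq.surjective x
    rw [hg', hf']
  · refine continuous_quot_lift _ (hp.continuous_iff.2 ?_)
    exact (continuous_quot_mk.comp hq.continuous).congr fun w => (hf w).symm
  · refine continuous_quot_lift _ (hq.continuous_iff.2 ?_)
    exact (continuous_quot_mk.comp hp.continuous).congr fun w => (hg w).symm

/-! ### A common cover of the open book and the surgered manifold by compact pieces -/

instance {n : ℕ} {K : Fin n → Set S3} (e : ∀ i, Tube (K i)) : T2Space (Exterior e) :=
  inferInstanceAs (T2Space {x : S3 // ∀ i u w, ‖w‖ < 1 → (e i).toFun (u, w) ≠ x})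

/-- The part of the product of the page and the interval that is far from the holes. -/
abbrev FarPart : Type :=
  {p : fourHoledSphere × I // ∀ i, 5 / 4 ≤ ‖(p.1 : ℂ) - basePoint.1 i‖}

instance : CompactSpace FarPart := by
  refine isCompact_iff_compactSpace.1 (IsClosed.isCompact ?_)
  have h : {p : fourHoledSphere × I | ∀ i, 5 / 4 ≤ ‖(p.1 : ℂ) - basePoint.1 i‖} =
      ⋂ i, {p : fourHoledSphere × I | 5 / 4 ≤ ‖(p.1 : ℂ) - basePoint.1 i‖} := by
    ext p
    simp
  change IsClosed {p : fourHoledSphere × I | ∀ i, 5 / 4 ≤ ‖(p.1 : ℂ) - basePoint.1 i‖}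
  rw [h]
  exact isClosed_iInter fun i => isClosed_le continuous_const (by fun_prop)

/-- A collar of the boundary of a hole. -/
abbrev Collar : Type := {w : ℂ // 1 ≤ ‖w‖ ∧ ‖w‖ ≤ 5 / 4}

instance : CompactSpace Collar := by
  refine isCompact_iff_compactSpace.1 (Metric.isCompact_of_isClosed_isBounded ?_ ?_)
  · exact (isClosed_le continuous_const continuous_norm).inter
      (isClosed_le continuous_norm continuous_const)
  · exact (Metric.isBounded_closedBall (x := (0 : ℂ)) (r := 5 / 4)).subset fun z hz => by
      rw [mem_closedBall_zero_iff]
      exact hz.2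

lemma Collar.ne_zero (w : Collar) : w.1 ≠ 0 := norm_pos_iff.1 (by linarith [w.2.1])

lemma Collar.mem (i : Fin 3) (w : Collar) : basePoint.1 i + w.1 ∈ fourHoledSphere := by
  have h1 := w.2.1
  have h2 := w.2.2
  refine mem_fourHoledSphere_iff.2 ⟨?_, fun j => ?_⟩
  · linarith [norm_add_le (basePoint.1 i) w.1, norm_basePoint_le i]
  · rcases eq_or_ne i j with rfl | h
    · rwa [add_sub_cancel_left]
    · have h3 := norm_basePoint_sub_ge h
      have h4 := norm_sub_le (basePoint.1 i + w.1 - basePoint.1 j) w.1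
      have h5 : basePoint.1 i + w.1 - basePoint.1 j - w.1 = basePoint.1 i - basePoint.1 j := by ring
      rw [h5] at h4
      linarith

/-- The disjoint union of the part far from the holes and the parts near the holes. -/
abbrev Pieces : Type := FarPart ⊕ (Fin 3 × Collar × I)

/-- The pieces cover the product of the page and the interval. -/
def piecesToProduct : Pieces → fourHoledSphere × I :=
  Sum.elim Subtype.val fun p => (⟨basePoint.1 p.1 + p.2.1.1, Collar.mem p.1 p.2.1⟩, p.2.2)

/-- A continuous surjection of a compact space onto a Hausdorff space is a quotient map. The pieces
meet only at distance 5/4 from the centres, the radius to which `radial` sends the unit circle. -/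
lemma isQuotientMap_piecesToProduct : Topology.IsQuotientMap piecesToProduct := by
  refine Topology.IsQuotientMap.of_surjective_continuous ?_ ?_
  · rintro ⟨x, t⟩
    by_cases h : ∀ i, 5 / 4 ≤ ‖(x : ℂ) - basePoint.1 i‖
    · exact ⟨Sum.inl ⟨(x, t), h⟩, rfl⟩
    · push Not at h
      obtain ⟨i, hi⟩ := h
      exact ⟨Sum.inr (i, ⟨x - basePoint.1 i, (mem_fourHoledSphere_iff.1 x.2).2 i, hi.le⟩, t),
        Prod.ext (Subtype.ext (add_sub_cancel _ _)) rfl⟩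
  · refine Continuous.sumElim continuous_subtype_val ?_
    have : Continuous fun p : Fin 3 × Collar × I => basePoint.1 p.1 :=
      (continuous_of_discreteTopology (f := basePoint.1)).comp continuous_fst
    fun_prop

lemma direction_mul_norm (w : ℂ) : (‖w‖ : ℂ) * direction w = w := by
  rcases eq_or_ne w 0 with rfl | h
  · simp
  · rw [coe_direction h]
    have : (‖w‖ : ℂ) ≠ 0 := Complex.ofReal_ne_zero.2 (norm_ne_zero_iff.2 h)
    field_simp

lemma direction_real_mul {r : ℝ} (hr : 0 < r) (v : Circle) : direction (r * (v : ℂ)) = v := by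
  apply Subtype.ext
  rw [coe_direction (mul_ne_zero (Complex.ofReal_ne_zero.2 hr.ne') v.coe_ne_zero), norm_mul,
    Complex.norm_real, Circle.norm_coe, Real.norm_of_nonneg hr.le, mul_one]
  exact mul_div_cancel_left₀ _ (Complex.ofReal_ne_zero.2 hr.ne')

namespace Motion

variable {m : Motion} (hm : m.Delayed)

lemma disjoint_range_tube {i j : Fin 3} (hij : i ≠ j) :
    Disjoint (Set.range (tube i hm).toFun) (Set.range (tube j hm).toFun) := by
  rw [Set.disjoint_left]
  rintro _ ⟨⟨u, w⟩, rfl⟩ ⟨⟨u', w'⟩, h⟩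
  change m.tubeFun j (u', w') = m.tubeFun i (u, w) at h
  rw [tubeFun_eq, tubeFun_eq] at h
  obtain ⟨rfl, h2⟩ := Prod.ext_iff.1 (cyl_injective h)
  have h3 := (m.toHomeo _).injective h2
  refine hij (eq_of_near (z := basePoint.1 i + radial w) ?_ ?_)
  · rw [add_sub_cancel_left]
    exact (norm_radial_lt w).le
  · change basePoint.1 j + radial w' = basePoint.1 i + radial w at h3
    rw [← h3, add_sub_cancel_left]
    exact (norm_radial_lt w').le

lemma tube_ne_page {x : fourHoledSphere} (h : ∀ i, 5 / 4 ≤ ‖(x : ℂ) - basePoint.1 i‖) (t : I)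
    (i : Fin 3) (u : Circle) (w : ℂ) (hw : ‖w‖ < 1) : (tube i hm).toFun (u, w) ≠ m.page x t := by
  intro he
  have h1 := h i
  rw [(m.tubeFun_eq_page he).2, add_sub_cancel_left] at h1
  exact absurd (norm_radial_lt_iff.2 hw) (not_lt.2 h1)

/-- The point of the solid torus that belongs to a point near a hole. -/
def toTorus (w : Collar) (t : I) : Metric.closedBall (0 : ℂ) 1 × Circle :=
  (⟨(4 * (‖w.1‖ - 1) : ℝ) * turn t, by
    have h1 := w.2.1
    have h2 := w.2.2
    rw [mem_closedBall_zero_iff, norm_mul, Circle.norm_coe, mul_one, Complex.norm_real,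
      Real.norm_of_nonneg (by linarith)]
    linarith⟩, direction w.1)

lemma continuous_toTorus : Continuous fun p : Collar × I => toTorus p.1 p.2 := by
  refine Continuous.prodMk (Continuous.subtype_mk ?_ _) ?_
  · have h3 : Continuous fun p : Collar × I => (turn p.2 : ℂ) :=
      continuous_subtype_val.comp (continuous_turn.comp (by fun_prop))
    fun_prop
  · exact continuousOn_direction.comp_continuous (by fun_prop) fun p => p.1.ne_zero

/-- The pieces cover the pieces of the surgered manifold. -/
def piecesToSurgery : Pieces →
    Exterior (tube · hm) ⊕ (Fin 3 × Metric.closedBall (0 : ℂ) 1 × Circle) :=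
  Sum.map (fun p => ⟨m.page p.1.1 p.1.2, tube_ne_page hm p.2 _⟩)
    fun p => (p.1, toTorus p.2.1 p.2.2)

/-- Again compact onto Hausdorff; the work is surjectivity. A point outside the tubes has a page
point at distance at least 5/4 from each centre, and a point of a solid torus is reached by reading
its disk coordinate in polar form. -/
lemma isQuotientMap_piecesToSurgery : Topology.IsQuotientMap (piecesToSurgery hm) := by
  refine Topology.IsQuotientMap.of_surjective_continuous ?_ ?_
  · refine Function.Surjective.sumMap ?_ ?_
    · rintro ⟨y, hy⟩
      obtain ⟨z, t, hz, hp, ht⟩ := m.exists_page_eq y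
      have hfar : ∀ i, 5 / 4 ≤ ‖z - basePoint.1 i‖ := by
        intro i
        by_contra! h
        have h1 := radial_radialInv (y := z - basePoint.1 i) (by linarith)
        refine hy i (turn t) (radialInv (z - basePoint.1 i)) ?_ (ht i _ ?_)
        · rwa [← norm_radial_lt_iff, h1]
        · rw [h1, add_sub_cancel]
      have hmem : z ∈ fourHoledSphere :=
        mem_fourHoledSphere_iff.2 ⟨hz, fun i => by linarith [hfar i]⟩
      exact ⟨⟨(⟨z, hmem⟩, t), hfar⟩, Subtype.ext (hp hmem)⟩
    · rintro ⟨i, ⟨d, hd⟩, v⟩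
      rw [mem_closedBall_zero_iff] at hd
      have hpos : 0 < 1 + ‖d‖ / 4 := by positivity
      have hn : ‖((1 + ‖d‖ / 4 : ℝ) : ℂ) * v‖ = 1 + ‖d‖ / 4 := by
        rw [norm_mul, Circle.norm_coe, mul_one, Complex.norm_real, Real.norm_of_nonneg hpos.le]
      -- The radius of `d` becomes the depth in the collar, its direction becomes the time, and `v`
      -- becomes the direction around the hole.
      refine ⟨(i, ⟨((1 + ‖d‖ / 4 : ℝ) : ℂ) * v, ?_, ?_⟩, time (direction d)), ?_⟩
      · rw [hn]
        linarith [norm_nonneg d]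
      · rw [hn]
        linarith
      · refine Prod.ext rfl (Prod.ext (Subtype.ext ?_) (direction_real_mul hpos v))
        change ((4 * (‖((1 + ‖d‖ / 4 : ℝ) : ℂ) * v‖ - 1) : ℝ) : ℂ) *
          turn (time (direction d)) = d
        rw [hn, turn_time, show 4 * (1 + ‖d‖ / 4 - 1) = ‖d‖ by ring, direction_mul_norm]
  · refine Continuous.sumMap ?_ ?_
    · exact Continuous.subtype_mk (m.continuous_page.comp continuous_subtype_val) _
    · exact continuous_fst.prodMk (continuous_toTorus.comp continuous_snd)

lemma monodromy_of_near {φ : RelHomeo fourHoledSphere} (hφ : m.EndsAt φ) {x : fourHoledSphere}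
    {i : Fin 3} (h : ‖(x : ℂ) - basePoint.1 i‖ ≤ 3 / 2) :
    (φ : fourHoledSphere ≃ₜ fourHoledSphere) x = x :=
  Subtype.ext (by rw [← hφ, m.finish_disk h])

/-- A point common to both pieces lies at distance exactly 5/4. Its disk coordinate then has norm 1
and equals the angle of the page, as the surgery relation demands. -/
lemma surgery_glue {x : fourHoledSphere} (hx : ∀ i, 5 / 4 ≤ ‖(x : ℂ) - basePoint.1 i‖) (t : I)
    (i : Fin 3) (w : Collar) (h : (x : ℂ) = basePoint.1 i + w.1) :
    (Quot.mk _ (Sum.inr (i, toTorus w t)) : Surgery (tube · hm)) =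
      Quot.mk _ (Sum.inl ⟨m.page x t, tube_ne_page hm hx t⟩) := by
  have hn : ‖w.1‖ = 5 / 4 := by
    have := hx i
    rw [h, add_sub_cancel_left] at this
    exact le_antisymm w.2.2 this
  refine Quot.sound (SurgeryRel.glue i _ (turn t) _ _ ?_ ?_)
  · change ((4 * (‖w.1‖ - 1) : ℝ) : ℂ) * _ = _
    rw [hn]
    norm_num
  · refine m.page_eq_tubeFun t ?_
    have h1 := direction_mul_norm w.1
    rw [hn] at h1
    rw [radial_of_norm_one (Circle.norm_coe _), h]
    exact congrArg _ h1.symm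

/-- Depth and time are polar coordinates on the disk. They are ambiguous at the centre, which is the
boundary of the hole where all times are collapsed, and at the times 0 and 1, which are glued by a
monodromy that is the identity near the hole. -/
lemma openBook_eq_of_toTorus_eq {φ : RelHomeo fourHoledSphere} (hφ : m.EndsAt φ) (i : Fin 3)
    {w w' : Collar} {t t' : I} (h : toTorus w t = toTorus w' t') :
    (Quot.mk _ (⟨basePoint.1 i + w.1, Collar.mem i w⟩, t) : OpenBook φ) =
      Quot.mk _ (⟨basePoint.1 i + w'.1, Collar.mem i w'⟩, t') := by
  obtain ⟨h1, h2⟩ := Prod.ext_iff.1 h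
  replace h1 : ((4 * (‖w.1‖ - 1) : ℝ) : ℂ) * turn t = ((4 * (‖w'.1‖ - 1) : ℝ) : ℂ) * turn t' :=
    congrArg Subtype.val h1
  change direction w.1 = direction w'.1 at h2
  have hn : ‖w.1‖ = ‖w'.1‖ := by
    have := congrArg norm h1
    rw [norm_mul, norm_mul, Circle.norm_coe, Circle.norm_coe, Complex.norm_real, Complex.norm_real,
      Real.norm_of_nonneg (by linarith [w.2.1]), Real.norm_of_nonneg (by linarith [w'.2.1])] at this
    linarith
  obtain rfl : w = w' := Subtype.ext (by
    rw [← direction_mul_norm w.1, ← direction_mul_norm w'.1, hn, h2])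
  have hfix : (φ : fourHoledSphere ≃ₜ fourHoledSphere) ⟨basePoint.1 i + w.1, Collar.mem i w⟩ =
      ⟨basePoint.1 i + w.1, Collar.mem i w⟩ := by
    refine monodromy_of_near hφ (i := i) ?_
    rw [add_sub_cancel_left]
    linarith [w.2.2]
  rcases eq_or_lt_of_le w.2.1 with h1' | h1'
  · exact openBook_collapse φ _ (mem_frontier_of_hole (Collar.mem i w) (i := i)
      (by rw [add_sub_cancel_left, ← h1'])) _ _
  · have h0 : ((4 * (‖w.1‖ - 1) : ℝ) : ℂ) ≠ 0 := Complex.ofReal_ne_zero.2 (by linarith)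
    have hu : turn t = turn t' := Subtype.ext (mul_left_cancel₀ h0 h1)
    rcases turn_eq_cases hu with rfl | ⟨rfl, rfl⟩ | ⟨rfl, rfl⟩
    · rfl
    · rw [openBook_glue, hfix]
    · rw [openBook_glue, hfix]

/-- The open book of a motion is the result of the surgery along the tubes of the motion. -/
lemma exists_surgery_homeo {φ : RelHomeo fourHoledSphere} (hφ : m.EndsAt φ) :
    ∃ h : OpenBook φ ≃ₜ Surgery (tube · hm), ∀ w,
      h (Quot.mk _ (piecesToProduct w)) = Quot.mk _ (piecesToSurgery hm w) := by
  refine exists_quotHomeo isQuotientMap_piecesToProduct (isQuotientMap_piecesToSurgery hm)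
    ?_ ?_ ?_ ?_
  · rintro (⟨⟨x, t⟩, hx⟩ | ⟨i, w, t⟩) (⟨⟨x', t'⟩, hx'⟩ | ⟨j, w', t'⟩) h
    · obtain ⟨rfl, rfl⟩ := Prod.ext_iff.1 h
      rfl
    · obtain ⟨h1, rfl⟩ := Prod.ext_iff.1 h
      exact (surgery_glue hm hx t j w' (congrArg Subtype.val h1)).symm
    · obtain ⟨h1, rfl⟩ := Prod.ext_iff.1 h
      exact surgery_glue hm hx' t i w (congrArg Subtype.val h1.symm)
    · obtain ⟨h1, rfl⟩ := Prod.ext_iff.1 h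
      replace h1 : basePoint.1 i + w.1 = basePoint.1 j + w'.1 := congrArg Subtype.val h1
      obtain rfl : i = j := by
        refine eq_of_near (z := basePoint.1 i + w.1) ?_ ?_
        · rw [add_sub_cancel_left]
          linarith [w.2.2]
        · rw [h1, add_sub_cancel_left]
          linarith [w'.2.2]
      obtain rfl : w = w' := Subtype.ext (add_left_cancel h1)
      rfl
  · rintro (⟨⟨x, t⟩, hx⟩ | ⟨i, w, t⟩) (⟨⟨x', t'⟩, hx'⟩ | ⟨j, w', t'⟩) h
    · exact m.openBook_eq_of_page_eq hφ (congrArg Subtype.val (Sum.inl.inj h))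
    · cases h
    · cases h
    · obtain ⟨rfl, h1⟩ := Prod.ext_iff.1 (Sum.inr.inj h)
      exact openBook_eq_of_toTorus_eq hφ _ h1
  · rintro _ _ (x | ⟨x, hx, s, t⟩)
    · by_cases hfar : ∀ i, 5 / 4 ≤ ‖(x : ℂ) - basePoint.1 i‖
      -- The monodromy fixes every point near a hole, so by injectivity it cannot move a far point
      -- there.
      · have hfar' : ∀ i, 5 / 4 ≤
            ‖((φ : fourHoledSphere ≃ₜ fourHoledSphere) x : ℂ) - basePoint.1 i‖ := by
          intro i
          by_contra! h
          have h1 := monodromy_of_near hφ (h.le.trans (by norm_num))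
          have h2 := (φ : fourHoledSphere ≃ₜ fourHoledSphere).injective h1
          rw [h2] at h
          exact absurd h (not_lt.2 (hfar i))
        refine ⟨Sum.inl ⟨_, hfar⟩, Sum.inl ⟨(_, 0), hfar'⟩, rfl, rfl, ?_⟩
        exact congrArg _ (congrArg Sum.inl (Subtype.ext (m.page_monodromy hφ x)))
      · push Not at hfar
        obtain ⟨i, hi⟩ := hfar
        have h1 := (mem_fourHoledSphere_iff.1 x.2).2 i
        rw [monodromy_of_near hφ (hi.le.trans (by norm_num))]
        refine ⟨Sum.inr (i, ⟨x - basePoint.1 i, h1, hi.le⟩, 1),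
          Sum.inr (i, ⟨x - basePoint.1 i, h1, hi.le⟩, 0),
          Prod.ext (Subtype.ext (add_sub_cancel _ _)) rfl,
          Prod.ext (Subtype.ext (add_sub_cancel _ _)) rfl, ?_⟩
        refine congrArg _ (congrArg Sum.inr (Prod.ext rfl (Prod.ext (Subtype.ext ?_) rfl)))
        simp only [toTorus, Set.Icc.coe_one, Set.Icc.coe_zero, turn_one, turn_zero]
    -- At the outer boundary the position in S³ is a point of the axis independent of time; at a
    -- hole the disk coordinate is 0 at all times.
    · rcases frontier_cases x.2 hx with h | ⟨i, hi⟩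
      · have hfar : ∀ i, 5 / 4 ≤ ‖(x : ℂ) - basePoint.1 i‖ := fun i => by
          linarith [norm_sub_norm_le (x : ℂ) (basePoint.1 i), norm_basePoint_le i]
        refine ⟨Sum.inl ⟨(x, s), hfar⟩, Sum.inl ⟨(x, t), hfar⟩, rfl, rfl, ?_⟩
        refine congrArg _ (congrArg Sum.inl (Subtype.ext ?_))
        change m.page x s = m.page x t
        refine proj_congr ?_ ?_
        · rw [m.outer _ _ (by linarith), m.outer _ _ (by linarith)]
        · rw [height_of_eq h]
          simp
      · refine ⟨Sum.inr (i, ⟨x - basePoint.1 i, hi.ge, by rw [hi]; norm_num⟩, s),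
          Sum.inr (i, ⟨x - basePoint.1 i, hi.ge, by rw [hi]; norm_num⟩, t),
          Prod.ext (Subtype.ext (add_sub_cancel _ _)) rfl,
          Prod.ext (Subtype.ext (add_sub_cancel _ _)) rfl, ?_⟩
        refine congrArg _ (congrArg Sum.inr (Prod.ext rfl (Prod.ext (Subtype.ext ?_) rfl)))
        simp only [toTorus, hi]
        simp
  · rintro _ _ ⟨i, d, u, v, x, hd, hx⟩
    have hn : ‖((5 / 4 : ℝ) : ℂ) * v‖ = 5 / 4 := by
      rw [norm_mul, Circle.norm_coe, mul_one, Complex.norm_real]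
      norm_num
    let w : Collar := ⟨((5 / 4 : ℝ) : ℂ) * v, by rw [hn]; norm_num, hn.le⟩
    -- A glued point lies on the circle of radius 5/4, and therefore belongs to the collar and to
    -- the far part.
    have hfar : ∀ j, 5 / 4 ≤ ‖basePoint.1 i + w.1 - basePoint.1 j‖ := by
      intro j
      by_contra! h
      obtain rfl : j = i := eq_of_near (h.le.trans (by norm_num))
        (by rw [add_sub_cancel_left]; linarith [w.2.2])
      rw [add_sub_cancel_left] at h
      exact absurd h (not_lt.2 hn.ge)
    refine ⟨Sum.inr (i, w, time u), Sum.inl ⟨(⟨_, Collar.mem i w⟩, time u), hfar⟩, ?_, ?_, rfl⟩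
    · refine congrArg Sum.inr (Prod.ext rfl (Prod.ext (Subtype.ext ?_)
        (direction_real_mul (by norm_num) v)))
      change ((4 * (‖((5 / 4 : ℝ) : ℂ) * v‖ - 1) : ℝ) : ℂ) * turn (time u) = d
      rw [hn, turn_time, hd]
      norm_num
    · refine congrArg Sum.inl (Subtype.ext ?_)
      rw [hx]
      refine (m.page_eq_tubeFun (i := i) (w := v) (time u) ?_).trans ?_
      · rw [radial_of_norm_one (Circle.norm_coe _)]
      · rw [turn_time]
        rfl

/-! ### Orientation of the surgery homeomorphism -/

lemma hasLocalDegreeOne_scale {c : ℝ} (hc : 0 < c) (p : ℂ × ℝ) :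
    HasLocalDegreeOne (fun q => (q.1, c * q.2)) p := by
  refine ⟨1, one_pos, fun x => (x.2.1, c * p.2 + ((1 - x.1) * c + x.1) * (x.2.2 - p.2)), ?_, ?_, ?_,
    ?_⟩
  · exact Continuous.continuousOn (by fun_prop)
  · intro q _
    refine Prod.ext rfl ?_
    change c * p.2 + ((1 - 0) * c + 0) * (q.2 - p.2) = c * q.2
    ring
  · intro q _
    ext <;> simp
  · intro s hs q _
    have hk : 0 < (1 - s) * c + s := by
      rcases eq_or_lt_of_le hs.1 with h | h
      · rw [← h]
        linarith
      · have := mul_nonneg (sub_nonneg.2 hs.2) hc.le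
        linarith
    simp only [Prod.ext_iff, add_eq_left, mul_eq_zero, hk.ne', false_or, sub_eq_zero]

/-- The open book of the mapping class of a motion is obtained by surgery on the closure of the
pure braid of the motion. -/
lemma isDehnSurgery_trace (hm : m.Delayed) {φ ψ : RelHomeo fourHoledSphere} (hψ : m.EndsAt ψ)
    (h : mappingClass φ = mappingClass ψ) :
    IsDehnSurgery (OpenBook φ) (openBookCoord φ) m.trace.closure m.framing := by
  obtain ⟨k, hk⟩ := exists_openBook_homeo h
  obtain ⟨g, hg⟩ := exists_surgery_homeo hm hψ
  -- The test point 5i at time 1/4 is far from the holes and the outer collar and within the waiting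
  -- period. There the homeomorphism is the identity on the page and scales time by 2π.
  refine ⟨(tube · hm), fun i j hij => disjoint_range_tube hm hij, fun i => hasFraming_tube i hm,
    k.trans g, (5 * Complex.I, 1 / 4), fun q => (q.1, 2 * Real.pi * q.2), ?_,
    hasLocalDegreeOne_scale (by positivity) _⟩
  have h1 : ∀ᶠ q : ℂ × ℝ in nhds (5 * Complex.I, 1 / 4), ‖q.1 - 5 * Complex.I‖ < 1 := by
    have : Continuous fun q : ℂ × ℝ => ‖q.1 - 5 * Complex.I‖ := by fun_prop
    exact (this.tendsto _).eventually (gt_mem_nhds (by simp))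
  have h2 : ∀ᶠ q : ℂ × ℝ in nhds (5 * Complex.I, 1 / 4), 0 < q.2 ∧ q.2 < 1 / 2 :=
    (continuous_snd.tendsto _).eventually (Ioo_mem_nhds (by norm_num) (by norm_num))
  filter_upwards [h1, h2] with q hq hq'
  have h5 : ∀ i, 5 ≤ ‖5 * Complex.I - basePoint.1 i‖ := fun i => by
    have him : (5 * Complex.I - basePoint.1 i).im = 5 := by
      revert i
      refine forall_fin_three ?_ ?_ ?_ <;> simp [basePoint_zero, basePoint_one, basePoint_two]
    have := Complex.abs_im_le_norm (5 * Complex.I - basePoint.1 i)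
    rw [him] at this
    exact (le_abs_self _).trans this
  have hfar' : ∀ i, 4 < ‖q.1 - basePoint.1 i‖ := fun i => by
    have := norm_sub_le_norm_sub_add_norm_sub (5 * Complex.I) q.1 (basePoint.1 i)
    rw [norm_sub_rev] at hq
    linarith [h5 i]
  have hn : ‖q.1‖ < 6 := by
    have h6 := norm_sub_norm_le q.1 (5 * Complex.I)
    have h7 : ‖5 * Complex.I‖ = 5 := by simp
    linarith
  have hfar : ∀ i, 5 / 4 ≤ ‖q.1 - basePoint.1 i‖ := fun i => by linarith [hfar' i]
  have hmem : q.1 ∈ fourHoledSphere :=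
    mem_fourHoledSphere_iff.2 ⟨by linarith, fun i => by linarith [hfar i]⟩
  let x : fourHoledSphere := ⟨q.1, hmem⟩
  let t : I := ⟨q.2, hq'.1.le, by linarith⟩
  refine ⟨Quot.mk _ (x, t), ⟨x, t, ?_, ?_, ?_, rfl, rfl⟩,
    ⟨m.page x t, tube_ne_page hm hfar t⟩, ?_, ?_, ?_⟩
  · exact mem_interior_fourHoledSphere (by linarith) fun i => by linarith [hfar' i]
  · exact Subtype.coe_lt_coe.1 hq'.1
  · exact Subtype.coe_lt_coe.1 (show q.2 < 1 by linarith)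
  · intro i u w hw he
    have h8 := hfar' i
    have h9 : q.1 = basePoint.1 i + radial w := (m.tubeFun_eq_page he).2
    rw [h9, add_sub_cancel_left] at h8
    linarith [norm_radial_lt w]
  · change m.page x t = sphereCoord (q.1, 2 * Real.pi * q.2)
    rw [m.page_of_lt (show ‖q.1‖ < 10 by linarith), sphereCoord_turn,
      m.position_of_le t (show ‖q.1‖ ≤ 9 by linarith), hm.1 _ hq'.2.le]
  · change g (k _) = _
    rw [hk x t hq'.2.le]
    exact hg (Sum.inl ⟨(x, t), hfar⟩)

end Motion

/-! ### Homeomorphisms of the three-sphere that move the fibres of the solid torus -/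

section Displacement

variable {h : Circle → ℂ → ℂ}

lemma displace_ne_zero (h : Circle → ℂ → ℂ) (x : S3) :
    x.1 0 + ‖x.1 1‖ * h (direction (x.1 1)) (x.1 0 / ‖x.1 1‖) ≠ 0 ∨ x.1 1 ≠ 0 := by
  by_cases hx : x.1 1 = 0
  · left
    have := (s3_ne_zero x).resolve_right (not_not.2 hx)
    simpa [hx] using this
  · exact Or.inr hx

/-- The map of the three-sphere that adds `h u z` to the coordinate `z` in the fibre over `u`. -/
def displace (h : Circle → ℂ → ℂ) (x : S3) : S3 := proj _ _ (displace_ne_zero h x)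

lemma displace_cyl (u : Circle) (z : ℂ) : displace h (cyl (u, z)) = cyl (u, z + h u z) := by
  have hx := cyl_one_ne_zero (u, z)
  have hn : 0 < ‖(cyl (u, z)).1 1‖ := norm_pos_iff.2 hx
  have hc := cylInv_cyl (u, z)
  have h1 : direction ((cyl (u, z)).1 1) = u := congrArg Prod.fst hc
  have h2 : (cyl (u, z)).1 0 / ‖(cyl (u, z)).1 1‖ = z := congrArg Prod.snd hc
  have h3 := direction_mul_norm ((cyl (u, z)).1 1)
  refine proj_eq_iff.2 ⟨‖(cyl (u, z)).1 1‖, hn, ?_, ?_⟩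
  · rw [h1, h2, mul_add]
    congr 1
    have hn' : (‖(cyl (u, z)).1 1‖ : ℂ) ≠ 0 := Complex.ofReal_ne_zero.2 hn.ne'
    rw [mul_comm]
    exact (div_eq_iff hn').1 h2
  · rw [h1] at h3
    exact h3.symm

lemma displace_of_one_eq_zero {x : S3} (hx : x.1 1 = 0) : displace h x = x := by
  refine (proj_congr ?_ rfl).trans (proj_self x)
  simp [hx]

/-- The axis is fixed pointwise and each page fibre is preserved, so bijectivity is decided fibre by
fibre. -/
lemma displace_bijective {h : Circle → ℂ → ℂ}
    (hb : ∀ u, Function.Bijective fun z => z + h u z) : Function.Bijective (displace h) := by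
  have key : ∀ x : S3, x.1 1 = 0 ∨ ∃ u z, x = cyl (u, z) := fun x => by
    by_cases hx : x.1 1 = 0
    · exact Or.inl hx
    · exact Or.inr ⟨_, _, (cyl_cylInv hx).symm⟩
  refine ⟨fun x y hxy => ?_, fun y => ?_⟩
  · rcases key x with hx | ⟨u, z, rfl⟩ <;> rcases key y with hy | ⟨u', z', rfl⟩
    · rwa [displace_of_one_eq_zero hx, displace_of_one_eq_zero hy] at hxy
    · rw [displace_of_one_eq_zero hx, displace_cyl] at hxy
      exact absurd (hxy ▸ hx) (cyl_one_ne_zero _)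
    · rw [displace_of_one_eq_zero hy, displace_cyl] at hxy
      exact absurd (hxy ▸ hy) (cyl_one_ne_zero _)
    · rw [displace_cyl, displace_cyl] at hxy
      obtain ⟨rfl, h2⟩ := Prod.ext_iff.1 (cyl_injective hxy)
      rw [(hb u).1 h2]
  · rcases key y with hy | ⟨u, z, rfl⟩
    · exact ⟨y, displace_of_one_eq_zero hy⟩
    · obtain ⟨z', hz'⟩ := (hb u).2 z
      exact ⟨cyl (u, z'), by rw [displace_cyl]; exact congrArg (fun z => cyl (u, z)) hz'⟩

/-- Off the axis this is continuity in the solid torus coordinates. At the axis the added term is at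
most `‖y.1 1‖ * B`, which tends to 0; boundedness of `h` is what extends the map over the axis. -/
lemma continuous_displace (hc : Continuous fun p : Circle × ℂ => h p.1 p.2) {B : ℝ}
    (hB : ∀ u z, ‖h u z‖ ≤ B) : Continuous (displace h) := by
  have h0 := continuous_s3_apply 0
  have h1 := continuous_s3_apply 1
  refine continuous_proj (h0.add (continuous_iff_continuousAt.2 fun x => ?_)) h1 _
  by_cases hx : x.1 1 = 0
  · have hlim : Filter.Tendsto (fun y : S3 => ‖y.1 1‖ * B) (nhds x) (nhds 0) := by
      have h2 : Continuous fun y : S3 => ‖y.1 1‖ * B := h1.norm.mul continuous_const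
      simpa [hx] using h2.tendsto x
    have h3 : ((‖x.1 1‖ : ℝ) : ℂ) * h (direction (x.1 1)) (x.1 0 / ‖x.1 1‖) = 0 := by simp [hx]
    rw [ContinuousAt, h3]
    refine squeeze_zero_norm (fun y => ?_) hlim
    rw [norm_mul, Complex.norm_real, norm_norm]
    exact mul_le_mul_of_nonneg_left (hB _ _) (norm_nonneg _)
  · have h2 : ContinuousOn (fun y : S3 => h (cylInv y).1 (cylInv y).2) {y : S3 | y.1 1 ≠ 0} :=
      hc.comp_continuousOn continuousOn_cylInv
    exact (Complex.continuous_ofReal.comp h1.norm).continuousAt.mul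
      (h2.continuousAt (isOpen_s3_one_ne_zero.mem_nhds hx))

end Displacement

/-- The identity plus a contraction is a bijection. -/
lemma bijective_add_of_lipschitz {f : ℂ → ℂ} (hf : LipschitzWith (1 / 2) f) :
    Function.Bijective fun z => z + f z := by
  constructor
  · intro z w h
    have h1 := hf.dist_le_mul w z
    have h2 : z - w = f w - f z := by linear_combination h
    rw [dist_eq_norm, dist_eq_norm, ← h2, norm_sub_rev w z] at h1
    have h3 : ‖z - w‖ ≤ 0 := by
      push_cast at h1
      linarith
    exact sub_eq_zero.1 (norm_le_zero_iff.1 h3)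
  · intro ζ
    -- A solution of `z + f z = ζ` is a fixed point of this contraction.
    have hc : ContractingWith (1 / 2) fun z => ζ - f z := by
      refine ⟨by rw [← NNReal.coe_lt_coe]; norm_num, LipschitzWith.of_dist_le_mul fun z w => ?_⟩
      rw [dist_sub_left]
      exact hf.dist_le_mul z w
    refine ⟨hc.fixedPoint, ?_⟩
    have h := hc.fixedPoint_isFixedPt
    change ζ - f _ = _ at h
    exact (eq_add_of_sub_eq h).symm

/-! ### Transport of a surgery by a homeomorphism of the three-sphere -/

/-- A homeomorphism of the three-sphere that preserves the orientation in a strong sense: in the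
coordinates, it is the end of an isotopy that starts at the identity. -/
structure CoordIsotopy (g : S3 ≃ₜ S3) where
  toFun : ℝ → ℂ × ℝ → ℂ × ℝ
  continuous_toFun : Continuous fun p : ℝ × (ℂ × ℝ) => toFun p.1 p.2
  injective : ∀ s ∈ Set.Icc (0 : ℝ) 1, Function.Injective (toFun s)
  start : ∀ q, toFun 0 q = q
  finish : ∀ q, g (sphereCoord q) = sphereCoord (toFun 1 q)

namespace CoordIsotopy

variable {g : S3 ≃ₜ S3} (G : CoordIsotopy g)

/-- In the first half of the time the isotopy is run back to the identity with `f` kept fixed; in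
the second half the given homotopy of `f` is run. Subtracting the value at `f p` holds the image of
`p` fixed, and injectivity of each stage keeps other points away from it. -/
lemma hasLocalDegreeOne {f : ℂ × ℝ → ℂ × ℝ} {p : ℂ × ℝ} (hf : HasLocalDegreeOne f p) :
    HasLocalDegreeOne (fun q => G.toFun 1 (f q)) p := by
  obtain ⟨r, hr, H, hH, hH0, hH1, hHp⟩ := hf
  refine ⟨r, hr, fun x => G.toFun 1 (f p) + (G.toFun (clamp (1 - 2 * x.1))
    (H (clamp (2 * x.1 - 1), x.2)) - G.toFun (clamp (1 - 2 * x.1)) (f p)), ?_, ?_, ?_, ?_⟩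
  · have hcl := continuous_clamp
    have h1 : ContinuousOn (fun x : ℝ × (ℂ × ℝ) => H (clamp (2 * x.1 - 1), x.2))
        (Set.Icc 0 1 ×ˢ Metric.ball p r) :=
      hH.comp (by fun_prop) fun x hx => ⟨clamp_mem _, hx.2⟩
    have h2 : ContinuousOn (fun x : ℝ × (ℂ × ℝ) => clamp (1 - 2 * x.1))
        (Set.Icc 0 1 ×ˢ Metric.ball p r) := by fun_prop
    exact continuousOn_const.add ((G.continuous_toFun.comp_continuousOn (h2.prodMk h1)).sub
      (G.continuous_toFun.comp_continuousOn (h2.prodMk continuousOn_const)))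
  · intro q hq
    simp only
    rw [clamp_of_one_le (by norm_num), clamp_of_nonpos (by norm_num), hH0 q hq]
    abel
  · intro q hq
    simp only
    rw [clamp_of_nonpos (by norm_num), clamp_of_one_le (by norm_num), hH1 q hq, G.start, G.start]
    abel
  · intro s _ q hq
    simp only [add_eq_left, sub_eq_zero]
    rw [(G.injective _ (clamp_mem _)).eq_iff]
    exact hHp _ (clamp_mem _) q hq

variable {K K' : Set S3}

/-- The image of a tube. -/
def mapTube (hK : g '' K = K') (e : Tube K) : Tube K' where
  toFun p := g (e.toFun p)
  isOpenEmbedding := g.isOpenEmbedding.comp e.isOpenEmbedding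
  core := by
    rw [← hK]
    conv_lhs => rw [e.core]
    rw [← Set.range_comp]
    rfl
  orientation := by
    obtain ⟨p, f, h, hf⟩ := e.orientation
    refine ⟨p, _, ?_, G.hasLocalDegreeOne hf⟩
    filter_upwards [h] with q ⟨x, hx, hx'⟩
    refine ⟨x, hx, ?_⟩
    change g (e.toFun x) = _
    rw [show e.toFun x = sphereCoord (f q) from hx', G.finish]

/-- A framing is a relation in the first homology of the complement, and `g` maps complement to
complement, carrying longitude and meridian to those of the new tube. -/
lemma hasFraming_mapTube (hK : g '' K = K') {e : Tube K} {n : ℤ} (he : e.HasFraming n) :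
    (G.mapTube hK e).HasFraming n := by
  let c : C({x : S3 // x ∉ K}, {x : S3 // x ∉ K'}) :=
    ⟨fun x => ⟨g x, fun h => by
      rw [← hK] at h
      obtain ⟨y, hy, hyx⟩ := h
      exact x.2 (g.injective hyx ▸ hy)⟩, by fun_prop⟩
  have h := congrArg (Abelianization.map (FundamentalGroup.map c e.base)) he
  rw [map_zpow] at h
  exact h

variable {n : ℕ} {L L' : Fin n → Set S3}

/-- The homeomorphism of the exteriors. -/
def exteriorHomeo (hL : ∀ i, g '' L i = L' i) (e : ∀ i, Tube (L i)) :
    Exterior e ≃ₜ Exterior fun i => G.mapTube (hL i) (e i) :=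
  g.subtype fun x => forall₄_congr fun i u w _ => by
    change _ ↔ g ((e i).toFun (u, w)) ≠ g x
    rw [g.injective.ne_iff]

/-- The homeomorphism of the surgered manifolds. -/
def surgeryHomeo (hL : ∀ i, g '' L i = L' i) (e : ∀ i, Tube (L i)) :
    Surgery e ≃ₜ Surgery fun i => G.mapTube (hL i) (e i) :=
  quotHomeo ((G.exteriorHomeo hL e).sumCongr (Homeomorph.refl _)) (by
    rintro _ _ ⟨i, d, u, v, x, hd, hx⟩
    exact Quot.sound (SurgeryRel.glue i d u v _ hd (congrArg g hx))) (by
    rintro _ _ ⟨i, d, u, v, x, hd, hx⟩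
    refine Quot.sound (SurgeryRel.glue i d u v _ hd (g.injective ?_))
    refine Eq.trans ?_ hx
    exact congrArg Subtype.val ((G.exteriorHomeo hL e).apply_symm_apply x))

lemma isDehnSurgery (G : CoordIsotopy g) {Y : Type} [TopologicalSpace Y] {R : ℂ × ℝ → Y → Prop}
    {c : Fin n → ℤ} (hL : ∀ i, g '' L i = L' i) (h : IsDehnSurgery Y R L c) : IsDehnSurgery Y R L' c := by
  obtain ⟨e, he, hc, k, p, f, hk, hf⟩ := h
  refine ⟨fun i => G.mapTube (hL i) (e i), fun i j hij => ?_,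
    fun i => G.hasFraming_mapTube (hL i) (hc i), k.trans (G.surgeryHomeo hL e), p, _, ?_,
    G.hasLocalDegreeOne hf⟩
  · change Disjoint (Set.range (g ∘ (e i).toFun)) (Set.range (g ∘ (e j).toFun))
    rw [Set.range_comp, Set.range_comp]
    exact (Set.disjoint_image_iff g.injective).2 (he i j hij)
  · filter_upwards [hk] with q ⟨y, hy, x, hx, hqx, hyx⟩
    refine ⟨y, hy, G.exteriorHomeo hL e x, fun i u w hw h => ?_, ?_, ?_⟩
    · exact hx i u w hw (g.injective h)
    · change g x.1 = _
      rw [show x.1 = sphereCoord (f q) from hqx, G.finish]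
    · change G.surgeryHomeo hL e (k y) = _
      rw [hyx]
      rfl

end CoordIsotopy

/-! ### Isotopy invariance of the surgery -/

section Bump

variable {ι : Type*} [Fintype ι]

/-- The displacement that carries the points `x i` in the direction of the vectors `v i`, and has
support in the balls of radius `ρ` about these points. -/
def bump (x v : ι → ℂ) (ρ : ℝ) (z : ℂ) : ℂ :=
  ∑ i, (max (1 - ‖z - x i‖ / ρ) 0 : ℝ) * v i

lemma bump_apply_self {x v : ι → ℂ} {ρ : ℝ} (hρ : 0 < ρ)
    (hx : ∀ i j, i ≠ j → ρ ≤ ‖x i - x j‖) (i : ι) : bump x v ρ (x i) = v i := by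
  rw [bump, Finset.sum_eq_single i]
  · simp
  · intro j _ hj
    have h : 1 - ‖x i - x j‖ / ρ ≤ 0 := by
      rw [sub_nonpos, one_le_div hρ]
      exact hx i j hj.symm
    rw [max_eq_right h, Complex.ofReal_zero, zero_mul]
  · simp

lemma norm_bump_le (x v : ι → ℂ) {ρ : ℝ} (hρ : 0 < ρ) {r : ℝ} (hv : ∀ i, ‖v i‖ ≤ r) (z : ℂ) :
    ‖bump x v ρ z‖ ≤ Fintype.card ι * r := by
  refine (norm_sum_le_of_le _ (f := fun i => ((max (1 - ‖z - x i‖ / ρ) 0 : ℝ) : ℂ) * v i)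
    (n := fun _ => r) fun i _ => ?_).trans (by simp)
  have h1 : max (1 - ‖z - x i‖ / ρ) 0 ≤ 1 := by
    refine max_le ?_ zero_le_one
    have : 0 ≤ ‖z - x i‖ / ρ := by positivity
    linarith
  rw [norm_mul, Complex.norm_real, Real.norm_of_nonneg (le_max_right _ _)]
  exact (mul_le_of_le_one_left (norm_nonneg _) h1).trans (hv i)

/-- Each cone has slope at most 1/ρ, so each summand has Lipschitz constant `‖v i‖ / ρ`; the
hypothesis makes this at most `r` divided by the number of summands. -/
lemma lipschitzWith_bump (x v : ι → ℂ) {ρ : ℝ} (hρ : 0 < ρ) {r : NNReal}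
    (hv : ∀ i, ‖v i‖ * Fintype.card ι ≤ r * ρ) : LipschitzWith r (bump x v ρ) := by
  refine LipschitzWith.of_dist_le_mul fun z w => ?_
  rw [dist_eq_norm, dist_eq_norm, bump, bump, ← Finset.sum_sub_distrib]
  rcases isEmpty_or_nonempty ι with hι | hι
  · simp only [Finset.univ_eq_empty, Finset.sum_empty, norm_zero]
    positivity
  have hN : 0 < (Fintype.card ι : ℝ) := by exact_mod_cast Fintype.card_pos
  refine (norm_sum_le_of_le _ (n := fun _ => r / Fintype.card ι * ‖z - w‖) fun i _ => ?_).trans ?_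
  · rw [← sub_mul, ← Complex.ofReal_sub, norm_mul, Complex.norm_real, Real.norm_eq_abs]
    have h1 : |max (1 - ‖z - x i‖ / ρ) 0 - max (1 - ‖w - x i‖ / ρ) 0| ≤ ‖z - w‖ / ρ := by
      refine (abs_max_sub_max_le_abs _ _ _).trans ?_
      have h2 : 1 - ‖z - x i‖ / ρ - (1 - ‖w - x i‖ / ρ) = (‖w - x i‖ - ‖z - x i‖) / ρ := by ring
      rw [h2, abs_div, abs_of_pos hρ]
      refine div_le_div_of_nonneg_right ?_ hρ.le
      refine (abs_norm_sub_norm_le _ _).trans ?_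
      rw [sub_sub_sub_cancel_right, norm_sub_rev]
    have h3 : ‖v i‖ ≤ r * ρ / Fintype.card ι := (le_div_iff₀ hN).2 (hv i)
    calc _ ≤ ‖z - w‖ / ρ * (r * ρ / Fintype.card ι) := by gcongr
      _ = _ := by field_simp
  · rw [Finset.sum_const, Finset.card_univ, nsmul_eq_mul]
    have : (Fintype.card ι : ℝ) * (r / Fintype.card ι * ‖z - w‖) = r * ‖z - w‖ := by field_simp
    rw [this]

end Bump

/-- The position of the `i`-th strand over a point of the circle. -/
def PureBraid.strand (b : PureBraid) (i : Fin 3) (u : Circle) : ℂ := (b (time u)).1 i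

lemma PureBraid.strand_turn (b : PureBraid) (i : Fin 3) (t : I) :
    b.strand i (turn t) = (b t).1 i := by
  refine apply_time_turn (f := fun t : I => (b t).1 i) ?_ t
  rw [b.source, b.target]

lemma PureBraid.continuous_strand (b : PureBraid) (i : Fin 3) : Continuous (b.strand i) := by
  refine continuous_comp_time (f := fun t : I => (b t).1 i) ?_ ?_
  · exact (continuous_apply i).comp (continuous_subtype_val.comp b.continuous)
  · rw [b.source, b.target]

lemma PureBraid.closure_eq_range (b : PureBraid) (i : Fin 3) :
    b.closure i = Set.range fun t : I => cyl (turn t, (b t).1 i) := by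
  simp only [PureBraid.closure, sphereCoord_turn]

/-- Surgeries on the closures of nearby pure braids agree. -/
lemma IsDehnSurgery.of_near {Y : Type} [TopologicalSpace Y] {R : ℂ × ℝ → Y → Prop}
    {c : Fin 3 → ℤ} {b b' : PureBraid} {ρ : ℝ} (hρ : 0 < ρ)
    (hb : ∀ t i j, i ≠ j → ρ ≤ ‖(b t).1 i - (b t).1 j‖)
    (hb' : ∀ t i, ‖(b' t).1 i - (b t).1 i‖ ≤ ρ / 6) (h : IsDehnSurgery Y R b.closure c) :
    IsDehnSurgery Y R b'.closure c := by
  let x : Circle → Fin 3 → ℂ := fun u i => b.strand i u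
  let v : Circle → Fin 3 → ℂ := fun u i => b'.strand i u - b.strand i u
  let k : Circle → ℂ → ℂ := fun u => bump (x u) (v u) ρ
  have hk : Continuous fun p : Circle × ℂ => k p.1 p.2 := by
    refine continuous_finsetSum _ fun i _ => ?_
    have h1 := b.continuous_strand i
    have h2 := b'.continuous_strand i
    fun_prop
  have hlip : ∀ u, LipschitzWith (1 / 2) (k u) := fun u => by
    -- Three strands, each displaced by at most ρ/6, give the Lipschitz constant 3 · (1/6) = 1/2.
    -- Hence the identity plus the bump is a bijection of every fibre.
    refine lipschitzWith_bump _ _ hρ fun i => ?_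
    have := hb' (time u) i
    change ‖(b' (time u)).1 i - (b (time u)).1 i‖ * _ ≤ _
    rw [Fintype.card_fin]
    push_cast
    linarith
  have hscale : ∀ u, ∀ s ∈ Set.Icc (0 : ℝ) 1,
      LipschitzWith (1 / 2) fun z => (s : ℂ) * k u z := fun u s hs => by
    refine LipschitzWith.of_dist_le_mul fun z w => ?_
    rw [dist_eq_norm, ← mul_sub, norm_mul, Complex.norm_real, Real.norm_of_nonneg hs.1,
      ← dist_eq_norm]
    exact (mul_le_of_le_one_left dist_nonneg hs.2).trans ((hlip u).dist_le_mul z w)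
  have hbound : ∀ u z, ‖k u z‖ ≤ Fintype.card (Fin 3) * (ρ / 6) := fun u z =>
    norm_bump_le _ _ hρ (fun i => hb' (time u) i) z
  let g : S3 ≃ₜ S3 := (continuous_displace hk hbound).homeoOfEquivCompactToT2
    (f := Equiv.ofBijective _ (displace_bijective fun u => bijective_add_of_lipschitz (hlip u)))
  have hg : ∀ u z, g (cyl (u, z)) = cyl (u, z + k u z) := displace_cyl
  -- Scaling the displacement by `s` in the unit interval keeps it a contraction, so all stages are
  -- injective and join the identity to `g`.
  let G : CoordIsotopy g :=
    { toFun := fun s q => (q.1 + s * k (Circle.exp q.2) q.1, q.2)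
      continuous_toFun := by
        have h1 : Continuous fun p : ℝ × (ℂ × ℝ) => k (Circle.exp p.2.2) p.2.1 :=
          hk.comp (f := fun p : ℝ × (ℂ × ℝ) => (Circle.exp p.2.2, p.2.1)) (by fun_prop)
        fun_prop
      injective := fun s hs q q' hq => by
        obtain ⟨h1, h2⟩ := Prod.ext_iff.1 hq
        change q.2 = q'.2 at h2
        simp only [h2] at h1
        exact Prod.ext ((bijective_add_of_lipschitz (hscale _ s hs)).1 h1) h2
      start := fun q => by simp
      finish := fun q => by
        obtain ⟨z, θ⟩ := q
        rw [sphereCoord_eq_cyl, sphereCoord_eq_cyl, hg, Complex.ofReal_one, one_mul] }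
  refine G.isDehnSurgery (fun i => ?_) h
  rw [b.closure_eq_range, b'.closure_eq_range, ← Set.range_comp]
  congr 1
  funext t
  rw [Function.comp_apply, hg]
  have hx : x (turn t) i = (b t).1 i := b.strand_turn i t
  have hv : v (turn t) i = (b' t).1 i - (b t).1 i := by
    change b'.strand i (turn t) - b.strand i (turn t) = _
    rw [b.strand_turn, b'.strand_turn]
  have hkx : k (turn t) ((b t).1 i) = (b' t).1 i - (b t).1 i := by
    rw [← hv, ← hx]
    exact bump_apply_self hρ (fun i j hij => hb (time (turn t)) i j hij) i
  rw [hkx, add_sub_cancel]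

/-- The surgery depends only on the isotopy class of the braid. -/
lemma IsDehnSurgery.of_homotopic {Y : Type} [TopologicalSpace Y] {R : ℂ × ℝ → Y → Prop}
    {c : Fin 3 → ℤ} {b b' : PureBraid} (hbb' : Path.Homotopic b b')
    (h : IsDehnSurgery Y R b.closure c) : IsDehnSurgery Y R b'.closure c := by
  obtain ⟨F⟩ := hbb'
  let gap : Conf → ℝ := fun x => min ‖x.1 0 - x.1 1‖ (min ‖x.1 0 - x.1 2‖ ‖x.1 1 - x.1 2‖)
  have hgap : Continuous gap := by
    have h1 : ∀ i, Continuous fun x : Conf => x.1 i := fun i =>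
      (continuous_apply i).comp continuous_subtype_val
    have h2 : ∀ i j, Continuous fun x : Conf => ‖x.1 i - x.1 j‖ := fun i j =>
      ((h1 i).sub (h1 j)).norm
    exact (h2 0 1).min ((h2 0 2).min (h2 1 2))
  have hpos : ∀ x, 0 < gap x := fun x => by
    have h1 : ∀ i j, i ≠ j → 0 < ‖x.1 i - x.1 j‖ := fun i j hij =>
      norm_pos_iff.2 (sub_ne_zero.2 fun h => hij (x.2 h))
    exact lt_min (h1 _ _ (by decide)) (lt_min (h1 _ _ (by decide)) (h1 _ _ (by decide)))
  have hle : ∀ x : Conf, ∀ i j, i ≠ j → gap x ≤ ‖x.1 i - x.1 j‖ := fun x => by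
    have key : ∀ i j : Fin 3, i < j → gap x ≤ ‖x.1 i - x.1 j‖ := fun i j hij => by
      rcases pair_cases hij with ⟨rfl, rfl⟩ | ⟨rfl, rfl⟩ | ⟨rfl, rfl⟩
      · exact min_le_left _ _
      · exact (min_le_right _ _).trans (min_le_left _ _)
      · exact (min_le_right _ _).trans (min_le_right _ _)
    intro i j hij
    rcases lt_or_gt_of_ne hij with h | h
    · exact key i j h
    · rw [norm_sub_rev]
      exact key j i h
  -- Compactness gives a positive lower bound for the distance of the strands, uniform over the
  -- homotopy.
  obtain ⟨p, -, hp⟩ := isCompact_univ.exists_isMinOn (Set.univ_nonempty (α := I × I))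
    (hgap.comp F.continuous).continuousOn
  have hsep : ∀ s t i j, i ≠ j → gap (F p) ≤ ‖(F.eval s t).1 i - (F.eval s t).1 j‖ :=
    fun s t i j hij => (hp (Set.mem_univ (s, t))).trans (hle _ i j hij)
  -- Neighbouring stages are closer than a sixth of the gap, so the truth of the surgery statement
  -- is locally constant along the connected interval.
  have hlc : IsLocallyConstant fun s : I => IsDehnSurgery Y R (PureBraid.closure (F.eval s)) c := by
    refine (IsLocallyConstant.iff_eventually_eq _).2 fun s => ?_
    have hc : Continuous fun s : I => F.toHomotopy.curry s := F.toHomotopy.curry.continuous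
    filter_upwards [(hc.tendsto s).eventually (Metric.ball_mem_nhds _
      (div_pos (hpos (F p)) (by norm_num : (0 : ℝ) < 6)))] with s' hs'
    have hclose : ∀ t i, ‖(F.eval s' t).1 i - (F.eval s t).1 i‖ ≤ gap (F p) / 6 := fun t i => by
      rw [← dist_eq_norm]
      exact (dist_le_pi_dist (F.eval s' t).1 (F.eval s t).1 i).trans
        ((ContinuousMap.dist_apply_le_dist t).trans (Metric.mem_ball.1 hs').le)
    refine propext ⟨IsDehnSurgery.of_near (hpos (F p)) (hsep s') fun t i => ?_,
      IsDehnSurgery.of_near (hpos (F p)) (hsep s) hclose⟩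
    rw [norm_sub_rev]
    exact hclose t i
  have key := hlc.apply_eq_of_preconnectedSpace 0 1
  simp only [F.eval_zero, F.eval_one] at key
  exact key ▸ h

end OpenBookSurgery

end

/-! ### Assembly of the theorem -/

open OpenBookSurgery

theorem proposition2p2 (α β γ δ : ℤ) (k : ℕ) (ε η : Fin k → ℤ)
    (φ : OpenBookSurgery.RelHomeo OpenBookSurgery.fourHoledSphere)
    (hφ : OpenBookSurgery.mappingClass φ =
      OpenBookSurgery.τa ^ α * OpenBookSurgery.τb ^ β * OpenBookSurgery.τc ^ γ *
        OpenBookSurgery.τd ^ δ *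
        (List.ofFn fun i => OpenBookSurgery.τe ^ ε i * OpenBookSurgery.τf ^ η i).prod)
    (word : OpenBookSurgery.BraidGroup)
    (hword : word =
      (OpenBookSurgery.σ₂ * OpenBookSurgery.σ₁ * OpenBookSurgery.σ₂) ^ (2 * δ) *
        (List.ofFn fun i =>
          OpenBookSurgery.σ₁ ^ (2 * ε i) * OpenBookSurgery.σ₂ ^ (2 * η i)).prod) :
    (∃ b : OpenBookSurgery.PureBraid, b.toBraid = word) ∧
    ∀ b : OpenBookSurgery.PureBraid, b.toBraid = word →
      OpenBookSurgery.IsDehnSurgery (OpenBookSurgery.OpenBook φ)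
        (OpenBookSurgery.openBookCoord φ) b.closure
        ![α + δ + (∑ i, ε i), β + δ + (∑ i, ε i) + (∑ i, η i), γ + δ + (∑ i, η i)] := by
  obtain ⟨ψ, hψ, m, hend, htrace, hframing⟩ := exists_realized_monodromy α β γ δ ε η
  have hm : m.trace.toBraid = word := by
    rw [← pureToBraid_toPure, htrace, pureToBraid_monodromyPure, hword]
  refine ⟨⟨m.trace, hm⟩, fun b hb => ?_⟩
  -- The delayed motion has the same pure braid class, end map and framings, and it meets the
  -- waiting condition of the surgery statement.
  have hdelay : (Motion.still.concat m).trace.toPure = m.trace.toPure := by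
    have hstill : Motion.still.trace = Path.refl basePoint := rfl
    rw [Motion.trace_concat, hstill, toPure_trans, toPure_refl, one_mul]
  -- An arbitrary geometric representative is compared with the trace of the motion: equality in the
  -- braid group becomes a homotopy of pure braids, along which the surgery is transported.
  have hhom : Path.Homotopic (Motion.still.concat m).trace b := by
    rw [← toPure_eq_iff, hdelay]
    apply pureToBraid_injective
    rw [pureToBraid_toPure, pureToBraid_toPure, hm, hb]
  have hend' : (Motion.still.concat m).EndsAt ψ := fun x =>
    (m.finish (2 * 1 - 1) (by norm_num) x).trans (hend x)
  have hsurg := Motion.isDehnSurgery_trace m.delayed_concat_still hend' (hφ.trans hψ.symm)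
  have hfr : (Motion.still.concat m).framing = m.framing := funext fun i => zero_add _
  rw [hfr, hframing] at hsurg
  exact hsurg.of_homotopic hhom
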